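/- Let $\mathcal V$ be the symmetric monoidal closed category $\mathcal M_k$ of modules over a commutative ring $k$ (with $\otimes_k$), or $\mathsf{Ab}$ (with $\otimes_{\mathbb Z}$), or $\mathsf{Set}$ (with the cartesian product), and write $i$ for its unit object. Let $(\mathcal C,\otimes,e)$ be a $\mathcal V$-monoidal $\mathcal V$-category (a monoidal category that is, respectively, $k$-linear with $k$-bilinear tensor product, preadditive with biadditive tensor product, or arbitrary), with unit constraints $\mathbf l_a\colon e\otimes a\to a$ and $\mathbf r_a\colon a\otimes e\to a$. **Conventions.** 1. *Bimodules.* For a monoid $R$ in $\mathcal V$, ${}_R\mathcal V_R$ is the monoidal category of $R$-$R$-bimodules with tensor product $\otimes_R$ (a coequalizer) and unit object $R$. The forgetful functor $\Gamma^R\colon{}_R\mathcal V_R\to\mathcal V$ is (lax) monoidal via the canonical epimorphisms $X\otimes Y\to X\otimes_RY$ and the unit $i\to R$ of $R$. 2. *Essentially strong functors.* Let $G\colon\mathcal C\to\mathcal V$ be a (lax) monoidal functor with structure maps $G_{a,b}\colon Ga\otimes Gb\to G(a\otimes b)$ and $G_0\colon i\to Ge$. Then $Ge$ is a monoid, with multiplication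 $G\mathbf l_e\circ G_{e,e}$ and unit $G_0$; each $Ga$ is a $Ge$-$Ge$-bimodule via $G\mathbf l_a\circ G_{e,a}$ and $G\mathbf r_a\circ G_{a,e}$; and $G_{a,b}$ factors uniquely through $U_{a,b}\colon Ga\otimes_{Ge}Gb\to G(a\otimes b)$. This defines a monoidal functor $U\colon\mathcal C\to{}_{Ge}\mathcal V_{Ge}$, with unit constraint $U_0=\mathrm{id}_{Ge}$ and $G=\Gamma^{Ge}U$. The functor $G$ is *essentially strong* if $U$ is strong, i.e. if $U_0$ and all $U_{a,b}$ are isomorphisms. 3. *Right bialgebroids.* A right bialgebroid over a monoid $R$ in $\mathcal V$ consists of a monoid $A$ in $\mathcal V$, monoid morphisms $s\colon R\to A$ and $t\colon R^{\mathrm{op}}\to A$ with commuting images, and a comonoid structure $(\delta,\varepsilon)$ in ${}_R\mathcal V_R$ on the bimodule $A$ with $r\cdot a=a\,t(r)$ and $a\cdot r=a\,s(r)$, such that the following hold, where $\delta(a)=a_{(1)}\otimes_Ra_{(2)}$. - $\delta$ takes values in the Takeuchi product $A\times_RA\subseteq A\otimes_RA$, the joint equalizer, over all elements $\rho$ of $R$,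 of the pairs $(s(\rho)\cdot)\otimes_RA$ and $A\otimes_R(t(\rho)\cdot)$. - $\delta$ is multiplicative and unital for the product $(a\otimes_Ra')(b\otimes_Rb')=ab\otimes_Ra'b'$ on $A\times_RA$. - $\varepsilon(1)=1$ and $\varepsilon(s(\varepsilon(a))b)=\varepsilon(ab)=\varepsilon(t(\varepsilon(a))b)$. 4. *Modules over a right bialgebroid.* The category $\mathcal V_A$ of right $A$-modules in $\mathcal V$ is then monoidal. The tensor product of $X$ and $Y$ is $X\otimes_RY$ with $(x\otimes_Ry)a=xa_{(1)}\otimes_Rya_{(2)}$, the unit object is $R$ with $r\triangleleft a=\varepsilon(s(r)a)$, and the coherence isomorphisms are those of ${}_R\mathcal V_R$. Here a right $A$-module $X$ is regarded as a bimodule by $r\cdot x=x\,t(r)$ and $x\cdot r=x\,s(r)$. This defines the strict monoidal forgetful functor $\Phi^A\colon\mathcal V_A\to{}_R\mathcal V_R$. **Theorem.** Let $G\colon\mathcal C\to\mathcal V$ be an essentially strong monoidal $\mathcal V$-functor which is represented by an object $g$, i.e. there is a $\mathcal V$-natural isomorphism $\varphi\colon\mathcal C(g,-)\cong G$. Then: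 * There is a comonoid structure $(\gamma,\pi)$ on $g$ such that $\varphi((\alpha\otimes\beta)\circ\gamma)=G_{a,b}(\varphi(\alpha)\otimes\varphi(\beta))$ for all $\alpha\colon g\to a$ and $\beta\colon g\to b$, and $\varphi(\pi)=G_0$ (for $\mathcal V=\mathcal M_k,\mathsf{Ab},\mathsf{Set}$ the latter means that $\varphi(\pi)$ is the image under $G_0$ of $1\in k$, of $1\in\mathbb Z$, or of the unique point). * Let $R=\mathcal C(g,e)$ be the convolution monoid in $\mathcal V$, with $\rho*\rho'=\mathbf l_e\circ(\rho\otimes\rho')\circ\gamma$ and unit $\pi$, and let $A=\mathcal C(g,g)$ be the endomorphism monoid in $\mathcal V$, with multiplication $\alpha\circ\beta$. Then $A$ has a structure of right bialgebroid over $R$ with $s(\rho)=\mathbf r_g\circ(g\otimes\rho)\circ\gamma$ and $t(\rho)=\mathbf l_g\circ(\rho\otimes g)\circ\gamma$. * For this bialgebroid there are a strong monoidal $\mathcal V$-functor $K\colon\mathcal C\to\mathcal V_A$ and a monoidal natural isomorphism $$G\;\cong\;\Gamma^R\,\Phi^A\,K .$$ -/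

import Mathlib

open CategoryTheory MonoidalCategory Limits

universe w v u

set_option linter.unusedSectionVars false
set_option linter.unusedVariables false

namespace BGD

/-- The monoidal unit is a generator: parallel morphisms agreeing on all elements `𝟙_ V ⟶ X`
are equal. -/
class UnitSeparates (V : Type u) [Category.{v} V] [MonoidalCategory V] : Prop where
  isSeparator : IsSeparator (𝟙_ V)

section Elements

variable {V : Type u} [Category.{v} V] [MonoidalCategory V]

/-- The element `x ⊗ y` of `X ⊗ Y`, for elements `x` of `X` and `y` of `Y`. -/
def tm {X Y : V} (x : 𝟙_ V ⟶ X) (y : 𝟙_ V ⟶ Y) : 𝟙_ V ⟶ X ⊗ Y :=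
  (λ_ (𝟙_ V)).inv ≫ (x ⊗ₘ y)

theorem tm_tensorHom {X Y X' Y' : V} (x : 𝟙_ V ⟶ X) (y : 𝟙_ V ⟶ Y) (f : X ⟶ X') (g : Y ⟶ Y') :
    tm x y ≫ (f ⊗ₘ g) = tm (x ≫ f) (y ≫ g) := by
  simp [tm]

theorem tm_whiskerLeft {X Y Y' : V} (x : 𝟙_ V ⟶ X) (y : 𝟙_ V ⟶ Y) (g : Y ⟶ Y') :
    tm x y ≫ (X ◁ g) = tm x (y ≫ g) := by
  rw [← id_tensorHom, tm_tensorHom, Category.comp_id]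

theorem tm_whiskerRight {X X' Y : V} (x : 𝟙_ V ⟶ X) (y : 𝟙_ V ⟶ Y) (f : X ⟶ X') :
    tm x y ≫ (f ▷ Y) = tm (x ≫ f) y := by
  rw [← tensorHom_id, tm_tensorHom, Category.comp_id]

theorem tm_associator_hom {X Y Z : V} (x : 𝟙_ V ⟶ X) (y : 𝟙_ V ⟶ Y) (z : 𝟙_ V ⟶ Z) :
    tm (tm x y) z ≫ (α_ X Y Z).hom = tm x (tm y z) := by
  simp only [tm]
  have h1 : (((λ_ (𝟙_ V)).inv ≫ (x ⊗ₘ y)) ⊗ₘ z) =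
      (λ_ (𝟙_ V)).inv ▷ 𝟙_ V ≫ ((x ⊗ₘ y) ⊗ₘ z) := by
    rw [← tensorHom_id, tensorHom_comp_tensorHom, Category.id_comp]
  have h2 : (x ⊗ₘ ((λ_ (𝟙_ V)).inv ≫ (y ⊗ₘ z))) =
      𝟙_ V ◁ (λ_ (𝟙_ V)).inv ≫ (x ⊗ₘ (y ⊗ₘ z)) := by
    rw [← id_tensorHom, tensorHom_comp_tensorHom, Category.id_comp]
  rw [h1, h2, Category.assoc, Category.assoc, associator_naturality]
  monoidal

theorem tm_associator_inv {X Y Z : V} (x : 𝟙_ V ⟶ X) (y : 𝟙_ V ⟶ Y) (z : 𝟙_ V ⟶ Z) :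
    tm x (tm y z) ≫ (α_ X Y Z).inv = tm (tm x y) z := by
  rw [← tm_associator_hom, Category.assoc, Iso.hom_inv_id, Category.comp_id]

theorem tm_leftUnitor_hom {X : V} (x : 𝟙_ V ⟶ X) : tm (𝟙 (𝟙_ V)) x ≫ (λ_ X).hom = x := by
  simp [tm]

theorem tm_rightUnitor_hom {X : V} (x : 𝟙_ V ⟶ X) : tm x (𝟙 (𝟙_ V)) ≫ (ρ_ X).hom = x := by
  simp [tm, unitors_inv_equal]

theorem el_leftUnitor_inv {X : V} (x : 𝟙_ V ⟶ X) : x ≫ (λ_ X).inv = tm (𝟙 (𝟙_ V)) x := by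
  rw [Iso.comp_inv_eq, tm_leftUnitor_hom]

theorem el_rightUnitor_inv {X : V} (x : 𝟙_ V ⟶ X) : x ≫ (ρ_ X).inv = tm x (𝟙 (𝟙_ V)) := by
  rw [Iso.comp_inv_eq, tm_rightUnitor_hom]

theorem tm_braiding [BraidedCategory V] {X Y : V} (x : 𝟙_ V ⟶ X) (y : 𝟙_ V ⟶ Y) :
    tm x y ≫ (β_ X Y).hom = tm y x := by
  simp [tm, unitors_inv_equal]

theorem tm_tensorμ [BraidedCategory V] {X Y Z W : V} (x : 𝟙_ V ⟶ X) (y : 𝟙_ V ⟶ Y)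
    (z : 𝟙_ V ⟶ Z) (t : 𝟙_ V ⟶ W) :
    tm (tm x y) (tm z t) ≫ tensorμ X Y Z W = tm (tm x z) (tm y t) := by
  simp only [tensorμ, ← Category.assoc, tm_associator_hom, tm_whiskerLeft, tm_associator_inv,
    tm_whiskerRight, tm_braiding]

/-- `x ↦ x ⊗ y` for a fixed element `y`. -/
def insR (X : V) {Y : V} (y : 𝟙_ V ⟶ Y) : X ⟶ X ⊗ Y := (ρ_ X).inv ≫ X ◁ y

/-- `y ↦ x ⊗ y` for a fixed element `x`. -/
def insL {X : V} (x : 𝟙_ V ⟶ X) (Y : V) : Y ⟶ X ⊗ Y := (λ_ Y).inv ≫ x ▷ Y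

theorem el_insR {X Y : V} (x : 𝟙_ V ⟶ X) (y : 𝟙_ V ⟶ Y) : x ≫ insR X y = tm x y := by
  rw [insR, ← Category.assoc, el_rightUnitor_inv, tm_whiskerLeft, Category.id_comp]

theorem el_insL {X Y : V} (x : 𝟙_ V ⟶ X) (y : 𝟙_ V ⟶ Y) : y ≫ insL x Y = tm x y := by
  rw [insL, ← Category.assoc, el_leftUnitor_inv, tm_whiskerRight, Category.id_comp]

variable [UnitSeparates V]

/-- Morphisms are determined by their values on elements. -/
theorem el_ext {X Y : V} {f g : X ⟶ Y} (h : ∀ x : 𝟙_ V ⟶ X, x ≫ f = x ≫ g) : f = g :=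
  UnitSeparates.isSeparator.def f g h

theorem ext_insR [MonoidalClosed V] {X Y Z : V} {f g : X ⊗ Y ⟶ Z}
    (h : ∀ y : 𝟙_ V ⟶ Y, insR X y ≫ f = insR X y ≫ g) : f = g := by
  apply MonoidalClosed.curry_injective
  refine el_ext fun y => ?_
  rw [← MonoidalClosed.curry_natural_left, ← MonoidalClosed.curry_natural_left]
  congr 1
  have := h y
  simp only [insR, Category.assoc] at this
  exact (cancel_epi _).1 this

theorem ext_insL [MonoidalClosed V] [BraidedCategory V] {X Y Z : V} {f g : X ⊗ Y ⟶ Z}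
    (h : ∀ x : 𝟙_ V ⟶ X, insL x Y ≫ f = insL x Y ≫ g) : f = g := by
  rw [← cancel_epi (β_ Y X).hom]
  refine ext_insR fun x => ?_
  have : insR Y x ≫ (β_ Y X).hom = insL x Y := by
    refine el_ext fun y => ?_
    rw [← Category.assoc, el_insR, tm_braiding, el_insL]
  rw [← Category.assoc, ← Category.assoc, this, h]

/-- Morphisms out of `X ⊗ Y` are determined by their values on the elements `x ⊗ y`. -/
theorem tm_ext [MonoidalClosed V] {X Y Z : V} {f g : X ⊗ Y ⟶ Z}
    (h : ∀ (x : 𝟙_ V ⟶ X) (y : 𝟙_ V ⟶ Y), tm x y ≫ f = tm x y ≫ g) : f = g := by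
  refine ext_insR fun y => el_ext fun x => ?_
  rw [← Category.assoc, ← Category.assoc, el_insR, h]

theorem tm_ext₃ [MonoidalClosed V] {X Y Z W : V} {f g : (X ⊗ Y) ⊗ Z ⟶ W}
    (h : ∀ (x : 𝟙_ V ⟶ X) (y : 𝟙_ V ⟶ Y) (z : 𝟙_ V ⟶ Z),
      tm (tm x y) z ≫ f = tm (tm x y) z ≫ g) : f = g := by
  refine ext_insR fun z => tm_ext fun x y => ?_
  rw [← Category.assoc, ← Category.assoc, el_insR, h]

end Elements

section Bimodules

variable {V : Type u} [Category.{v} V] [MonoidalCategory V] [HasCoequalizers V]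
  [∀ X : V, PreservesColimitsOfSize.{0, 0} (tensorLeft X)]
  [∀ X : V, PreservesColimitsOfSize.{0, 0} (tensorRight X)]

/-- The monoidal category of `R`-`R`-bimodules in `V`, with tensor product `⊗_R` and unit `R`. -/
noncomputable instance bimodMonoidal (R : Mon V) : MonoidalCategory (Bimod R R) where
  tensorObj M N := Bimod.tensorBimod M N
  tensorUnit := Bimod.regular R
  whiskerLeft M _ _ f := Bimod.whiskerLeft M f
  whiskerRight f N := Bimod.whiskerRight f N
  tensorHom f g := Bimod.whiskerRight f _ ≫ Bimod.whiskerLeft _ g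
  associator := Bimod.associatorBimod
  leftUnitor := Bimod.leftUnitorBimod
  rightUnitor := Bimod.rightUnitorBimod
  tensorHom_def _ _ := rfl
  id_tensorHom_id M N := by
    rw [Bimod.whiskerLeft_id_bimod, Bimod.id_whiskerRight_bimod, Category.comp_id]
  tensorHom_comp_tensorHom f g h k := by
    rw [Bimod.whiskerLeft_comp_bimod, Bimod.comp_whiskerRight_bimod, Category.assoc,
      Category.assoc]
    congr 1
    rw [← Category.assoc, Bimod.whisker_exchange_bimod, Category.assoc]
  whiskerLeft_id _ _ := Bimod.whiskerLeft_id_bimod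
  id_whiskerRight _ _ := Bimod.id_whiskerRight_bimod
  associator_naturality {X₁ X₂ X₃ Y₁ Y₂ Y₃} f g h := by
    rw [Bimod.comp_whiskerRight_bimod, Bimod.whiskerLeft_comp_bimod,
      Bimod.whiskerRight_comp_bimod, Bimod.comp_whiskerLeft_bimod, Bimod.whisker_assoc_bimod]
    simp only [Category.assoc, Iso.inv_hom_id, Iso.hom_inv_id_assoc, Iso.inv_hom_id_assoc,
      Category.comp_id]
  leftUnitor_naturality f := by
    rw [Bimod.id_whiskerLeft_bimod]; simp
  rightUnitor_naturality f := by
    rw [Bimod.whiskerRight_id_bimod]; simp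
  pentagon := Bimod.pentagon_bimod
  triangle := Bimod.triangle_bimod

variable {R : Mon V}

/-- The canonical epimorphism `P ⊗ Q ⟶ P ⊗_R Q`. -/
noncomputable def tπ (P Q : Bimod R R) : P.X ⊗ Q.X ⟶ (P ⊗ Q : Bimod R R).X :=
  coequalizer.π (P.actRight ▷ Q.X) ((α_ _ _ _).hom ≫ (P.X ◁ Q.actLeft))

theorem tπ_cond (P Q : Bimod R R) :
    P.actRight ▷ Q.X ≫ tπ P Q = (α_ _ _ _).hom ≫ (P.X ◁ Q.actLeft) ≫ tπ P Q := by
  have := coequalizer.condition (P.actRight ▷ Q.X) ((α_ _ _ _).hom ≫ (P.X ◁ Q.actLeft))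
  rw [Category.assoc] at this
  exact this

theorem tπ_hom_ext {P Q : Bimod R R} {W : V} {f g : (P ⊗ Q : Bimod R R).X ⟶ W}
    (h : tπ P Q ≫ f = tπ P Q ≫ g) : f = g :=
  coequalizer.hom_ext h

theorem whiskerLeft_tπ_ext {P Q : Bimod R R} {Z W : V} {f g : Z ⊗ (P ⊗ Q : Bimod R R).X ⟶ W}
    (h : Z ◁ tπ P Q ≫ f = Z ◁ tπ P Q ≫ g) : f = g :=
  (cancel_epi ((tensorLeft Z).map
    (coequalizer.π (P.actRight ▷ Q.X) ((α_ _ _ _).hom ≫ (P.X ◁ Q.actLeft))))).1 h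

theorem whiskerRight_tπ_ext {P Q : Bimod R R} {Z W : V} {f g : (P ⊗ Q : Bimod R R).X ⊗ Z ⟶ W}
    (h : tπ P Q ▷ Z ≫ f = tπ P Q ▷ Z ≫ g) : f = g :=
  (cancel_epi ((tensorRight Z).map
    (coequalizer.π (P.actRight ▷ Q.X) ((α_ _ _ _).hom ≫ (P.X ◁ Q.actLeft))))).1 h

/-- The morphism out of `P ⊗_R Q` induced by an `R`-balanced morphism out of `P ⊗ Q`. -/
noncomputable def tdesc {P Q : Bimod R R} {W : V} (f : P.X ⊗ Q.X ⟶ W)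
    (h : P.actRight ▷ Q.X ≫ f = (α_ _ _ _).hom ≫ (P.X ◁ Q.actLeft) ≫ f) :
    (P ⊗ Q : Bimod R R).X ⟶ W :=
  coequalizer.desc f (by rw [h, Category.assoc])

theorem tπ_tdesc {P Q : Bimod R R} {W : V} (f : P.X ⊗ Q.X ⟶ W)
    (h : P.actRight ▷ Q.X ≫ f = (α_ _ _ _).hom ≫ (P.X ◁ Q.actLeft) ≫ f) :
    tπ P Q ≫ tdesc f h = f :=
  coequalizer.π_desc _ _

/-- The morphism out of `(P ⊗_R Q) ⊗ Z` induced by an `R`-balanced morphism. -/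
noncomputable def tdescR {P Q : Bimod R R} {Z W : V} (f : (P.X ⊗ Q.X) ⊗ Z ⟶ W)
    (h : P.actRight ▷ Q.X ▷ Z ≫ f = (α_ _ _ _).hom ▷ Z ≫ (P.X ◁ Q.actLeft) ▷ Z ≫ f) :
    (P ⊗ Q : Bimod R R).X ⊗ Z ⟶ W :=
  (PreservesCoequalizer.iso (tensorRight Z) _ _).inv ≫
    coequalizer.desc f (by
      dsimp
      rw [h, comp_whiskerRight, Category.assoc])

theorem tπ_tdescR {P Q : Bimod R R} {Z W : V} (f : (P.X ⊗ Q.X) ⊗ Z ⟶ W)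
    (h : P.actRight ▷ Q.X ▷ Z ≫ f = (α_ _ _ _).hom ▷ Z ≫ (P.X ◁ Q.actLeft) ▷ Z ≫ f) :
    tπ P Q ▷ Z ≫ tdescR f h = f :=
  π_tensor_id_preserves_coequalizer_inv_desc _ _ _ _

/-- The morphism out of `Z ⊗ (P ⊗_R Q)` induced by an `R`-balanced morphism. -/
noncomputable def tdescL {P Q : Bimod R R} {Z W : V} (f : Z ⊗ (P.X ⊗ Q.X) ⟶ W)
    (h : Z ◁ P.actRight ▷ Q.X ≫ f = Z ◁ (α_ _ _ _).hom ≫ Z ◁ (P.X ◁ Q.actLeft) ≫ f) :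
    Z ⊗ (P ⊗ Q : Bimod R R).X ⟶ W :=
  (PreservesCoequalizer.iso (tensorLeft Z) _ _).inv ≫
    coequalizer.desc f (by
      dsimp
      rw [h, MonoidalCategory.whiskerLeft_comp, Category.assoc])

theorem tπ_tdescL {P Q : Bimod R R} {Z W : V} (f : Z ⊗ (P.X ⊗ Q.X) ⟶ W)
    (h : Z ◁ P.actRight ▷ Q.X ≫ f = Z ◁ (α_ _ _ _).hom ≫ Z ◁ (P.X ◁ Q.actLeft) ≫ f) :
    Z ◁ tπ P Q ≫ tdescL f h = f :=
  id_tensor_π_preserves_coequalizer_inv_desc _ _ _ _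

theorem tπ_actLeft (P Q : Bimod R R) :
    R.X ◁ tπ P Q ≫ (P ⊗ Q : Bimod R R).actLeft =
      (α_ _ _ _).inv ≫ P.actLeft ▷ Q.X ≫ tπ P Q :=
  Bimod.TensorBimod.whiskerLeft_π_actLeft P Q

theorem tπ_actRight (P Q : Bimod R R) :
    tπ P Q ▷ R.X ≫ (P ⊗ Q : Bimod R R).actRight =
      (α_ _ _ _).hom ≫ P.X ◁ Q.actRight ≫ tπ P Q :=
  Bimod.TensorBimod.π_tensor_id_actRight P Q

theorem tπ_whiskerLeft (P : Bimod R R) {Q Q' : Bimod R R} (f : Q ⟶ Q') :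
    tπ P Q ≫ (P ◁ f).hom = P.X ◁ f.hom ≫ tπ P Q' :=
  ι_colimMap _ WalkingParallelPair.one

theorem tπ_whiskerRight {P P' : Bimod R R} (f : P ⟶ P') (Q : Bimod R R) :
    tπ P Q ≫ (f ▷ Q).hom = f.hom ▷ Q.X ≫ tπ P' Q :=
  ι_colimMap _ WalkingParallelPair.one

theorem tπ_tensorHom {P P' Q Q' : Bimod R R} (f : P ⟶ P') (g : Q ⟶ Q') :
    tπ P Q ≫ (f ⊗ₘ g).hom = (f.hom ⊗ₘ g.hom) ≫ tπ P' Q' := by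
  rw [MonoidalCategory.tensorHom_def, Bimod.comp_hom', ← Category.assoc, tπ_whiskerRight,
    Category.assoc, tπ_whiskerLeft, MonoidalCategory.tensorHom_def, Category.assoc]

theorem tπ_leftUnitor (P : Bimod R R) : tπ (𝟙_ (Bimod R R)) P ≫ (λ_ P).hom.hom = P.actLeft :=
  coequalizer.π_desc _ _

theorem tπ_rightUnitor (P : Bimod R R) : tπ P (𝟙_ (Bimod R R)) ≫ (ρ_ P).hom.hom = P.actRight :=
  coequalizer.π_desc _ _

theorem tπ_associator (P Q L : Bimod R R) :
    tπ P Q ▷ L.X ≫ tπ (P ⊗ Q) L ≫ (α_ P Q L).hom.hom =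
      (α_ _ _ _).hom ≫ P.X ◁ tπ Q L ≫ tπ P (Q ⊗ L) := by
  have h : tπ (P ⊗ Q) L ≫ (α_ P Q L).hom.hom = Bimod.AssociatorBimod.homAux P Q L :=
    coequalizer.π_desc _ _
  rw [h]
  exact π_tensor_id_preserves_coequalizer_inv_desc _ _ _ _

/-- The monoidal forgetful functor `Γ^R` from `R`-`R`-bimodules to `V`: its structure is given by
the canonical epimorphisms `P ⊗ Q ⟶ P ⊗_R Q` and the unit of `R`. -/
noncomputable def Γ (R : Mon V) : Bimod R R ⥤ V where
  obj P := P.X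
  map f := f.hom

noncomputable instance (R : Mon V) : (Γ R).LaxMonoidal where
  ε := MonObj.one (X := R.X)
  μ P Q := tπ P Q
  μ_natural_left f P := (tπ_whiskerRight f P).symm
  μ_natural_right P f := (tπ_whiskerLeft P f).symm
  associativity P Q L := tπ_associator P Q L
  left_unitality P := by
    change _ = _ ≫ tπ _ _ ≫ (λ_ P).hom.hom
    rw [tπ_leftUnitor]
    exact P.one_actLeft.symm
  right_unitality P := by
    change _ = _ ≫ tπ _ _ ≫ (ρ_ P).hom.hom
    rw [tπ_rightUnitor]
    exact P.actRight_one.symm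

end Bimodules
section Canonical
open Functor.LaxMonoidal
variable {V : Type u} [Category.{v} V] [MonoidalCategory V]
  {C : Type w} [Category.{v} C] [MonoidalCategory C] (G : C ⥤ V) [G.LaxMonoidal]

/-- The left action of `G e` on `G c`. -/
def lactG (c : C) : G.obj (𝟙_ C) ⊗ G.obj c ⟶ G.obj c := μ G (𝟙_ C) c ≫ G.map (λ_ c).hom

/-- The right action of `G e` on `G c`. -/
def ractG (c : C) : G.obj c ⊗ G.obj (𝟙_ C) ⟶ G.obj c := μ G c (𝟙_ C) ≫ G.map (ρ_ c).hom

theorem lactG_μ (a b : C) :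
    lactG G a ▷ G.obj b ≫ μ G a b = (α_ _ _ _).hom ≫ G.obj (𝟙_ C) ◁ μ G a b ≫ lactG G (a ⊗ b) := by
  simp only [lactG, comp_whiskerRight, Category.assoc]
  rw [μ_natural_left, ← associativity_assoc, ← G.map_comp]
  congr 3
  simp

theorem μ_ractG (a b : C) :
    G.obj a ◁ ractG G b ≫ μ G a b = (α_ _ _ _).inv ≫ μ G a b ▷ G.obj (𝟙_ C) ≫ ractG G (a ⊗ b) := by
  simp only [ractG, MonoidalCategory.whiskerLeft_comp, Category.assoc]
  rw [μ_natural_right, Iso.eq_inv_comp, ← associativity_assoc, ← G.map_comp]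
  congr 3
  simp

theorem μ_balanced (a b : C) :
    ractG G a ▷ G.obj b ≫ μ G a b = (α_ _ _ _).hom ≫ G.obj a ◁ lactG G b ≫ μ G a b := by
  simp only [lactG, ractG, comp_whiskerRight, MonoidalCategory.whiskerLeft_comp, Category.assoc]
  rw [μ_natural_left, μ_natural_right, ← associativity_assoc, ← G.map_comp]
  congr 3
  simp

theorem lactG_nat {a b : C} (f : a ⟶ b) :
    lactG G a ≫ G.map f = G.obj (𝟙_ C) ◁ G.map f ≫ lactG G b := by
  simp only [lactG, Category.assoc]
  rw [μ_natural_right_assoc, ← G.map_comp, ← G.map_comp, leftUnitor_naturality]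

theorem ractG_nat {a b : C} (f : a ⟶ b) :
    ractG G a ≫ G.map f = G.map f ▷ G.obj (𝟙_ C) ≫ ractG G b := by
  simp only [ractG, Category.assoc]
  rw [μ_natural_left_assoc, ← G.map_comp, ← G.map_comp, rightUnitor_naturality]

/-- The monoid `G e`: the image under `G` of the unit monoid `e` of `C`. -/
abbrev baseMon : Mon V where
  X := G.obj (𝟙_ C)
  mon :=
    { one := ε G
      mul := μ G (𝟙_ C) (𝟙_ C) ≫ G.map (λ_ (𝟙_ C)).hom
      one_mul := (left_unitality G (𝟙_ C)).symm
      mul_one := by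
        rw [unitors_equal]; exact (right_unitality G (𝟙_ C)).symm
      mul_assoc := by
        have h := lactG_μ G (𝟙_ C) (𝟙_ C) =≫ G.map (λ_ (𝟙_ C)).hom
        simp only [Category.assoc, lactG_nat] at h
        rw [← MonoidalCategory.whiskerLeft_comp_assoc] at h
        exact h }

/-- The `G e`-`G e`-bimodule with underlying object `G c`. -/
abbrev canonObj (c : C) : Bimod (baseMon G) (baseMon G) where
  X := G.obj c
  actLeft := lactG G c
  actRight := ractG G c
  one_actLeft := (left_unitality G c).symm
  actRight_one := (right_unitality G c).symm
  left_assoc := by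
    have h := lactG_μ G (𝟙_ C) c =≫ G.map (λ_ c).hom
    simp only [Category.assoc, lactG_nat] at h
    rw [← MonoidalCategory.whiskerLeft_comp_assoc] at h
    exact h
  right_assoc := by
    have h := μ_ractG G c (𝟙_ C) =≫ G.map (ρ_ c).hom
    simp only [Category.assoc, ractG_nat] at h
    rw [← comp_whiskerRight_assoc] at h
    refine Eq.trans ?_ h
    congr 2
    change _ ≫ G.map (λ_ (𝟙_ C)).hom = ractG G (𝟙_ C)
    rw [ractG, unitors_equal]
  middle_assoc := by
    have h := lactG_μ G c (𝟙_ C) =≫ G.map (ρ_ c).hom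
    simp only [Category.assoc, lactG_nat] at h
    rw [← MonoidalCategory.whiskerLeft_comp_assoc] at h
    exact h

/-- The functor `U` in the canonical factorization `G = Γ U`. -/
abbrev canonFunctor : C ⥤ Bimod (baseMon G) (baseMon G) where
  obj c := canonObj G c
  map f :=
    { hom := G.map f
      left_act_hom := lactG_nat G f
      right_act_hom := ractG_nat G f }
  map_id c := by ext; exact G.map_id c
  map_comp f g := by ext; exact G.map_comp f g

variable [HasCoequalizers V]
  [∀ X : V, PreservesColimitsOfSize.{0, 0} (tensorLeft X)]
  [∀ X : V, PreservesColimitsOfSize.{0, 0} (tensorRight X)]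

/-- The unique morphism `U a ⊗_R U b ⟶ U (a ⊗ b)` through which `G a ⊗ G b ⟶ G (a ⊗ b)`
factors. -/
noncomputable def canonμ (a b : C) :
    (canonFunctor G).obj a ⊗ (canonFunctor G).obj b ⟶ (canonFunctor G).obj (a ⊗ b) where
  hom := tdesc (P := canonObj G a) (Q := canonObj G b) (μ G a b) (μ_balanced G a b)
  left_act_hom := by
    refine whiskerLeft_tπ_ext (P := canonObj G a) (Q := canonObj G b) ?_
    change _ ◁ tπ (canonObj G a) (canonObj G b) ≫ (canonObj G a ⊗ canonObj G b).actLeft ≫ _ = _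
    rw [← Category.assoc, tπ_actLeft, ← MonoidalCategory.whiskerLeft_comp_assoc, tπ_tdesc,
      Category.assoc, Category.assoc, tπ_tdesc, Iso.inv_comp_eq]
    exact lactG_μ G a b
  right_act_hom := by
    refine whiskerRight_tπ_ext (P := canonObj G a) (Q := canonObj G b) ?_
    change tπ (canonObj G a) (canonObj G b) ▷ _ ≫ (canonObj G a ⊗ canonObj G b).actRight ≫ _ = _
    rw [← Category.assoc, tπ_actRight, ← comp_whiskerRight_assoc, tπ_tdesc,
      Category.assoc, Category.assoc, tπ_tdesc, ← Iso.eq_inv_comp]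
    exact μ_ractG G a b

theorem tπ_canonμ (a b : C) :
    tπ ((canonFunctor G).obj a) ((canonFunctor G).obj b) ≫ (canonμ G a b).hom = μ G a b :=
  tπ_tdesc _ (μ_balanced G a b)

/-- The unit constraint of `U` is the identity. -/
def canonε : 𝟙_ (Bimod (baseMon G) (baseMon G)) ⟶ (canonFunctor G).obj (𝟙_ C) where
  hom := 𝟙 (G.obj (𝟙_ C))
  left_act_hom := by
    refine (Category.comp_id _).trans ?_
    change lactG G (𝟙_ C) = G.obj (𝟙_ C) ◁ 𝟙 (G.obj (𝟙_ C)) ≫ lactG G (𝟙_ C)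
    rw [MonoidalCategory.whiskerLeft_id, Category.id_comp]
  right_act_hom := by
    refine (Category.comp_id _).trans ?_
    change lactG G (𝟙_ C) = 𝟙 (G.obj (𝟙_ C)) ▷ G.obj (𝟙_ C) ≫ ractG G (𝟙_ C)
    rw [id_whiskerRight, Category.id_comp, lactG, ractG, unitors_equal]

/-- The monoidal structure of `U`. -/
noncomputable instance : (canonFunctor G).LaxMonoidal where
  ε := canonε G
  μ := canonμ G
  μ_natural_left f X' := by
    ext
    refine tπ_hom_ext ?_
    simp only [Bimod.comp_hom']
    rw [← Category.assoc, tπ_whiskerRight, Category.assoc, tπ_canonμ, ← Category.assoc, tπ_canonμ]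
    exact μ_natural_left G f X'
  μ_natural_right X' f := by
    ext
    refine tπ_hom_ext ?_
    simp only [Bimod.comp_hom']
    rw [← Category.assoc, tπ_whiskerLeft, Category.assoc, tπ_canonμ, ← Category.assoc, tπ_canonμ]
    exact μ_natural_right G X' f
  associativity X Y Z := by
    ext
    refine tπ_hom_ext ?_
    refine whiskerRight_tπ_ext ?_
    simp only [Bimod.comp_hom']
    have e1 := tπ_whiskerRight (canonμ G X Y) (canonObj G Z)
    have e2 := tπ_associator (canonObj G X) (canonObj G Y) (canonObj G Z)
    have e3 := tπ_whiskerLeft (canonObj G X) (canonμ G Y Z)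
    have e4 := e2 =≫ ((canonObj G X ◁ canonμ G Y Z).hom ≫ (canonμ G X (Y ⊗ Z)).hom)
    simp only [Category.assoc] at e4
    rw [← Category.assoc (tπ _ _), e1, Category.assoc, ← comp_whiskerRight_assoc, tπ_canonμ,
      ← Category.assoc (tπ _ _), tπ_canonμ, e4, ← Category.assoc (tπ _ _), e3, Category.assoc,
      tπ_canonμ, ← MonoidalCategory.whiskerLeft_comp_assoc, tπ_canonμ]
    exact associativity G X Y Z
  left_unitality X := by
    ext
    refine tπ_hom_ext ?_
    simp only [Bimod.comp_hom']
    rw [tπ_leftUnitor, ← Category.assoc, tπ_whiskerRight, Category.assoc, ← Category.assoc (tπ _ _),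
      tπ_canonμ]
    change lactG G X = (𝟙 (G.obj (𝟙_ C))) ▷ G.obj X ≫ lactG G X
    rw [id_whiskerRight, Category.id_comp]
  right_unitality X := by
    ext
    refine tπ_hom_ext ?_
    simp only [Bimod.comp_hom']
    rw [tπ_rightUnitor, ← Category.assoc, tπ_whiskerLeft, Category.assoc, ← Category.assoc (tπ _ _),
      tπ_canonμ]
    change ractG G X = G.obj X ◁ (𝟙 (G.obj (𝟙_ C))) ≫ ractG G X
    rw [MonoidalCategory.whiskerLeft_id, Category.id_comp]

/-- A monoidal functor `G` is essentially strong if the monoidal functor `U` in its canonical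
factorization `G = Γ U` is strong, i.e. its structure morphisms are invertible. -/
def EssentiallyStrong : Prop :=
  IsIso (ε (canonFunctor G)) ∧ ∀ a b : C, IsIso (μ (canonFunctor G) a b)

end Canonical

section Base
variable {V : Type u} [Category.{v} V] [MonoidalCategory V]

instance [MonoidalClosed V] (X : V) : PreservesColimitsOfSize.{0, 0} (tensorLeft X) :=
  (ihom.adjunction X).leftAdjoint_preservesColimits

instance [MonoidalClosed V] [BraidedCategory V] (X : V) :
    PreservesColimitsOfSize.{0, 0} (tensorRight X) :=
  (Adjunction.ofIsLeftAdjoint (tensorRight X)).leftAdjoint_preservesColimits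

/-- A right module over a monoid `A` in `V`. -/
structure RightMod (A : Mon V) where
  X : V
  act : X ⊗ A.X ⟶ X
  act_one : X ◁ MonObj.one ≫ act = (ρ_ X).hom
  act_assoc : X ◁ MonObj.mul ≫ act = (α_ X A.X A.X).inv ≫ act ▷ A.X ≫ act

namespace RightMod
variable {A : Mon V}

/-- A morphism of right `A`-modules. -/
@[ext]
structure Hom (M N : RightMod A) where
  hom : M.X ⟶ N.X
  act_hom : M.act ≫ hom = hom ▷ A.X ≫ N.act

instance : Category (RightMod A) where
  Hom M N := Hom M N
  id M := ⟨𝟙 M.X, by rw [Category.comp_id, id_whiskerRight, Category.id_comp]⟩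
  comp f g := ⟨f.hom ≫ g.hom, by
    rw [← Category.assoc, f.act_hom, Category.assoc, g.act_hom, comp_whiskerRight,
      Category.assoc]⟩
  id_comp f := Hom.ext (Category.id_comp f.hom)
  comp_id f := Hom.ext (Category.comp_id f.hom)
  assoc f g h := Hom.ext (Category.assoc f.hom g.hom h.hom)

theorem hom_ext {M N : RightMod A} {f g : M ⟶ N} (h : f.hom = g.hom) : f = g :=
  Hom.ext h

theorem comp_hom {M N L : RightMod A} (f : M ⟶ N) (g : N ⟶ L) : (f ≫ g).hom = f.hom ≫ g.hom := rfl

theorem id_hom (M : RightMod A) : Hom.hom (𝟙 M) = 𝟙 M.X := rfl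

/-- The monoid `A` as a right module over itself. -/
abbrev regular (A : Mon V) : RightMod A where
  X := A.X
  act := MonObj.mul
  act_one := MonObj.mul_one A.X
  act_assoc := by
    rw [Iso.eq_inv_comp]; exact (MonObj.mul_assoc A.X).symm

end RightMod

end Base

section Bialgebroids

variable {V : Type u} [Category.{v} V] [MonoidalCategory V] [SymmetricCategory V]
  [MonoidalClosed V] [HasCoequalizers V] [UnitSeparates V]

theorem tm_ext₄ {X Y Z W T : V} {f g : ((X ⊗ Y) ⊗ Z) ⊗ W ⟶ T}
    (h : ∀ (x : 𝟙_ V ⟶ X) (y : 𝟙_ V ⟶ Y) (z : 𝟙_ V ⟶ Z) (w : 𝟙_ V ⟶ W),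
      tm (tm (tm x y) z) w ≫ f = tm (tm (tm x y) z) w ≫ g) : f = g := by
  refine ext_insR fun w => tm_ext₃ fun x y z => ?_
  rw [← Category.assoc, ← Category.assoc, el_insR, h]

theorem tm_ext₅ {X Y A B D T : V} {f g : (X ⊗ Y) ⊗ ((A ⊗ B) ⊗ D) ⟶ T}
    (h : ∀ (x : 𝟙_ V ⟶ X) (y : 𝟙_ V ⟶ Y) (a : 𝟙_ V ⟶ A) (b : 𝟙_ V ⟶ B) (d : 𝟙_ V ⟶ D),
      tm (tm x y) (tm (tm a b) d) ≫ f = tm (tm x y) (tm (tm a b) d) ≫ g) : f = g := by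
  rw [← cancel_epi (β_ ((A ⊗ B) ⊗ D) (X ⊗ Y)).hom, ← cancel_epi (α_ ((A ⊗ B) ⊗ D) X Y).hom]
  refine ext_insR fun y => tm_ext₄ fun a b d x => ?_
  simp only [← Category.assoc, el_insR, tm_associator_hom, tm_braiding, h]

section BimodElements

variable {R : Mon V} {P Q L : Bimod R R}

/-- The element `x ⊗_R y` of `P ⊗_R Q`. -/
noncomputable def tb (x : 𝟙_ V ⟶ P.X) (y : 𝟙_ V ⟶ Q.X) : 𝟙_ V ⟶ (P ⊗ Q : Bimod R R).X :=
  tm x y ≫ tπ P Q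

theorem tm_tπ (x : 𝟙_ V ⟶ P.X) (y : 𝟙_ V ⟶ Q.X) : tm x y ≫ tπ P Q = tb x y := rfl

theorem tb_ext {W : V} {f g : (P ⊗ Q : Bimod R R).X ⟶ W}
    (h : ∀ (x : 𝟙_ V ⟶ P.X) (y : 𝟙_ V ⟶ Q.X), tb x y ≫ f = tb x y ≫ g) : f = g := by
  refine tπ_hom_ext (tm_ext fun x y => ?_)
  rw [← Category.assoc, ← Category.assoc, tm_tπ, h]

theorem tm_tb_ext {Z W : V} {f g : (P ⊗ Q : Bimod R R).X ⊗ Z ⟶ W}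
    (h : ∀ (x : 𝟙_ V ⟶ P.X) (y : 𝟙_ V ⟶ Q.X) (z : 𝟙_ V ⟶ Z),
      tm (tb x y) z ≫ f = tm (tb x y) z ≫ g) : f = g := by
  refine ext_insR fun z => tb_ext fun x y => ?_
  rw [← Category.assoc, ← Category.assoc, el_insR, h]

theorem tm_tb_ext' {Z W : V} {f g : Z ⊗ (P ⊗ Q : Bimod R R).X ⟶ W}
    (h : ∀ (z : 𝟙_ V ⟶ Z) (x : 𝟙_ V ⟶ P.X) (y : 𝟙_ V ⟶ Q.X),
      tm z (tb x y) ≫ f = tm z (tb x y) ≫ g) : f = g := by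
  refine ext_insL fun z => tb_ext fun x y => ?_
  rw [← Category.assoc, ← Category.assoc, el_insL, h]

theorem tb_balanced (x : 𝟙_ V ⟶ P.X) (r : 𝟙_ V ⟶ R.X) (y : 𝟙_ V ⟶ Q.X) :
    tb (P := P) (tm x r ≫ P.actRight) y = tb x (tm r y ≫ Q.actLeft) := by
  have h := tm (tm x r) y ≫= tπ_cond P Q
  simp only [← Category.assoc, tm_whiskerRight, tm_associator_hom, tm_whiskerLeft] at h
  exact h

theorem tb_actLeft (r : 𝟙_ V ⟶ R.X) (x : 𝟙_ V ⟶ P.X) (y : 𝟙_ V ⟶ Q.X) :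
    tm r (tb x y) ≫ (P ⊗ Q : Bimod R R).actLeft = tb (tm r x ≫ P.actLeft) y := by
  have h := tm r (tm x y) ≫= tπ_actLeft P Q
  simp only [← Category.assoc, tm_whiskerRight, tm_associator_inv, tm_whiskerLeft] at h
  exact h

theorem tb_actRight (r : 𝟙_ V ⟶ R.X) (x : 𝟙_ V ⟶ P.X) (y : 𝟙_ V ⟶ Q.X) :
    tm (tb x y) r ≫ (P ⊗ Q : Bimod R R).actRight = tb x (tm y r ≫ Q.actRight) := by
  have h := tm (tm x y) r ≫= tπ_actRight P Q
  simp only [← Category.assoc, tm_whiskerRight, tm_associator_hom, tm_whiskerLeft] at h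
  exact h

theorem tb_tensorHom {P' Q' : Bimod R R} (f : P ⟶ P') (g : Q ⟶ Q')
    (x : 𝟙_ V ⟶ P.X) (y : 𝟙_ V ⟶ Q.X) :
    tb x y ≫ (f ⊗ₘ g).hom = tb (x ≫ f.hom) (y ≫ g.hom) := by
  have h := tm x y ≫= tπ_tensorHom f g
  simp only [← Category.assoc, tm_tensorHom] at h
  exact h

theorem tb_whiskerLeft {Q' : Bimod R R} (g : Q ⟶ Q') (x : 𝟙_ V ⟶ P.X) (y : 𝟙_ V ⟶ Q.X) :
    tb x y ≫ (P ◁ g).hom = tb x (y ≫ g.hom) := by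
  have h := tm x y ≫= tπ_whiskerLeft P g
  simp only [← Category.assoc, tm_whiskerLeft] at h
  exact h

theorem tb_whiskerRight {P' : Bimod R R} (f : P ⟶ P') (x : 𝟙_ V ⟶ P.X) (y : 𝟙_ V ⟶ Q.X) :
    tb x y ≫ (f ▷ Q).hom = tb (x ≫ f.hom) y := by
  have h := tm x y ≫= tπ_whiskerRight f Q
  simp only [← Category.assoc, tm_whiskerRight] at h
  exact h

theorem tb_associator (x : 𝟙_ V ⟶ P.X) (y : 𝟙_ V ⟶ Q.X) (z : 𝟙_ V ⟶ L.X) :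
    tb (tb x y) z ≫ (α_ P Q L).hom.hom = tb x (tb y z) := by
  have h := tm (tm x y) z ≫= tπ_associator P Q L
  simp only [← Category.assoc, tm_whiskerRight, tm_whiskerLeft, tm_associator_hom] at h
  exact h

theorem tb_leftUnitor (r : 𝟙_ V ⟶ R.X) (x : 𝟙_ V ⟶ P.X) :
    tb (P := 𝟙_ (Bimod R R)) r x ≫ (λ_ P).hom.hom = tm r x ≫ P.actLeft := by
  have h := tm r x ≫= tπ_leftUnitor P
  exact (Category.assoc _ _ _).trans h

theorem tb_rightUnitor (x : 𝟙_ V ⟶ P.X) (r : 𝟙_ V ⟶ R.X) :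
    tb (Q := 𝟙_ (Bimod R R)) x r ≫ (ρ_ P).hom.hom = tm x r ≫ P.actRight := by
  have h := tm x r ≫= tπ_rightUnitor P
  exact (Category.assoc _ _ _).trans h

end BimodElements

theorem RightMod.el_one {A : Mon V} (M : RightMod A) (x : 𝟙_ V ⟶ M.X) :
    tm x MonObj.one ≫ M.act = x := by
  have h := tm x (𝟙 _) ≫= M.act_one
  simpa only [← Category.assoc, tm_whiskerLeft, Category.id_comp, tm_rightUnitor_hom] using h

theorem RightMod.el_mul {A : Mon V} (M : RightMod A) (x : 𝟙_ V ⟶ M.X) (a b : 𝟙_ V ⟶ A.X) :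
    tm x (tm a b ≫ MonObj.mul) ≫ M.act = tm (tm x a ≫ M.act) b ≫ M.act := by
  have h := tm x (tm a b) ≫= M.act_assoc
  simpa only [← Category.assoc, tm_whiskerLeft, tm_whiskerRight, tm_associator_inv] using h

theorem RightMod.el_hom {A : Mon V} {M N : RightMod A} (f : M ⟶ N) (x : 𝟙_ V ⟶ M.X)
    (a : 𝟙_ V ⟶ A.X) : (tm x a ≫ M.act) ≫ f.hom = tm (x ≫ f.hom) a ≫ N.act := by
  have h := tm x a ≫= f.act_hom
  simpa only [← Category.assoc, tm_whiskerRight] using h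

/-- The `A`-linear morphism `A ⟶ M`, `a ↦ x a`, for an element `x` of `M`. -/
def RightMod.orb {A : Mon V} {M : RightMod A} (x : 𝟙_ V ⟶ M.X) : RightMod.regular A ⟶ M :=
  RightMod.Hom.mk (M := RightMod.regular A) (insL x A.X ≫ M.act) (by
    refine tm_ext fun a b => ?_
    change tm a b ≫ MonObj.mul ≫ insL x A.X ≫ M.act = tm a b ≫ (insL x A.X ≫ M.act) ▷ A.X ≫ M.act
    rw [← Category.assoc (tm a b) MonObj.mul, ← Category.assoc (tm a b ≫ MonObj.mul), el_insL,
      ← Category.assoc (tm a b), tm_whiskerRight, ← Category.assoc a, el_insL]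
    exact M.el_mul x a b)

/-- The structure of a ring over `R^e = R^op ⊗ R` on a monoid `A`: a monoid morphism
`t ⊗ s : R^op ⊗ R ⟶ A`, i.e. morphisms `s : R ⟶ A` and `t : R^op ⟶ A` of monoids with commuting
images. -/
structure ReRing (R A : Mon V) where
  s : R.X ⟶ A.X
  t : R.X ⟶ A.X
  s_one : MonObj.one ≫ s = MonObj.one
  s_mul : MonObj.mul ≫ s = (s ⊗ₘ s) ≫ MonObj.mul
  t_one : MonObj.one ≫ t = MonObj.one
  t_mul : MonObj.mul ≫ t = (β_ R.X R.X).hom ≫ (t ⊗ₘ t) ≫ MonObj.mul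
  s_t_comm : (s ⊗ₘ t) ≫ MonObj.mul = (β_ R.X R.X).hom ≫ (t ⊗ₘ s) ≫ MonObj.mul

namespace ReRing

variable {R A : Mon V} (S : ReRing R A)

theorem el_s_mul (r q : 𝟙_ V ⟶ R.X) :
    (tm r q ≫ MonObj.mul) ≫ S.s = tm (r ≫ S.s) (q ≫ S.s) ≫ MonObj.mul := by
  have h := tm r q ≫= S.s_mul
  simpa only [← Category.assoc, tm_tensorHom] using h

theorem el_t_mul (r q : 𝟙_ V ⟶ R.X) :
    (tm r q ≫ MonObj.mul) ≫ S.t = tm (q ≫ S.t) (r ≫ S.t) ≫ MonObj.mul := by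
  have h := tm r q ≫= S.t_mul
  simpa only [← Category.assoc, tm_tensorHom, tm_braiding] using h

theorem el_comm (r q : 𝟙_ V ⟶ R.X) :
    tm (r ≫ S.s) (q ≫ S.t) ≫ MonObj.mul = tm (q ≫ S.t) (r ≫ S.s) ≫ MonObj.mul := by
  have h := tm r q ≫= S.s_t_comm
  simpa only [← Category.assoc, tm_tensorHom, tm_braiding] using h

/-- The `R`-`R`-bimodule underlying a right `A`-module: `r · x = x t(r)` and `x · r = x s(r)`. -/
abbrev bimod (M : RightMod A) : Bimod R R where
  X := M.X
  actLeft := (β_ R.X M.X).hom ≫ M.X ◁ S.t ≫ M.act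
  actRight := M.X ◁ S.s ≫ M.act
  one_actLeft := by
    rw [← cancel_epi (λ_ M.X).inv]
    refine el_ext fun x => ?_
    simp only [← Category.assoc, el_leftUnitor_inv, tm_whiskerRight, tm_braiding, tm_whiskerLeft,
      Category.id_comp, S.t_one, M.el_one, tm_leftUnitor_hom]
  actRight_one := by
    rw [← cancel_epi (ρ_ M.X).inv]
    refine el_ext fun x => ?_
    simp only [← Category.assoc, el_rightUnitor_inv, tm_whiskerLeft,
      Category.id_comp, S.s_one, M.el_one, tm_rightUnitor_hom]
  left_assoc := by
    refine tm_ext₃ fun r q x => ?_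
    simp only [← Category.assoc, tm_whiskerRight, tm_whiskerLeft, tm_braiding, tm_associator_hom,
      S.el_t_mul, M.el_mul]
  right_assoc := by
    rw [← cancel_epi (α_ M.X R.X R.X).hom]
    refine tm_ext₃ fun x r q => ?_
    simp only [← Category.assoc, tm_whiskerRight, tm_whiskerLeft, tm_associator_hom,
      tm_associator_inv, S.el_s_mul, M.el_mul]
  middle_assoc := by
    refine tm_ext₃ fun r x q => ?_
    simp only [← Category.assoc, tm_whiskerRight, tm_whiskerLeft, tm_braiding, tm_associator_hom]
    rw [← M.el_mul, ← M.el_mul, S.el_comm]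

theorem el_actLeft (M : RightMod A) (r : 𝟙_ V ⟶ R.X) (x : 𝟙_ V ⟶ M.X) :
    tm r x ≫ (S.bimod M).actLeft = tm x (r ≫ S.t) ≫ M.act := by
  change tm r x ≫ (β_ R.X M.X).hom ≫ M.X ◁ S.t ≫ M.act = _
  simp only [← Category.assoc, tm_whiskerLeft, tm_braiding]

theorem el_actRight (M : RightMod A) (x : 𝟙_ V ⟶ M.X) (r : 𝟙_ V ⟶ R.X) :
    tm x r ≫ (S.bimod M).actRight = tm x (r ≫ S.s) ≫ M.act := by
  change tm x r ≫ M.X ◁ S.s ≫ M.act = _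
  simp only [← Category.assoc, tm_whiskerLeft]

/-- Morphisms of bimodules, on elements. -/
theorem bimodHom_aux {M N : RightMod A} (f : M.X ⟶ N.X)
    (h : ∀ (x : 𝟙_ V ⟶ M.X) (a : 𝟙_ V ⟶ A.X), (tm x a ≫ M.act) ≫ f = tm (x ≫ f) a ≫ N.act) :
    (S.bimod M).actLeft ≫ f = R.X ◁ f ≫ (S.bimod N).actLeft ∧
      (S.bimod M).actRight ≫ f = f ▷ R.X ≫ (S.bimod N).actRight := by
  constructor
  · refine tm_ext fun r x => ?_
    simp only [← Category.assoc, tm_braiding, tm_whiskerLeft, h]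
  · refine tm_ext fun x r => ?_
    simp only [← Category.assoc, tm_whiskerLeft, tm_whiskerRight, h]

/-- A morphism of `A`-modules is a morphism of the underlying bimodules. -/
def bimodMap {M N : RightMod A} (f : M ⟶ N) : S.bimod M ⟶ S.bimod N where
  hom := f.hom
  left_act_hom := (S.bimodHom_aux f.hom (RightMod.el_hom f)).1
  right_act_hom := (S.bimodHom_aux f.hom (RightMod.el_hom f)).2

/-- The bimodule `A` over `R`: `r · a = a t(r)` and `a · r = a s(r)`. -/
abbrev reg : Bimod R R := S.bimod (RightMod.regular A)

/-- The `A`-linear morphism `A ⟶ M`, `a ↦ x a`, as a morphism of bimodules. -/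
def orb {M : RightMod A} (x : 𝟙_ V ⟶ M.X) : S.reg ⟶ S.bimod M :=
  S.bimodMap (RightMod.orb x)

theorem el_orb {M : RightMod A} (x : 𝟙_ V ⟶ M.X) (a : 𝟙_ V ⟶ A.X) :
    a ≫ (S.orb x).hom = tm x a ≫ M.act := by
  change a ≫ insL x A.X ≫ M.act = _
  rw [← Category.assoc, el_insL]

/-- Left multiplication `b ↦ a b` by an element `a` of `A`, an endomorphism of the bimodule `A`. -/
abbrev leftMul (a : 𝟙_ V ⟶ A.X) : S.reg ⟶ S.reg := S.orb (M := RightMod.regular A) a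

/-- A (generalized) element `f : Z ⟶ A ⊗_R A` belongs to the Takeuchi product
`A ×_R A ⊆ A ⊗_R A`: it equalizes `s(ρ) · ⊗_R A` and `A ⊗_R t(ρ) ·` for all elements `ρ` of `R`. -/
def InTakeuchi {Z : V} (f : Z ⟶ (S.reg ⊗ S.reg : Bimod R R).X) : Prop :=
  ∀ ρ : 𝟙_ V ⟶ R.X,
    f ≫ (S.leftMul (ρ ≫ S.s) ▷ S.reg).hom = f ≫ (S.reg ◁ S.leftMul (ρ ≫ S.t)).hom

theorem diagAct_aux (M N : RightMod A) :
    (M.X ⊗ N.X) ◁ S.reg.actRight ▷ S.reg.X ≫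
        tensorμ M.X N.X A.X A.X ≫ (M.act ⊗ₘ N.act) ≫ tπ (S.bimod M) (S.bimod N) =
      (M.X ⊗ N.X) ◁ (α_ _ _ _).hom ≫ (M.X ⊗ N.X) ◁ (S.reg.X ◁ S.reg.actLeft) ≫
        tensorμ M.X N.X A.X A.X ≫ (M.act ⊗ₘ N.act) ≫ tπ (S.bimod M) (S.bimod N) := by
  refine tm_ext₅ fun x y a r b => ?_
  simp only [← Category.assoc, tm_whiskerLeft, tm_whiskerRight, tm_associator_hom, tm_braiding,
    tm_tensorμ, tm_tensorHom, M.el_mul, N.el_mul]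
  have h := tb_balanced (P := S.bimod M) (Q := S.bimod N) (tm x a ≫ M.act) r (tm y b ≫ N.act)
  simp only [← Category.assoc, tm_whiskerLeft, tm_braiding] at h
  exact h

/-- `(x ⊗ y) ⊗ (a ⊗_R b) ↦ x a ⊗_R y b`. -/
noncomputable def diagAct (M N : RightMod A) :
    (M.X ⊗ N.X) ⊗ (S.reg ⊗ S.reg : Bimod R R).X ⟶ (S.bimod M ⊗ S.bimod N : Bimod R R).X :=
  tdescL (P := S.reg) (Q := S.reg)
    (tensorμ M.X N.X A.X A.X ≫ (M.act ⊗ₘ N.act) ≫ tπ (S.bimod M) (S.bimod N))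
    (S.diagAct_aux M N)

theorem el_diagAct (M N : RightMod A) (x : 𝟙_ V ⟶ M.X) (y : 𝟙_ V ⟶ N.X)
    (w : 𝟙_ V ⟶ (S.reg ⊗ S.reg : Bimod R R).X) :
    tm (tm x y) w ≫ S.diagAct M N = w ≫ (S.orb x ⊗ₘ S.orb y).hom := by
  rw [← el_insL, Category.assoc]
  congr 1
  refine tb_ext fun a b => ?_
  have h := tm (tm x y) (tm a b) ≫= tπ_tdescL (P := S.reg) (Q := S.reg) _ (S.diagAct_aux M N)
  rw [← Category.assoc, el_insL, tb_tensorHom, el_orb, el_orb]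
  refine Eq.trans ?_ (h.trans ?_)
  · rw [← Category.assoc, tm_whiskerLeft]
    rfl
  · rw [← Category.assoc, tm_tensorμ, ← Category.assoc, tm_tensorHom]
    rfl

theorem takAct_aux (M N : RightMod A) {Z : V} (f : Z ⟶ (S.reg ⊗ S.reg : Bimod R R).X)
    (hf : S.InTakeuchi f) :
    (S.bimod M).actRight ▷ (S.bimod N).X ▷ Z ≫ (M.X ⊗ N.X) ◁ f ≫ S.diagAct M N =
      (α_ _ _ _).hom ▷ Z ≫ ((S.bimod M).X ◁ (S.bimod N).actLeft) ▷ Z ≫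
        (M.X ⊗ N.X) ◁ f ≫ S.diagAct M N := by
  refine tm_ext₄ fun x r y z => ?_
  have key : ∀ w : 𝟙_ V ⟶ (S.reg ⊗ S.reg : Bimod R R).X,
      w ≫ (S.orb (tm x (r ≫ S.s) ≫ M.act) ⊗ₘ S.orb y).hom =
        w ≫ (S.leftMul (r ≫ S.s) ▷ S.reg).hom ≫ (S.orb x ⊗ₘ S.orb y).hom ∧
      w ≫ (S.orb x ⊗ₘ S.orb (tm y (r ≫ S.t) ≫ N.act)).hom =
        w ≫ (S.reg ◁ S.leftMul (r ≫ S.t)).hom ≫ (S.orb x ⊗ₘ S.orb y).hom := by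
    intro w
    constructor <;> congr 1 <;> refine tb_ext fun a b => ?_
    · simp only [← Category.assoc, tb_tensorHom, tb_whiskerRight, el_orb]
      rw [← M.el_mul]
    · simp only [← Category.assoc, tb_tensorHom, tb_whiskerLeft, el_orb]
      rw [← N.el_mul]
  simp only [← Category.assoc, tm_whiskerLeft, tm_whiskerRight, tm_associator_hom, tm_braiding,
    el_diagAct]
  rw [(key _).1, (key _).2, ← Category.assoc, ← Category.assoc, Category.assoc z, hf r]
  simp only [Category.assoc]

/-- For an element `f : Z ⟶ A ⊗_R A` of the Takeuchi product, the right action of `f` on `M ⊗_R N`,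
`(x ⊗_R y) ⊗ z ↦ x f(z)₁ ⊗_R y f(z)₂`. -/
noncomputable def takAct (M N : RightMod A) {Z : V} (f : Z ⟶ (S.reg ⊗ S.reg : Bimod R R).X)
    (hf : S.InTakeuchi f) :
    (S.bimod M ⊗ S.bimod N : Bimod R R).X ⊗ Z ⟶ (S.bimod M ⊗ S.bimod N : Bimod R R).X :=
  tdescR (P := S.bimod M) (Q := S.bimod N) ((M.X ⊗ N.X) ◁ f ≫ S.diagAct M N)
    (S.takAct_aux M N f hf)

theorem el_takAct (M N : RightMod A) {Z : V} (f : Z ⟶ (S.reg ⊗ S.reg : Bimod R R).X)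
    (hf : S.InTakeuchi f) (x : 𝟙_ V ⟶ M.X) (y : 𝟙_ V ⟶ N.X) (z : 𝟙_ V ⟶ Z) :
    tm (tb (P := S.bimod M) (Q := S.bimod N) x y) z ≫ S.takAct M N f hf =
      (z ≫ f) ≫ (S.orb x ⊗ₘ S.orb y).hom := by
  have h := tm (tm x y) z ≫= tπ_tdescR (P := S.bimod M) (Q := S.bimod N)
    ((M.X ⊗ N.X) ◁ f ≫ S.diagAct M N) (S.takAct_aux M N f hf)
  rw [← Category.assoc, tm_whiskerRight, ← Category.assoc, tm_whiskerLeft, el_diagAct] at h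
  exact h

end ReRing
end Bialgebroids
section Tensor
variable {V : Type u} [Category.{v} V] [MonoidalCategory V] [SymmetricCategory V]
  [MonoidalClosed V] [HasCoequalizers V] [UnitSeparates V]

namespace ReRing
variable {R A : Mon V} (S : ReRing R A)

theorem bimodMap_comp {M N L : RightMod A} (f : M ⟶ N) (g : N ⟶ L) :
    S.bimodMap (f ≫ g) = S.bimodMap f ≫ S.bimodMap g := by
  ext; rfl

theorem bimodMap_id (M : RightMod A) : S.bimodMap (𝟙 M) = 𝟙 (S.bimod M) := by
  ext; rfl

theorem orb_map {M N : RightMod A} (f : M ⟶ N) (x : 𝟙_ V ⟶ M.X) :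
    S.orb x ≫ S.bimodMap f = S.orb (x ≫ f.hom) := by
  ext
  refine el_ext fun a => ?_
  rw [Bimod.comp_hom', ← Category.assoc, el_orb, el_orb]
  exact RightMod.el_hom f x a

theorem orb_act {M : RightMod A} (x : 𝟙_ V ⟶ M.X) (a : 𝟙_ V ⟶ A.X) :
    S.orb (tm x a ≫ M.act) = S.leftMul a ≫ S.orb x := by
  ext
  refine el_ext fun b => ?_
  rw [Bimod.comp_hom', ← Category.assoc, el_orb, el_orb, el_orb]
  exact (M.el_mul x a b).symm

theorem takAct_nat {M N M' N' : RightMod A} (g : M ⟶ M') (h : N ⟶ N') {Z : V}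
    (f : Z ⟶ (S.reg ⊗ S.reg : Bimod R R).X) (hf : S.InTakeuchi f) :
    S.takAct M N f hf ≫ (S.bimodMap g ⊗ₘ S.bimodMap h).hom =
      (S.bimodMap g ⊗ₘ S.bimodMap h).hom ▷ Z ≫ S.takAct M' N' f hf := by
  refine tm_tb_ext fun x y z => ?_
  rw [← Category.assoc, ← Category.assoc, el_takAct, tm_whiskerRight, tb_tensorHom]
  change _ = tm (tb (P := S.bimod M') (Q := S.bimod N') (x ≫ g.hom) (y ≫ h.hom)) z ≫ _
  rw [el_takAct, Category.assoc, ← Bimod.comp_hom', tensorHom_comp_tensorHom, orb_map, orb_map]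

/-- The morphism `A ⟶ R` in `V` underlying the counit of a comonoid structure on the bimodule
`A`. -/
def ε (c : ComonObj S.reg) : A.X ⟶ R.X := c.counit.hom

end ReRing

/-- A right bialgebroid over `R` on the monoid `A` in `V`: a ring over `R^e = R^op ⊗ R` together
with a comonoid structure `⟨A, δ, ε⟩` on the `R`-`R`-bimodule `A` (where `r · a = a t(r)` and
`a · r = a s(r)`) such that `δ` takes values in the Takeuchi product `A ×_R A`, on which the
multiplication `(a ⊗_R a')(b ⊗_R b') = a b ⊗_R a' b'` is well defined, such that `δ` is
multiplicative and unital, and such that `ε(1) = 1` and `ε(s(ε(a)) b) = ε(a b) = ε(t(ε(a)) b)`. -/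
structure RightBialgebroid (R A : Mon V) extends ReRing R A where
  comon : ComonObj toReRing.reg
  takeuchi : toReRing.InTakeuchi comon.comul.hom
  comul_one : MonObj.one ≫ comon.comul.hom =
    tb (P := toReRing.reg) (Q := toReRing.reg) MonObj.one MonObj.one
  comul_mul : MonObj.mul ≫ comon.comul.hom =
    comon.comul.hom ▷ A.X ≫
      toReRing.takAct (RightMod.regular A) (RightMod.regular A) comon.comul.hom takeuchi
  counit_one : MonObj.one ≫ toReRing.ε comon = MonObj.one
  counit_s : (toReRing.ε comon ≫ s) ▷ A.X ≫ MonObj.mul ≫ toReRing.ε comon =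
    MonObj.mul ≫ toReRing.ε comon
  counit_t : (toReRing.ε comon ≫ t) ▷ A.X ≫ MonObj.mul ≫ toReRing.ε comon =
    MonObj.mul ≫ toReRing.ε comon

namespace RightBialgebroid
variable {R A : Mon V} (B : RightBialgebroid R A)

/-- The comultiplication. -/
abbrev δ : B.reg ⟶ B.reg ⊗ B.reg := B.comon.comul

/-- The counit. -/
abbrev counit : B.reg ⟶ 𝟙_ (Bimod R R) := B.comon.counit

/-- The counit as a morphism `A ⟶ R` in `V`. -/
abbrev ε : A.X ⟶ R.X := B.toReRing.ε B.comon

theorem el_comul_mul (a b : 𝟙_ V ⟶ A.X) :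
    (tm a b ≫ MonObj.mul) ≫ B.δ.hom =
      tm (a ≫ B.δ.hom) b ≫
        B.takAct (RightMod.regular A) (RightMod.regular A) B.δ.hom B.takeuchi := by
  have h := tm a b ≫= B.comul_mul
  rw [← Category.assoc, ← Category.assoc, tm_whiskerRight] at h
  exact h

theorem el_counit_s (a b : 𝟙_ V ⟶ A.X) :
    (tm ((a ≫ B.ε) ≫ B.s) b ≫ MonObj.mul) ≫ B.ε = (tm a b ≫ MonObj.mul) ≫ B.ε := by
  have h := tm a b ≫= B.counit_s
  simpa only [← Category.assoc, tm_whiskerRight] using h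

theorem one_act (M : RightMod A) (x : 𝟙_ V ⟶ M.X) :
    MonObj.one ≫ (B.orb x).hom = x := by
  rw [ReRing.el_orb, M.el_one]

/-- The tensor product of right `A`-modules: `M ⊗_R N` with the action
`(x ⊗_R y) a = x a₁ ⊗_R y a₂`. -/
noncomputable abbrev tens (M N : RightMod A) : RightMod A where
  X := (B.bimod M ⊗ B.bimod N : Bimod R R).X
  act := B.takAct M N B.δ.hom B.takeuchi
  act_one := by
    rw [← cancel_epi (ρ_ _).inv]
    refine tb_ext fun x y => ?_
    rw [← Category.assoc, ← Category.assoc, el_rightUnitor_inv, ← Category.assoc,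
      tm_whiskerLeft, Category.id_comp]
    erw [ReRing.el_takAct]
    erw [B.comul_one, tb_tensorHom]
    rw [one_act, one_act, Category.assoc, Iso.inv_hom_id, Category.comp_id]
  act_assoc := by
    rw [← cancel_epi (α_ _ _ _).hom, Iso.hom_inv_id_assoc]
    refine ext_insR fun b => ext_insR fun a => tb_ext fun x y => ?_
    simp only [← Category.assoc, el_insR, tm_associator_hom, tm_whiskerLeft, tm_whiskerRight]
    erw [ReRing.el_takAct, ReRing.el_takAct, el_comul_mul]
    have h := B.takAct_nat (RightMod.orb x) (RightMod.orb y) B.δ.hom B.takeuchi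
    have h' := tm (a ≫ B.δ.hom) b ≫= h
    rw [← Category.assoc, ← Category.assoc, tm_whiskerRight] at h'
    exact h'

theorem el_tens (M N : RightMod A) (x : 𝟙_ V ⟶ M.X) (y : 𝟙_ V ⟶ N.X) (a : 𝟙_ V ⟶ A.X) :
    tm (tb (P := B.bimod M) (Q := B.bimod N) x y) a ≫ (B.tens M N).act =
      (a ≫ B.δ.hom) ≫ (B.orb x ⊗ₘ B.orb y).hom :=
  B.el_takAct M N B.δ.hom B.takeuchi x y a

theorem reg_actLeft (r : 𝟙_ V ⟶ R.X) (a : 𝟙_ V ⟶ A.X) :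
    tm r a ≫ B.reg.actLeft = tm a (r ≫ B.t) ≫ MonObj.mul :=
  B.el_actLeft (RightMod.regular A) r a

theorem reg_actRight (r : 𝟙_ V ⟶ R.X) (a : 𝟙_ V ⟶ A.X) :
    tm a r ≫ B.reg.actRight = tm a (r ≫ B.s) ≫ MonObj.mul :=
  B.el_actRight (RightMod.regular A) a r

theorem ε_left : (B.bimod (RightMod.regular A)).actLeft ≫ B.ε = R.X ◁ B.ε ≫ MonObj.mul :=
  B.counit.left_act_hom

theorem ε_right : (B.bimod (RightMod.regular A)).actRight ≫ B.ε = B.ε ▷ R.X ≫ MonObj.mul :=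
  B.counit.right_act_hom

/-- `ε(a s(r)) = ε(a) r`. -/
theorem counit_mul_s (a : 𝟙_ V ⟶ A.X) (r : 𝟙_ V ⟶ R.X) :
    (tm a (r ≫ B.s) ≫ MonObj.mul) ≫ B.ε = tm (a ≫ B.ε) r ≫ MonObj.mul := by
  have h := tm a r ≫= B.ε_right
  rw [← Category.assoc, ← Category.assoc _ (B.ε ▷ R.X), tm_whiskerRight] at h
  refine Eq.trans ?_ h
  congr 1
  exact (B.reg_actRight r a).symm

/-- `ε(a t(r)) = r ε(a)`. -/
theorem counit_mul_t (a : 𝟙_ V ⟶ A.X) (r : 𝟙_ V ⟶ R.X) :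
    (tm a (r ≫ B.t) ≫ MonObj.mul) ≫ B.ε = tm r (a ≫ B.ε) ≫ MonObj.mul := by
  have h := tm r a ≫= B.ε_left
  rw [← Category.assoc, ← Category.assoc _ (R.X ◁ B.ε), tm_whiskerLeft] at h
  refine Eq.trans ?_ h
  congr 1
  exact (B.reg_actLeft r a).symm

theorem el_one_mul {A : Mon V} (a : 𝟙_ V ⟶ A.X) : tm MonObj.one a ≫ MonObj.mul = a := by
  have h := tm (𝟙 _) a ≫= MonObj.one_mul A.X
  rwa [← Category.assoc, tm_whiskerRight, Category.id_comp, tm_leftUnitor_hom] at h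

theorem el_mul_one {A : Mon V} (a : 𝟙_ V ⟶ A.X) : tm a MonObj.one ≫ MonObj.mul = a := by
  have h := tm a (𝟙 _) ≫= MonObj.mul_one A.X
  rwa [← Category.assoc, tm_whiskerLeft, Category.id_comp, tm_rightUnitor_hom] at h

theorem el_mul_assoc {A : Mon V} (a b c : 𝟙_ V ⟶ A.X) :
    tm (tm a b ≫ MonObj.mul) c ≫ MonObj.mul = tm a (tm b c ≫ MonObj.mul) ≫ MonObj.mul :=
  (RightMod.el_mul (RightMod.regular A) a b c).symm

theorem counit_s_el (r : 𝟙_ V ⟶ R.X) : (r ≫ B.s) ≫ B.ε = r := by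
  have h := B.counit_mul_s MonObj.one r
  rw [el_one_mul, B.counit_one] at h
  exact h.trans (el_one_mul r)

theorem counit_t_el (r : 𝟙_ V ⟶ R.X) : (r ≫ B.t) ≫ B.ε = r := by
  have h := B.counit_mul_t MonObj.one r
  rw [el_one_mul, B.counit_one] at h
  exact h.trans (el_mul_one r)

/-- The action `r ⊗ a ↦ ε(s(r) a)` of `A` on `R`. -/
def unitAct : R.X ⊗ A.X ⟶ R.X := B.s ▷ A.X ≫ MonObj.mul ≫ B.ε

theorem el_unitAct (r : 𝟙_ V ⟶ R.X) (a : 𝟙_ V ⟶ A.X) :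
    tm r a ≫ B.unitAct = (tm (r ≫ B.s) a ≫ MonObj.mul) ≫ B.ε := by
  rw [unitAct, ← Category.assoc, ← Category.assoc, tm_whiskerRight]

/-- The unit object of the monoidal category of right `A`-modules: `R` with the action
`r ⊗ a ↦ ε(s(r) a)`. -/
abbrev unitMod : RightMod A where
  X := R.X
  act := B.unitAct
  act_one := by
    rw [← cancel_epi (ρ_ _).inv]
    refine el_ext fun x => ?_
    rw [Iso.inv_hom_id, Category.comp_id, ← Category.assoc, ← Category.assoc, el_rightUnitor_inv,
      tm_whiskerLeft, Category.id_comp, el_unitAct, el_mul_one, counit_s_el]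
  act_assoc := by
    rw [← cancel_epi (α_ _ _ _).hom, Iso.hom_inv_id_assoc]
    refine tm_ext₃ fun r a b => ?_
    rw [← Category.assoc, ← Category.assoc, ← Category.assoc, tm_associator_hom, tm_whiskerLeft,
      tm_whiskerRight, el_unitAct, el_unitAct, el_unitAct]
    rw [B.el_counit_s, el_mul_assoc]

theorem δ_t (r : 𝟙_ V ⟶ R.X) :
    (r ≫ B.t) ≫ B.δ.hom = tb (P := B.reg) (Q := B.reg) (r ≫ B.t) MonObj.one := by
  have h := tm r (MonObj.one (X := A.X)) ≫= B.δ.left_act_hom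
  rw [← Category.assoc, ← Category.assoc _ (R.X ◁ B.δ.hom), tm_whiskerLeft] at h
  have e := (B.reg_actLeft r MonObj.one).trans (el_one_mul (r ≫ B.t))
  refine (congrArg (· ≫ B.δ.hom) e.symm).trans (h.trans ?_)
  rw [B.comul_one, tb_actLeft]
  exact congrArg (fun z => tb (P := B.reg) (Q := B.reg) z MonObj.one) e

theorem δ_s (r : 𝟙_ V ⟶ R.X) :
    (r ≫ B.s) ≫ B.δ.hom = tb (P := B.reg) (Q := B.reg) MonObj.one (r ≫ B.s) := by
  have h := tm (MonObj.one (X := A.X)) r ≫= B.δ.right_act_hom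
  rw [← Category.assoc, ← Category.assoc _ (B.δ.hom ▷ R.X), tm_whiskerRight] at h
  have e := (B.reg_actRight r MonObj.one).trans (el_one_mul (r ≫ B.s))
  refine (congrArg (· ≫ B.δ.hom) e.symm).trans (h.trans ?_)
  rw [B.comul_one, tb_actRight]
  exact congrArg (fun z => tb (P := B.reg) (Q := B.reg) MonObj.one z) e

/-- `Φ(M ⊗_A N) = Φ(M) ⊗_R Φ(N)`: the two sides have the same underlying object, and the identity
is an isomorphism of bimodules. -/
noncomputable def tensIso (M N : RightMod A) : B.bimod M ⊗ B.bimod N ≅ B.bimod (B.tens M N) :=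
  Bimod.isoOfIso (Iso.refl (B.bimod M ⊗ B.bimod N : Bimod R R).X)
    (by
      refine tm_tb_ext' fun r x y => ?_
      rw [Iso.refl_hom, Category.comp_id, MonoidalCategory.whiskerLeft_id, Category.id_comp,
        tb_actLeft, B.el_actLeft]
      refine Eq.trans ?_ (B.el_actLeft (B.tens M N) r _).symm
      rw [el_tens, δ_t, tb_tensorHom, B.one_act, B.el_orb])
    (by
      refine tm_tb_ext fun x y r => ?_
      rw [Iso.refl_hom, Category.comp_id, id_whiskerRight, Category.id_comp,
        tb_actRight, B.el_actRight]
      refine Eq.trans ?_ (B.el_actRight (B.tens M N) _ r).symm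
      rw [el_tens, δ_s, tb_tensorHom, B.one_act, B.el_orb])

theorem unit_actLeft : (B.bimod B.unitMod).actLeft = MonObj.mul (X := R.X) := by
  refine tm_ext (X := R.X) (Y := R.X) fun r x => ?_
  refine (B.el_actLeft B.unitMod r x).trans ?_
  rw [el_unitAct, counit_mul_t, counit_s_el]

theorem unit_actRight : (B.bimod B.unitMod).actRight = MonObj.mul (X := R.X) := by
  refine tm_ext (X := R.X) (Y := R.X) fun x r => ?_
  refine (B.el_actRight B.unitMod x r).trans ?_
  rw [el_unitAct, counit_mul_s, counit_s_el]

/-- `Φ(E) = R`: the identity is an isomorphism of bimodules. -/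
noncomputable def unitIso : 𝟙_ (Bimod R R) ≅ B.bimod B.unitMod :=
  Bimod.isoOfIso (P := Bimod.regular R) (Iso.refl R.X)
    ((Category.comp_id (MonObj.mul (X := R.X))).trans
      (B.unit_actLeft.symm.trans ((Category.id_comp _).symm.trans
        (congrArg (· ≫ (B.bimod B.unitMod).actLeft)
          (MonoidalCategory.whiskerLeft_id R.X R.X).symm))))
    ((Category.comp_id (MonObj.mul (X := R.X))).trans
      (B.unit_actRight.symm.trans ((Category.id_comp _).symm.trans
        (congrArg (· ≫ (B.bimod B.unitMod).actRight) (id_whiskerRight R.X R.X).symm))))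

end RightBialgebroid
end Tensor
section Rep
variable {V : Type u} [Category.{v} V] [MonoidalCategory V] [SymmetricCategory V]
  [MonoidalClosed V] [HasCoequalizers V] [UnitSeparates V]

namespace RightBialgebroid
variable {R A : Mon V} (B : RightBialgebroid R A)

/-- A morphism of bimodules between modules is `A`-linear if it preserves orbit morphisms. -/
theorem linear_of_orb {M N : RightMod A} (f : B.bimod M ⟶ B.bimod N)
    (h : ∀ x : 𝟙_ V ⟶ M.X, B.orb x ≫ f = B.orb (x ≫ f.hom)) :
    M.act ≫ f.hom = f.hom ▷ A.X ≫ N.act := by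
  refine tm_ext fun x a => ?_
  have h1 := a ≫= congrArg Bimod.Hom.hom (h x)
  rw [Bimod.comp_hom', ← Category.assoc, B.el_orb, B.el_orb] at h1
  rw [← Category.assoc, h1, ← Category.assoc, tm_whiskerRight]

/-- An isomorphism of bimodules that is `A`-linear, as an isomorphism of modules. -/
def liftIso {M N : RightMod A} (i : B.bimod M ≅ B.bimod N)
    (h : M.act ≫ i.hom.hom = i.hom.hom ▷ A.X ≫ N.act) : M ≅ N where
  hom := RightMod.Hom.mk i.hom.hom h
  inv := RightMod.Hom.mk i.inv.hom (by
    have h1 : i.inv.hom ≫ i.hom.hom = 𝟙 _ := congrArg Bimod.Hom.hom i.inv_hom_id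
    have h2 : i.hom.hom ≫ i.inv.hom = 𝟙 _ := congrArg Bimod.Hom.hom i.hom_inv_id
    calc N.act ≫ i.inv.hom
        = (i.inv.hom ≫ i.hom.hom) ▷ A.X ≫ N.act ≫ i.inv.hom := by
          rw [h1]; exact ((congrArg (· ≫ N.act ≫ i.inv.hom) (id_whiskerRight _ _)).trans
            (Category.id_comp _)).symm
      _ = i.inv.hom ▷ A.X ≫ (M.act ≫ i.hom.hom) ≫ i.inv.hom := by
          rw [h, comp_whiskerRight, Category.assoc, Category.assoc]
      _ = i.inv.hom ▷ A.X ≫ M.act := by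
          rw [Category.assoc, h2]; exact congrArg (_ ≫ ·) (Category.comp_id _))
  hom_inv_id := RightMod.hom_ext (congrArg Bimod.Hom.hom i.hom_inv_id)
  inv_hom_id := RightMod.hom_ext (congrArg Bimod.Hom.hom i.inv_hom_id)

theorem bimodMap_liftIso {M N : RightMod A} (i : B.bimod M ≅ B.bimod N)
    (h : M.act ≫ i.hom.hom = i.hom.hom ▷ A.X ≫ N.act) :
    B.bimodMap (B.liftIso i h).hom = i.hom := rfl

/-- The tensor product of `A`-linear morphisms. -/
noncomputable def tensMap {M N M' N' : RightMod A} (f : M ⟶ M') (g : N ⟶ N') :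
    B.tens M N ⟶ B.tens M' N' :=
  RightMod.Hom.mk (M := B.tens M N) (N := B.tens M' N') (B.bimodMap f ⊗ₘ B.bimodMap g).hom
    (B.takAct_nat f g B.δ.hom B.takeuchi)

theorem bimodMap_tensMap {M N M' N' : RightMod A} (f : M ⟶ M') (g : N ⟶ N') :
    B.bimodMap (B.tensMap f g) =
      (B.tensIso M N).inv ≫ (B.bimodMap f ⊗ₘ B.bimodMap g) ≫ (B.tensIso M' N').hom := by
  ext
  exact ((Category.id_comp ((B.bimodMap f ⊗ₘ B.bimodMap g).hom ≫ 𝟙 _)).trans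
    (Category.comp_id _)).symm

theorem orb_tens (M N : RightMod A) (x : 𝟙_ V ⟶ M.X) (y : 𝟙_ V ⟶ N.X) :
    B.orb (M := B.tens M N) (tb (P := B.bimod M) (Q := B.bimod N) x y) =
      B.δ ≫ (B.orb x ⊗ₘ B.orb y) ≫ (B.tensIso M N).hom := by
  ext
  refine el_ext fun a => ?_
  refine (B.el_orb (M := B.tens M N) _ a).trans ?_
  rw [el_tens, Category.assoc]
  exact congrArg (fun z => a ≫ B.δ.hom ≫ z) (Category.comp_id _).symm

theorem orb_unit (r : 𝟙_ V ⟶ R.X) :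
    B.orb (M := B.unitMod) r = B.leftMul (r ≫ B.s) ≫ B.counit ≫ B.unitIso.hom := by
  ext
  refine el_ext fun a => ?_
  refine (B.el_orb (M := B.unitMod) _ a).trans ?_
  rw [el_unitAct]
  have h : a ≫ (B.leftMul (r ≫ B.s)).hom = tm (r ≫ B.s) a ≫ MonObj.mul :=
    B.el_orb (M := RightMod.regular A) _ a
  rw [← h, Category.assoc]
  exact congrArg (fun z => a ≫ (B.leftMul (r ≫ B.s)).hom ≫ z) (Category.comp_id _).symm

theorem takeuchi_el (r : 𝟙_ V ⟶ R.X) :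
    B.δ ≫ B.leftMul (r ≫ B.s) ▷ B.reg = B.δ ≫ B.reg ◁ B.leftMul (r ≫ B.t) := by
  ext
  exact B.takeuchi r

theorem leftMul_counit (r : 𝟙_ V ⟶ R.X) :
    B.leftMul (r ≫ B.s) ≫ B.counit = B.leftMul (r ≫ B.t) ≫ B.counit := by
  ext
  refine el_ext fun a => ?_
  have h : ∀ c : 𝟙_ V ⟶ A.X, a ≫ (B.leftMul c).hom = tm c a ≫ MonObj.mul :=
    fun c => B.el_orb (M := RightMod.regular A) c a
  rw [Bimod.comp_hom', Bimod.comp_hom', ← Category.assoc, ← Category.assoc, h, h]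
  have h2 := B.el_counit_s (r ≫ B.t) a
  rw [counit_t_el] at h2
  exact h2

theorem counit_δ : B.δ ≫ B.counit ▷ B.reg = (λ_ B.reg).inv := B.comon.counit_comul

theorem δ_counit : B.δ ≫ B.reg ◁ B.counit = (ρ_ B.reg).inv := B.comon.comul_counit

theorem δ_assoc : B.δ ≫ B.reg ◁ B.δ = B.δ ≫ B.δ ▷ B.reg ≫ (α_ _ _ _).hom := B.comon.comul_assoc

/-- The associator of bimodules, between the bimodules underlying tensor products of modules. -/
noncomputable def assocIso (M N L : RightMod A) :
    B.bimod (B.tens (B.tens M N) L) ≅ B.bimod (B.tens M (B.tens N L)) :=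
  ((B.tensIso _ _).symm ≪≫ ((B.tensIso _ _).symm ⊗ᵢ .refl _))
    ≪≫ α_ (B.bimod M) (B.bimod N) (B.bimod L)
    ≪≫ ((.refl _ ⊗ᵢ B.tensIso _ _) ≪≫ B.tensIso _ _)

noncomputable def leftIso (M : RightMod A) : B.bimod (B.tens B.unitMod M) ≅ B.bimod M :=
  ((B.tensIso _ _).symm ≪≫ (B.unitIso.symm ⊗ᵢ .refl _)) ≪≫ λ_ (B.bimod M)

noncomputable def rightIso (M : RightMod A) : B.bimod (B.tens M B.unitMod) ≅ B.bimod M :=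
  ((B.tensIso _ _).symm ≪≫ (.refl _ ⊗ᵢ B.unitIso.symm)) ≪≫ ρ_ (B.bimod M)

theorem linear_of_orb_tb {M N L : RightMod A} (f : B.bimod (B.tens M N) ⟶ B.bimod L)
    (h : ∀ (x : 𝟙_ V ⟶ M.X) (y : 𝟙_ V ⟶ N.X),
      B.orb (M := B.tens M N) (tb (P := B.bimod M) (Q := B.bimod N) x y) ≫ f =
        B.orb (tb (P := B.bimod M) (Q := B.bimod N) x y ≫ f.hom)) :
    (B.tens M N).act ≫ f.hom = f.hom ▷ A.X ≫ L.act := by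
  refine tm_tb_ext (P := B.bimod M) (Q := B.bimod N) fun x y a => ?_
  have h1 := a ≫= congrArg Bimod.Hom.hom (h x y)
  rw [Bimod.comp_hom', ← Category.assoc, B.el_orb, B.el_orb] at h1
  refine (Category.assoc _ _ _).symm.trans (h1.trans ?_)
  refine Eq.trans ?_ (Category.assoc _ _ _)
  rw [tm_whiskerRight]

theorem el_leftIso (M : RightMod A) (r : 𝟙_ V ⟶ R.X) (x : 𝟙_ V ⟶ M.X) :
    tb (P := B.bimod B.unitMod) (Q := B.bimod M) r x ≫ (B.leftIso M).hom.hom =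
      tm x (r ≫ B.t) ≫ M.act := by
  have h : (B.leftIso M).hom.hom =
      ((B.tensIso B.unitMod M).inv ≫ (B.unitIso.inv ⊗ₘ 𝟙 _) ≫ (λ_ (B.bimod M)).hom).hom :=
    congrArg Bimod.Hom.hom (Category.assoc _ _ _)
  rw [h, Bimod.comp_hom', Bimod.comp_hom', ← Category.assoc]
  have h2 : tb (P := B.bimod B.unitMod) (Q := B.bimod M) r x ≫ (B.tensIso B.unitMod M).inv.hom =
    tb (P := B.bimod B.unitMod) (Q := B.bimod M) r x := Category.comp_id _
  rw [h2, ← Category.assoc, tb_tensorHom, Bimod.id_hom', Category.comp_id]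
  refine Eq.trans ?_ ((tb_leftUnitor (P := B.bimod M) r x).trans (B.el_actLeft M r x))
  congr 2
  exact Category.comp_id _

theorem el_rightIso (M : RightMod A) (r : 𝟙_ V ⟶ R.X) (x : 𝟙_ V ⟶ M.X) :
    tb (P := B.bimod M) (Q := B.bimod B.unitMod) x r ≫ (B.rightIso M).hom.hom =
      tm x (r ≫ B.s) ≫ M.act := by
  have h : (B.rightIso M).hom.hom =
      ((B.tensIso M B.unitMod).inv ≫ (𝟙 _ ⊗ₘ B.unitIso.inv) ≫ (ρ_ (B.bimod M)).hom).hom :=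
    congrArg Bimod.Hom.hom (Category.assoc _ _ _)
  rw [h, Bimod.comp_hom', Bimod.comp_hom', ← Category.assoc]
  have h2 : tb (P := B.bimod M) (Q := B.bimod B.unitMod) x r ≫ (B.tensIso M B.unitMod).inv.hom =
    tb (P := B.bimod M) (Q := B.bimod B.unitMod) x r := Category.comp_id _
  rw [h2, ← Category.assoc, tb_tensorHom, Bimod.id_hom', Category.comp_id]
  refine Eq.trans ?_ ((tb_rightUnitor (P := B.bimod M) x r).trans (B.el_actRight M x r))
  congr 2
  exact Category.comp_id _

theorem leftIso_linear (M : RightMod A) :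
    (B.tens B.unitMod M).act ≫ (B.leftIso M).hom.hom = (B.leftIso M).hom.hom ▷ A.X ≫ M.act := by
  refine B.linear_of_orb_tb _ fun r x => ?_
  rw [el_leftIso, orb_tens, orb_unit, ReRing.orb_act]
  simp only [leftIso, Iso.trans_hom, Iso.symm_hom, tensorIso_hom, Iso.refl_hom, Category.assoc,
    Iso.hom_inv_id_assoc, tensorHom_comp_tensorHom_assoc, Iso.hom_inv_id, Category.comp_id]
  have h : (B.leftMul (r ≫ B.s) ≫ B.counit ⊗ₘ B.orb x) =
      B.leftMul (r ≫ B.s) ▷ B.reg ≫ (B.counit ⊗ₘ B.orb x) := by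
    rw [← tensorHom_id, tensorHom_comp_tensorHom, Category.id_comp]
  rw [h, Category.assoc, ← Category.assoc B.δ, takeuchi_el, Category.assoc,
    ← id_tensorHom, tensorHom_comp_tensorHom_assoc, Category.id_comp,
    MonoidalCategory.tensorHom_def, Category.assoc, leftUnitor_naturality, ← Category.assoc,
    counit_δ, Iso.inv_hom_id_assoc]

theorem rightIso_linear (M : RightMod A) :
    (B.tens M B.unitMod).act ≫ (B.rightIso M).hom.hom = (B.rightIso M).hom.hom ▷ A.X ≫ M.act := by
  refine B.linear_of_orb_tb _ fun x r => ?_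
  rw [el_rightIso, orb_tens, orb_unit, ReRing.orb_act]
  simp only [rightIso, Iso.trans_hom, Iso.symm_hom, tensorIso_hom, Iso.refl_hom, Category.assoc,
    Iso.hom_inv_id_assoc, tensorHom_comp_tensorHom_assoc, Iso.hom_inv_id, Category.comp_id]
  rw [leftMul_counit]
  have h : (B.orb x ⊗ₘ B.leftMul (r ≫ B.t) ≫ B.counit) =
      B.reg ◁ B.leftMul (r ≫ B.t) ≫ (B.orb x ⊗ₘ B.counit) := by
    rw [← id_tensorHom, tensorHom_comp_tensorHom, Category.id_comp]
  rw [h, Category.assoc, ← Category.assoc B.δ, ← takeuchi_el, Category.assoc,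
    ← tensorHom_id, tensorHom_comp_tensorHom_assoc, Category.id_comp,
    MonoidalCategory.tensorHom_def', Category.assoc, rightUnitor_naturality, ← Category.assoc,
    δ_counit, Iso.inv_hom_id_assoc]

theorem el_assocIso (M N L : RightMod A) (x : 𝟙_ V ⟶ M.X) (y : 𝟙_ V ⟶ N.X) (z : 𝟙_ V ⟶ L.X) :
    tb (P := B.bimod (B.tens M N)) (Q := B.bimod L)
        (tb (P := B.bimod M) (Q := B.bimod N) x y) z ≫ (B.assocIso M N L).hom.hom =
      tb (P := B.bimod M) (Q := B.bimod (B.tens N L)) x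
        (tb (P := B.bimod N) (Q := B.bimod L) y z) := by
  have h : (B.assocIso M N L).hom.hom =
      ((B.tensIso (B.tens M N) L).inv ≫ ((B.tensIso M N).inv ⊗ₘ 𝟙 _) ≫
        (α_ (B.bimod M) (B.bimod N) (B.bimod L)).hom ≫ (𝟙 _ ⊗ₘ (B.tensIso N L).hom) ≫
          (B.tensIso M (B.tens N L)).hom).hom :=
    congrArg Bimod.Hom.hom (Category.assoc _ _ _)
  have h2 : ∀ w : 𝟙_ V ⟶ (B.tens (B.tens M N) L).X,
    w ≫ (B.tensIso (B.tens M N) L).inv.hom = w := fun w => Category.comp_id _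
  have h3 : ∀ w : 𝟙_ V ⟶ (B.tens M N).X, w ≫ (B.tensIso M N).inv.hom = w :=
    fun w => Category.comp_id _
  have h4 : ∀ w : 𝟙_ V ⟶ (B.tens N L).X, w ≫ (B.tensIso N L).hom.hom = w :=
    fun w => Category.comp_id _
  have h5 : ∀ w : 𝟙_ V ⟶ (B.tens M (B.tens N L)).X,
    w ≫ (B.tensIso M (B.tens N L)).hom.hom = w := fun w => Category.comp_id _
  simp only [h, Bimod.comp_hom', ← Category.assoc]
  rw [h2, tb_tensorHom, h3, Bimod.id_hom', Category.comp_id]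
  refine (congrArg (fun w => (w ≫ _) ≫ _)
    (tb_associator (P := B.bimod M) (Q := B.bimod N) (L := B.bimod L) x y z)).trans ?_
  rw [tb_tensorHom, Bimod.id_hom', Category.comp_id]
  refine (h5 _).trans ?_
  congr 1
  exact h4 _

theorem orb_assocIso (M N L : RightMod A) (x : 𝟙_ V ⟶ M.X) (y : 𝟙_ V ⟶ N.X) (z : 𝟙_ V ⟶ L.X) :
    B.orb (M := B.tens (B.tens M N) L) (tb (P := B.bimod (B.tens M N)) (Q := B.bimod L)
        (tb (P := B.bimod M) (Q := B.bimod N) x y) z) ≫ (B.assocIso M N L).hom =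
      B.orb (M := B.tens M (B.tens N L)) (tb (P := B.bimod M) (Q := B.bimod (B.tens N L)) x
        (tb (P := B.bimod N) (Q := B.bimod L) y z)) := by
  have a1 := B.orb_tens (B.tens M N) L (tb (P := B.bimod M) (Q := B.bimod N) x y) z
  have a2 := B.orb_tens M (B.tens N L) x (tb (P := B.bimod N) (Q := B.bimod L) y z)
  rw [orb_tens] at a1 a2
  refine (congrArg (· ≫ (B.assocIso M N L).hom) a1).trans (Eq.trans ?_ a2.symm)
  simp only [assocIso, Iso.trans_hom, Iso.symm_hom, tensorIso_hom, Iso.refl_hom, Category.assoc,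
    Iso.hom_inv_id_assoc, tensorHom_comp_tensorHom_assoc, Iso.hom_inv_id, Category.comp_id]
  have h1 : (B.δ ≫ (B.orb x ⊗ₘ B.orb y) ⊗ₘ B.orb z) =
      B.δ ▷ B.reg ≫ ((B.orb x ⊗ₘ B.orb y) ⊗ₘ B.orb z) := by
    rw [← tensorHom_id, tensorHom_comp_tensorHom, Category.id_comp]
  have h2 : (B.orb x ⊗ₘ B.δ ≫ (B.orb y ⊗ₘ B.orb z) ≫ (B.tensIso N L).hom) =
      B.reg ◁ B.δ ≫ (B.orb x ⊗ₘ (B.orb y ⊗ₘ B.orb z)) ≫ (𝟙 _ ⊗ₘ (B.tensIso N L).hom) := by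
    rw [← id_tensorHom, tensorHom_comp_tensorHom, tensorHom_comp_tensorHom, Category.id_comp,
      Category.comp_id]
  rw [h1, h2]
  have h3 := B.δ_assoc =≫ ((B.orb x ⊗ₘ (B.orb y ⊗ₘ B.orb z)) ≫
    (𝟙 _ ⊗ₘ (B.tensIso N L).hom) ≫ (B.tensIso M (B.tens N L)).hom)
  simp only [Category.assoc] at h3 ⊢
  rw [h3, ← associator_naturality_assoc]

theorem assocIso_linear (M N L : RightMod A) :
    (B.tens (B.tens M N) L).act ≫ (B.assocIso M N L).hom.hom =
      (B.assocIso M N L).hom.hom ▷ A.X ≫ (B.tens M (B.tens N L)).act := by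
  refine ext_insR fun a => tb_ext (P := B.bimod (B.tens M N)) (Q := B.bimod L) fun w z => ?_
  have key : insR (B.bimod M ⊗ B.bimod N : Bimod R R).X z ≫
      tπ (B.bimod (B.tens M N)) (B.bimod L) ≫ insR (B.tens (B.tens M N) L).X a ≫
        (B.tens (B.tens M N) L).act ≫ (B.assocIso M N L).hom.hom =
      insR (B.bimod M ⊗ B.bimod N : Bimod R R).X z ≫
      tπ (B.bimod (B.tens M N)) (B.bimod L) ≫ insR (B.tens (B.tens M N) L).X a ≫
        (B.assocIso M N L).hom.hom ▷ A.X ≫ (B.tens M (B.tens N L)).act := by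
    refine tb_ext fun x y => ?_
    have h1 := a ≫= congrArg Bimod.Hom.hom (B.orb_assocIso M N L x y z)
    rw [Bimod.comp_hom', ← Category.assoc, B.el_orb, B.el_orb, ← el_assocIso,
      ← tm_whiskerRight] at h1
    have e1 : tb (P := B.bimod M) (Q := B.bimod N) x y ≫
        insR (B.bimod M ⊗ B.bimod N : Bimod R R).X z ≫
        tπ (B.bimod (B.tens M N)) (B.bimod L) ≫ insR (B.tens (B.tens M N) L).X a =
        tm (tb (P := B.bimod (B.tens M N)) (Q := B.bimod L)
          (tb (P := B.bimod M) (Q := B.bimod N) x y) z) a := by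
      rw [← Category.assoc, el_insR]
      refine (Category.assoc _ _ _).symm.trans ?_
      exact el_insR _ _
    have e2 := fun (W : V) (f : (B.tens (B.tens M N) L).X ⊗ A.X ⟶ W) => e1 =≫ f
    simp only [Category.assoc] at e2 h1
    exact (e2 _ _).trans (h1.trans (e2 _ _).symm)
  have k := w ≫= key
  have e1 : w ≫ insR (B.bimod M ⊗ B.bimod N : Bimod R R).X z ≫
      tπ (B.bimod (B.tens M N)) (B.bimod L) =
      tb (P := B.bimod (B.tens M N)) (Q := B.bimod L) w z := by
    rw [← Category.assoc, el_insR]; rfl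
  have e2 := fun (W : V) (f : (B.tens (B.tens M N) L).X ⟶ W) => e1 =≫ f
  simp only [Category.assoc] at e2
  exact (e2 _ _).symm.trans (k.trans (e2 _ _))

end RightBialgebroid
end Rep
section Rep
variable {V : Type u} [Category.{v} V] [MonoidalCategory V] [SymmetricCategory V]
  [MonoidalClosed V] [HasCoequalizers V] [UnitSeparates V]

namespace RightBialgebroid
variable {R A : Mon V} (B : RightBialgebroid R A)

/-- The category `V_A` of right modules over (the monoid underlying) a right bialgebroid `A`. -/
def Rep (_ : RightBialgebroid R A) : Type (max u v) := RightMod A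

instance : Category B.Rep := inferInstanceAs (Category (RightMod A))

/-- The forgetful functor `Φ` from right `A`-modules to `R`-`R`-bimodules:
`r · x = x t(r)` and `x · r = x s(r)`. -/
def Φ : B.Rep ⥤ Bimod R R where
  obj M := B.bimod M
  map f := B.bimodMap f

instance : B.Φ.Faithful where
  map_injective h := RightMod.hom_ext (congrArg Bimod.Hom.hom h)

/-- The tensor product `M ⊗_R N` with `(x ⊗_R y) a = x a₁ ⊗_R y a₂`, the unit object `R` with
`r a = ε(s(r) a)`, and the coherence isomorphisms of `R`-`R`-bimodules. -/
noncomputable instance : MonoidalCategoryStruct B.Rep where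
  tensorObj M N := B.tens M N
  tensorUnit := B.unitMod
  tensorHom f g := B.tensMap f g
  whiskerLeft M _ _ f := B.tensMap (𝟙 M) f
  whiskerRight f N := B.tensMap f (𝟙 N)
  associator M N L := B.liftIso (B.assocIso M N L) (B.assocIso_linear M N L)
  leftUnitor M := B.liftIso (B.leftIso M) (B.leftIso_linear M)
  rightUnitor M := B.liftIso (B.rightIso M) (B.rightIso_linear M)

/-- `Φ` preserves the tensor product and the unit, on the nose on underlying objects. -/
noncomputable def inducingData : Monoidal.InducingFunctorData B.Φ where
  μIso M N := B.tensIso M N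
  εIso := B.unitIso
  tensorHom_eq f g := B.bimodMap_tensMap f g
  whiskerLeft_eq M _ _ f := by
    rw [← id_tensorHom]
    exact B.bimodMap_tensMap (𝟙 (show RightMod A from M)) f
  whiskerRight_eq f N := by
    rw [← tensorHom_id]
    exact B.bimodMap_tensMap f (𝟙 (show RightMod A from N))
  associator_eq M N L := rfl
  leftUnitor_eq M := rfl
  rightUnitor_eq M := rfl

/-- The monoidal category `V_A` of right modules over a right bialgebroid `A`. -/
noncomputable instance : MonoidalCategory B.Rep := Monoidal.induced B.Φ B.inducingData

/-- The monoidal structure of the forgetful functor `Φ`: its structure morphisms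
`Φ(M) ⊗_R Φ(N) ⟶ Φ(M ⊗ N)` and `R ⟶ Φ(E)` are carried by identity morphisms of `V`. -/
noncomputable instance : B.Φ.Monoidal := Monoidal.fromInducedMonoidal B.Φ B.inducingData

theorem Φ_μ_hom (M N : B.Rep) : (Functor.LaxMonoidal.μ B.Φ M N).hom =
    𝟙 (B.bimod M ⊗ B.bimod N : Bimod R R).X := rfl

theorem Φ_ε_hom : (Functor.LaxMonoidal.ε B.Φ).hom = 𝟙 R.X := rfl

end RightBialgebroid
end Rep

instance (k : Type v) [CommRing k] : UnitSeparates (ModuleCat.{v} k) where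
  isSeparator := by
    intro X Y f g h
    ext x
    have := h (𝟙_ _) (by simp) (ModuleCat.ofHom (LinearMap.toSpanSingleton k X x))
    have h2 := congrArg (fun m => m.hom (1 : k)) this
    have e : (LinearMap.toSpanSingleton k X x) (1 : k) = x := by simp
    exact (congrArg f.hom e).symm.trans (h2.trans (congrArg g.hom e))

instance : UnitSeparates (Type v) where
  isSeparator := Types.isSeparator_punit

section Ab
open TensorProduct

/-- The tensor product of abelian groups, `ℤ` being the unit. -/
noncomputable instance : MonoidalCategoryStruct AddCommGrpCat.{v} where
  tensorObj M N := AddCommGrpCat.of (M ⊗[ℤ] N)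
  tensorHom f g := AddCommGrpCat.ofHom
    (TensorProduct.map f.hom.toIntLinearMap g.hom.toIntLinearMap).toAddMonoidHom
  whiskerLeft M _ _ f := AddCommGrpCat.ofHom
    (TensorProduct.map LinearMap.id f.hom.toIntLinearMap).toAddMonoidHom
  whiskerRight f N := AddCommGrpCat.ofHom
    (TensorProduct.map f.hom.toIntLinearMap LinearMap.id).toAddMonoidHom
  tensorUnit := AddCommGrpCat.of (ULift.{v} ℤ)
  associator M N L := (TensorProduct.assoc ℤ M N L).toAddEquiv.toAddCommGrpIso
  leftUnitor M := ((TensorProduct.congr ULift.moduleEquiv (LinearEquiv.refl ℤ M)).trans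
    (TensorProduct.lid ℤ M)).toAddEquiv.toAddCommGrpIso
  rightUnitor M := ((TensorProduct.congr (LinearEquiv.refl ℤ M) ULift.moduleEquiv).trans
    (TensorProduct.rid ℤ M)).toAddEquiv.toAddCommGrpIso

theorem ab_ext {M N L : AddCommGrpCat.{v}} {f g : AddCommGrpCat.of (M ⊗[ℤ] N) ⟶ L}
    (h : ∀ m n, f.hom (m ⊗ₜ[ℤ] n) = g.hom (m ⊗ₜ[ℤ] n)) : f = g := by
  ext x
  induction x using TensorProduct.induction_on with
  | zero => exact (map_zero f.hom).trans (map_zero g.hom).symm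
  | tmul m n => exact h m n
  | add x y hx hy => exact (map_add f.hom x y).trans ((congrArg₂ (· + ·) hx hy).trans (map_add g.hom x y).symm)

theorem ab_ext₃ {M N L P : AddCommGrpCat.{v}}
    {f g : AddCommGrpCat.of ((M ⊗[ℤ] N) ⊗[ℤ] L) ⟶ P}
    (h : ∀ m n l, f.hom ((m ⊗ₜ[ℤ] n) ⊗ₜ[ℤ] l) = g.hom ((m ⊗ₜ[ℤ] n) ⊗ₜ[ℤ] l)) : f = g := by
  refine ab_ext (M := AddCommGrpCat.of (M ⊗[ℤ] N)) fun x l => ?_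
  induction x using TensorProduct.induction_on with
  | zero => rw [TensorProduct.zero_tmul]; exact (map_zero f.hom).trans (map_zero g.hom).symm
  | tmul m n => exact h m n l
  | add x y hx hy =>
    rw [TensorProduct.add_tmul]
    exact (map_add f.hom _ _).trans ((congrArg₂ (· + ·) hx hy).trans (map_add g.hom _ _).symm)

theorem ab_ext₄ {M N L P Q : AddCommGrpCat.{v}}
    {f g : AddCommGrpCat.of (((M ⊗[ℤ] N) ⊗[ℤ] L) ⊗[ℤ] P) ⟶ Q}
    (h : ∀ m n l p, f.hom (((m ⊗ₜ[ℤ] n) ⊗ₜ[ℤ] l) ⊗ₜ[ℤ] p) =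
      g.hom (((m ⊗ₜ[ℤ] n) ⊗ₜ[ℤ] l) ⊗ₜ[ℤ] p)) : f = g := by
  refine ab_ext₃ (M := AddCommGrpCat.of (M ⊗[ℤ] N)) fun x l p => ?_
  induction x using TensorProduct.induction_on with
  | zero => simp only [TensorProduct.zero_tmul]; exact (map_zero f.hom).trans (map_zero g.hom).symm
  | tmul m n => exact h m n l p
  | add x y hx hy =>
    simp only [TensorProduct.add_tmul]
    exact (map_add f.hom _ _).trans ((congrArg₂ (· + ·) hx hy).trans (map_add g.hom _ _).symm)

noncomputable instance : MonoidalCategory AddCommGrpCat.{v} := MonoidalCategory.ofTensorHom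
  (id_tensorHom_id := fun M N => ab_ext fun m n => rfl)
  (id_tensorHom := fun M _ _ f => ab_ext fun m n => rfl)
  (tensorHom_id := fun f N => ab_ext fun m n => rfl)
  (tensorHom_comp_tensorHom := fun f g h k => ab_ext fun m n => rfl)
  (associator_naturality := fun f g h => ab_ext₃ fun m n l => rfl)
  (leftUnitor_naturality := fun {M N} f =>
    ab_ext (M := AddCommGrpCat.of (ULift.{v} ℤ)) fun m n => (map_zsmul f.hom m.down n).symm)
  (rightUnitor_naturality := fun {M N} f =>
    ab_ext (N := AddCommGrpCat.of (ULift.{v} ℤ)) fun n m => (map_zsmul f.hom m.down n).symm)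
  (pentagon := fun M N K L => ab_ext₄ fun m n k l => rfl)
  (triangle := fun M N => ab_ext₃ (N := AddCommGrpCat.of (ULift.{v} ℤ))
    fun m z n => (TensorProduct.smul_tmul z.down m n).symm)

/-- The flip `m ⊗ n ↦ n ⊗ m`. -/
noncomputable def abBraiding (M N : AddCommGrpCat.{v}) : M ⊗ N ≅ N ⊗ M :=
  (TensorProduct.comm ℤ M N).toAddEquiv.toAddCommGrpIso

theorem abt_ext {M N L : AddCommGrpCat.{v}} {f g : M ⊗ N ⟶ L}
    (h : ∀ (m : M) (n : N), f.hom (m ⊗ₜ[ℤ] n) = g.hom (m ⊗ₜ[ℤ] n)) : f = g :=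
  ab_ext h

theorem abt_ext₃ {M N L P : AddCommGrpCat.{v}} {f g : (M ⊗ N) ⊗ L ⟶ P}
    (h : ∀ (m : M) (n : N) (l : L),
      f.hom ((m ⊗ₜ[ℤ] n) ⊗ₜ[ℤ] l) = g.hom ((m ⊗ₜ[ℤ] n) ⊗ₜ[ℤ] l)) : f = g :=
  ab_ext₃ (M := M) (N := N) (L := L) h

noncomputable instance : SymmetricCategory AddCommGrpCat.{v} where
  braiding := abBraiding
  braiding_naturality_right M _ _ f := abt_ext fun m n => rfl
  braiding_naturality_left f N := abt_ext fun m n => rfl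
  hexagon_forward M N L := abt_ext₃ fun m n l => rfl
  hexagon_reverse M N L := by
    rw [← cancel_epi (α_ M N L).hom]
    exact abt_ext₃ fun m n l => rfl
  symmetry M N := abt_ext fun m n => rfl

noncomputable instance : MonoidalClosed AddCommGrpCat.{v} where
  closed M :=
    { rightAdj := preadditiveCoyoneda.obj (Opposite.op M)
      adj := Adjunction.mkOfHomEquiv
        { homEquiv := fun N P =>
            { toFun := fun f => AddCommGrpCat.ofHom
                { toFun := fun n => AddCommGrpCat.ofHom
                    { toFun := fun m => f.hom (m ⊗ₜ[ℤ] n)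
                      map_zero' := by rw [TensorProduct.zero_tmul]; exact map_zero f.hom
                      map_add' := fun a b => by
                        rw [TensorProduct.add_tmul]; exact map_add f.hom _ _ }
                  map_zero' := by
                    refine AddCommGrpCat.hom_ext (AddMonoidHom.ext fun m => ?_)
                    exact (congrArg f.hom (TensorProduct.tmul_zero _ m)).trans (map_zero f.hom)
                  map_add' := fun a b => by
                    refine AddCommGrpCat.hom_ext (AddMonoidHom.ext fun m => ?_)
                    exact (congrArg f.hom (TensorProduct.tmul_add m a b)).trans
                      (map_add f.hom _ _) }
              invFun := fun f => AddCommGrpCat.ofHom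
                (TensorProduct.lift
                  (AddMonoidHom.toIntLinearMap
                    { toFun := fun m => AddMonoidHom.toIntLinearMap
                        { toFun := fun n => (f.hom n).hom m
                          map_zero' := by rw [map_zero]; rfl
                          map_add' := fun a b => by rw [map_add]; rfl }
                      map_zero' := by ext n; exact map_zero (f.hom n).hom
                      map_add' := fun a b => by
                        ext n; exact map_add (f.hom n).hom a b })).toAddMonoidHom
              left_inv := fun f => ab_ext fun m n => rfl
              right_inv := fun f => by ext n; rfl }
          homEquiv_naturality_left_symm := fun f g => ab_ext fun m n => rfl
          homEquiv_naturality_right := fun f g => by ext n; rfl } }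

instance : UnitSeparates AddCommGrpCat.{v} where
  isSeparator := by
    intro X Y f g h
    ext x
    have := h (𝟙_ _) (by simp)
      (AddCommGrpCat.ofHom ((zmultiplesHom X x).comp AddEquiv.ulift.toAddMonoidHom))
    have h2 := congrArg (fun m => m.hom (ULift.up 1)) this
    have e : (zmultiplesHom X x) 1 = x := by simp
    exact (congrArg f.hom e).symm.trans (h2.trans (congrArg g.hom e))

end Ab

section Convolution
variable {C : Type u} [Category.{v} C] [MonoidalCategory C]

section Preadditive
variable [Preadditive C] [MonoidalPreadditive C] (g N : C) [ComonObj g] [MonObj N]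

instance : AddCommGroup (Conv g N) := inferInstanceAs (AddCommGroup (g ⟶ N))

variable {g N} in
theorem conv_add (a b c : g ⟶ N) :
    (ComonObj.comul ≫ a ▷ g ≫ N ◁ (b + c) ≫ MonObj.mul : g ⟶ N) =
      ComonObj.comul ≫ a ▷ g ≫ N ◁ b ≫ MonObj.mul +
        ComonObj.comul ≫ a ▷ g ≫ N ◁ c ≫ MonObj.mul := by
  simp

variable {g N} in
theorem add_conv (a b c : g ⟶ N) :
    (ComonObj.comul ≫ (a + b) ▷ g ≫ N ◁ c ≫ MonObj.mul : g ⟶ N) =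
      ComonObj.comul ≫ a ▷ g ≫ N ◁ c ≫ MonObj.mul +
        ComonObj.comul ≫ b ▷ g ≫ N ◁ c ≫ MonObj.mul := by
  simp

variable {g N} in
theorem conv_zero (a : g ⟶ N) :
    (ComonObj.comul ≫ a ▷ g ≫ N ◁ (0 : g ⟶ N) ≫ MonObj.mul : g ⟶ N) = 0 := by
  simp

variable {g N} in
theorem zero_conv (a : g ⟶ N) :
    (ComonObj.comul ≫ (0 : g ⟶ N) ▷ g ≫ N ◁ a ≫ MonObj.mul : g ⟶ N) = 0 := by
  simp

/-- The convolution ring. -/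
instance : Ring (Conv g N) where
  __ := (inferInstance : AddCommGroup (Conv g N))
  __ := (inferInstance : Monoid (Conv g N))
  left_distrib a b c := conv_add a b c
  right_distrib a b c := add_conv a b c
  zero_mul a := zero_conv a
  mul_zero a := conv_zero a
  zsmul := (inferInstance : AddCommGroup (Conv g N)).zsmul
  zsmul_zero' := (inferInstance : AddCommGroup (Conv g N)).zsmul_zero'
  zsmul_succ' := (inferInstance : AddCommGroup (Conv g N)).zsmul_succ'
  zsmul_neg' := (inferInstance : AddCommGroup (Conv g N)).zsmul_neg'

variable (k : Type v) [CommRing k] [Linear k C] [MonoidalLinear k C]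

instance : Module k (Conv g N) := inferInstanceAs (Module k (g ⟶ N))

variable {g N} in
theorem smul_conv (r : k) (a b : g ⟶ N) :
    (ComonObj.comul ≫ (r • a) ▷ g ≫ N ◁ b ≫ MonObj.mul : g ⟶ N) =
      r • (ComonObj.comul ≫ a ▷ g ≫ N ◁ b ≫ MonObj.mul) := by
  simp

variable {g N} in
theorem conv_smul (r : k) (a b : g ⟶ N) :
    (ComonObj.comul ≫ a ▷ g ≫ N ◁ (r • b) ≫ MonObj.mul : g ⟶ N) =
      r • (ComonObj.comul ≫ a ▷ g ≫ N ◁ b ≫ MonObj.mul) := by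
  simp

/-- The convolution algebra. -/
instance : Algebra k (Conv g N) :=
  Algebra.ofModule (fun r a b => smul_conv k r a b) (fun r a b => conv_smul k r a b)

end Preadditive
end Convolution

section Monoids

/-- A `k`-algebra as a monoid in the monoidal category of `k`-modules. -/
noncomputable abbrev algMon (k : Type v) [CommRing k] (A : Type v) [Ring A] [Algebra k A] :
    Mon (ModuleCat.{v} k) where
  X := ModuleCat.of k A
  mon := ModuleCat.MonModuleEquivalenceAlgebra.inverseObj (AlgCat.of k A)

/-- The ring homomorphism `ℤ ⟶ A`. -/
def ringUnit (A : Type v) [Ring A] : ULift.{v} ℤ →+ A where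
  toFun z := (z.down : A)
  map_zero' := Int.cast_zero
  map_add' a b := Int.cast_add a.down b.down

/-- A ring as a monoid in the monoidal category of abelian groups. -/
noncomputable abbrev ringMon (A : Type v) [Ring A] : Mon AddCommGrpCat.{v} where
  X := AddCommGrpCat.of A
  mon :=
    { one := AddCommGrpCat.ofHom (ringUnit A)
      mul := AddCommGrpCat.ofHom (LinearMap.mul' ℤ A).toAddMonoidHom
      one_mul := abt_ext (M := AddCommGrpCat.of (ULift.{v} ℤ)) (N := AddCommGrpCat.of A)
        fun z a => (zsmul_eq_mul a z.down).symm
      mul_one := abt_ext (M := AddCommGrpCat.of A) (N := AddCommGrpCat.of (ULift.{v} ℤ))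
        fun a z => (Int.cast_comm z.down a).symm.trans (zsmul_eq_mul a z.down).symm
      mul_assoc := abt_ext₃ (M := AddCommGrpCat.of A) (N := AddCommGrpCat.of A)
        (L := AddCommGrpCat.of A) fun a b c => mul_assoc a b c }

/-- A monoid as a monoid in the monoidal category of sets. -/
noncomputable abbrev setMon (A : Type v) [Monoid A] : Mon (Type v) where
  X := A
  mon := (MonTypeEquivalenceMon.inverse.obj (MonCat.of A)).mon

end Monoids
end BGD

/-! The unit object separates morphisms, and since the tensor product is closed, morphisms out of X
⊗ Y are determined by their values on elements x ⊗ y. So every identity can be checked on elements.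
By Yoneda the element u of G g that corresponds to the identity of g is universal: each element of G
c is G(f)(u) for exactly one f : g → c. In particular the elements μ(u ⊗ u) and G₀ are G(γ)(u) and
G(π)(u), and the comonoid laws for (γ, π) are the associativity and unitality of G evaluated at u
(`ElRep.comon`).

The representation identifies R with G e and A with G g, and A acts on every G c by G(f)(u) · α =
G(f ∘ α)(u). In the canonical G e-bimodule G g one has s(ρ) = u · ρ and t(ρ) = ρ · u. Therefore the
bimodule structure that the A-module G c acquires along s and t is the canonical one coming from G
(`act_s`, `act_t`). The axioms on s, t and the counit become identities for a comonoid in C. The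
Takeuchi condition, for example, says that both composites apply ρ to the middle leg of the
threefold comultiplication (`comul_convS`).

Essential strength makes θ : G a ⊗_R G b → G(a ⊗ b) invertible (`isIso_θV`). Hence c ↦ G c is a
strong monoidal functor to bimodules. It carries the comonoid g to a comonoid on A ≅ G g with δ =
θ⁻¹ ∘ G γ. For x = G(f)(u) and y = G(h)(u) this gives θ(x α₁ ⊗ y α₂) = G((f ⊗ h) γ α)(u) = θ(x ⊗ y)
· α, so θ is A-linear (`comul_orb`, `takAct_θ`). Multiplicativity of δ then reduces to the
A-linearity of G γ, and the functor to bimodules lifts to A-modules. Since Φ is faithful, coherence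
of the lift is inherited from bimodules.

All of this takes place over a symmetric closed V with coequalizers and separating unit. The
structure `EndoRep` records the data required, and modules, abelian groups and sets only have to
supply it. -/

namespace BGD
open Functor.LaxMonoidal

/-! ### The comonoid structure on a representing object. -/

section ElementsRepresentation

variable {V : Type u} [Category.{v} V] [MonoidalCategory V]
  {C : Type w} [Category.{v} C] [MonoidalCategory C]

/-- A representation of the functor of elements `c ↦ V(i, G c)` by an object `g`. -/
structure ElRep (G : C ⥤ V) (g : C) where
  el : ∀ c : C, (g ⟶ c) ≃ (𝟙_ V ⟶ G.obj c)
  el_comp : ∀ {c d : C} (f : g ⟶ c) (h : c ⟶ d), el d (f ≫ h) = el c f ≫ G.map h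

namespace ElRep
variable {G : C ⥤ V} {g : C} (D : ElRep G g)

/-- The universal element of `G g`. -/
def univ : 𝟙_ V ⟶ G.obj g := D.el g (𝟙 g)

/-- Yoneda: naturality determines the whole representation by the image of the identity of g. -/
theorem el_eq {c : C} (f : g ⟶ c) : D.el c f = D.univ ≫ G.map f := by
  rw [univ, ← D.el_comp, Category.id_comp]

variable [G.LaxMonoidal]

/-- The comultiplication on the representing object of a monoidal functor. -/
def comul : g ⟶ g ⊗ g := (D.el _).symm (tm D.univ D.univ ≫ μ G g g)

/-- The counit on the representing object of a monoidal functor. -/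
def counit : g ⟶ 𝟙_ C := (D.el _).symm (ε G)

theorem univ_comul : D.univ ≫ G.map D.comul = tm D.univ D.univ ≫ μ G g g := by
  rw [← el_eq]; exact Equiv.apply_symm_apply _ _

theorem univ_counit : D.univ ≫ G.map D.counit = ε G := by
  rw [← el_eq]; exact Equiv.apply_symm_apply _ _

/-- Naturality of μ moves f ⊗ h inside, so the defining property of the comultiplication at u gives
its property for all pairs of morphisms. This turns each comonoid law into a law of G. -/
theorem univ_comul_tensorHom {a b : C} (f : g ⟶ a) (h : g ⟶ b) :
    D.univ ≫ G.map (D.comul ≫ (f ⊗ₘ h)) =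
      tm (D.univ ≫ G.map f) (D.univ ≫ G.map h) ≫ μ G a b := by
  rw [G.map_comp, ← Category.assoc, univ_comul, Category.assoc, ← μ_natural, ← Category.assoc,
    tm_tensorHom]

/-- The comonoid structure on the representing object of a monoidal functor. -/
@[reducible]
def comon : ComonObj g where
  comul := D.comul
  counit := D.counit
  counit_comul := by
    -- With the unitor moved to the left, both sides are morphisms out of g and can be compared at
    -- the universal element, where the law is left unitality of G.
    have h : D.comul ≫ D.counit ▷ g ≫ (λ_ g).hom = 𝟙 g := by
      apply (D.el _).injective
      rw [el_eq, el_eq, ← tensorHom_id, ← Category.assoc, G.map_comp, ← Category.assoc,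
        univ_comul_tensorHom, univ_counit, G.map_id, Category.comp_id, Category.assoc]
      have := tm (𝟙 _) D.univ ≫= left_unitality G g
      rw [tm_leftUnitor_hom, ← Category.assoc, tm_whiskerRight, Category.id_comp] at this
      exact this.symm
    rw [← Category.assoc] at h
    exact (Iso.comp_hom_eq_id _).1 h
  comul_counit := by
    have h : D.comul ≫ g ◁ D.counit ≫ (ρ_ g).hom = 𝟙 g := by
      apply (D.el _).injective
      rw [el_eq, el_eq, ← id_tensorHom, ← Category.assoc, G.map_comp, ← Category.assoc,
        univ_comul_tensorHom, univ_counit, G.map_id, Category.comp_id, Category.assoc]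
      have := tm D.univ (𝟙 _) ≫= right_unitality G g
      rw [tm_rightUnitor_hom, ← Category.assoc, tm_whiskerLeft, Category.id_comp] at this
      exact this.symm
    rw [← Category.assoc] at h
    exact (Iso.comp_hom_eq_id _).1 h
  comul_assoc := by
    apply (D.el _).injective
    rw [el_eq, el_eq, ← tensorHom_id, ← id_tensorHom, ← Category.assoc D.comul,
      G.map_comp _ (α_ _ _ _).hom, univ_comul_tensorHom, ← Category.assoc D.univ,
      univ_comul_tensorHom, univ_comul, G.map_id,
      Category.comp_id]
    -- Coassociativity is the associativity of μ evaluated at u ⊗ u ⊗ u.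
    have := tm (tm D.univ D.univ) D.univ ≫= associativity G g g g
    simp only [← Category.assoc, tm_whiskerRight, tm_associator_hom, tm_whiskerLeft] at this
    exact this.symm

end ElRep

/-- A representation of a monoidal functor `G` by a comonoid `g`, together with monoids `R` and `A`
in `V` whose monoids of elements are the convolution monoid `C(g, e)` and the endomorphism monoid
`C(g, g)`, and the action of `A` on `G` by composition. -/
structure EndoRep (G : C ⥤ V) [G.LaxMonoidal] (g : C) [ComonObj g] (R A : Mon V)
    extends ElRep G g where
  univ_comul : toElRep.univ ≫ G.map ComonObj.comul = tm toElRep.univ toElRep.univ ≫ μ G g g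
  univ_counit : toElRep.univ ≫ G.map ComonObj.counit = ε G
  iR : R.X ≅ G.obj (𝟙_ C)
  iR_one : MonObj.one ≫ iR.hom = ε G
  iR_mul : MonObj.mul ≫ iR.hom = (iR.hom ⊗ₘ iR.hom) ≫ lactG G (𝟙_ C)
  iA : A.X ≅ G.obj g
  iA_one : MonObj.one ≫ iA.hom = toElRep.univ
  act : ∀ c : C, G.obj c ⊗ A.X ⟶ G.obj c
  univ_act : ∀ {c : C} (f : g ⟶ c) (a : 𝟙_ V ⟶ A.X),
    tm (toElRep.univ ≫ G.map f) a ≫ act c = a ≫ iA.hom ≫ G.map f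
  iA_mul : MonObj.mul ≫ iA.hom = iA.hom ▷ A.X ≫ act g

end ElementsRepresentation

namespace EndoRep
-- The action of A on G, and the source and target morphisms.
section Actions

variable {V : Type u} [Category.{v} V] [MonoidalCategory V] [SymmetricCategory V]
  [MonoidalClosed V] [HasCoequalizers V] [UnitSeparates V]
  {C : Type w} [Category.{v} C] [MonoidalCategory C] {G : C ⥤ V} [G.LaxMonoidal]
  {g : C} [ComonObj g] {R A : Mon V} (D : EndoRep G g R A)

theorem exists_el {c : C} (x : 𝟙_ V ⟶ G.obj c) : ∃ f : g ⟶ c, D.univ ≫ G.map f = x :=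
  ⟨(D.el c).symm x, by rw [← ElRep.el_eq, Equiv.apply_symm_apply]⟩

theorem exists_el_A (a : 𝟙_ V ⟶ A.X) : ∃ f : g ⟶ g, a ≫ D.iA.hom = D.univ ≫ G.map f := by
  obtain ⟨f, hf⟩ := D.exists_el (a ≫ D.iA.hom)
  exact ⟨f, hf.symm⟩

theorem exists_el_R (r : 𝟙_ V ⟶ R.X) : ∃ f : g ⟶ 𝟙_ C, r ≫ D.iR.hom = D.univ ≫ G.map f := by
  obtain ⟨f, hf⟩ := D.exists_el (r ≫ D.iR.hom)
  exact ⟨f, hf.symm⟩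

theorem hom_ext_el {c : C} {W : V} {p q : G.obj c ⟶ W}
    (h : ∀ f : g ⟶ c, D.univ ≫ G.map f ≫ p = D.univ ≫ G.map f ≫ q) : p = q := by
  refine el_ext fun x => ?_
  obtain ⟨f, rfl⟩ := D.exists_el x
  simpa only [Category.assoc] using h f

theorem tm_univ_μ {a b : C} (f : g ⟶ a) (h : g ⟶ b) :
    tm (D.univ ≫ G.map f) (D.univ ≫ G.map h) ≫ μ G a b =
      D.univ ≫ G.map (ComonObj.comul ≫ (f ⊗ₘ h)) := by
  rw [G.map_comp, ← Category.assoc, D.univ_comul, Category.assoc, ← μ_natural, ← Category.assoc,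
    tm_tensorHom]

/-- A acts by precomposition and G h by postcomposition, so the two commute. This is the A-linearity
of G h. -/
theorem act_map {c d : C} (h : c ⟶ d) : D.act c ≫ G.map h = G.map h ▷ A.X ≫ D.act d := by
  refine tm_ext fun x a => ?_
  obtain ⟨f, rfl⟩ := D.exists_el x
  rw [← Category.assoc, ← Category.assoc, tm_whiskerRight, D.univ_act, Category.assoc D.univ,
    ← G.map_comp, D.univ_act, G.map_comp, Category.assoc, Category.assoc]

/-- The right `A`-module with underlying object `G c`. -/
abbrev mod (c : C) : RightMod A where
  X := G.obj c
  act := D.act c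
  act_one := by
    rw [← cancel_epi (ρ_ _).inv]
    refine D.hom_ext_el fun f => ?_
    rw [Iso.inv_hom_id, Category.comp_id]
    simp only [← Category.assoc]
    rw [el_rightUnitor_inv, tm_whiskerLeft, Category.id_comp, D.univ_act, ← Category.assoc,
      D.iA_one]
  act_assoc := by
    rw [← cancel_epi (α_ _ _ _).hom, Iso.hom_inv_id_assoc]
    refine tm_ext₃ fun x a b => ?_
    obtain ⟨f, rfl⟩ := D.exists_el x
    simp only [← Category.assoc, tm_associator_hom, tm_whiskerLeft, tm_whiskerRight, D.univ_act]
    -- Writing a as G(α)(u) allows `univ_act` to be used a second time, with f replaced by α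
    -- followed by f.
    obtain ⟨α, hα⟩ := D.exists_el_A a
    have h1 : (tm a b ≫ MonObj.mul) ≫ D.iA.hom = b ≫ D.iA.hom ≫ G.map α := by
      rw [Category.assoc, D.iA_mul, ← Category.assoc, tm_whiskerRight, hα, D.univ_act]
    rw [h1, hα, Category.assoc D.univ, ← G.map_comp, D.univ_act]
    simp only [Category.assoc, G.map_comp]

/-- The `A`-linear morphism `G h`. -/
abbrev modMap {c d : C} (h : c ⟶ d) : D.mod c ⟶ D.mod d :=
  RightMod.Hom.mk (M := D.mod c) (N := D.mod d) (G.map h) (D.act_map h)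

/-- `A` is isomorphic to `G g` as a right `A`-module. -/
def regIso : RightMod.regular A ≅ D.mod g where
  hom := RightMod.Hom.mk (M := RightMod.regular A) (N := D.mod g) D.iA.hom D.iA_mul
  inv := RightMod.Hom.mk (M := D.mod g) (N := RightMod.regular A) D.iA.inv (by
    have h := D.iA.inv ▷ A.X ≫= D.iA_mul =≫ D.iA.inv
    simp only [Category.assoc, Iso.hom_inv_id, Category.comp_id] at h
    rw [← comp_whiskerRight_assoc, Iso.inv_hom_id, id_whiskerRight, Category.id_comp] at h
    exact h.symm)
  hom_inv_id := RightMod.hom_ext D.iA.hom_inv_id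
  inv_hom_id := RightMod.hom_ext D.iA.inv_hom_id

/-- `s ρ = r_g (g ⊗ ρ) γ`. -/
def s : R.X ⟶ A.X := D.iR.hom ≫ insL D.univ _ ≫ ractG G g ≫ D.iA.inv

/-- `t ρ = l_g (ρ ⊗ g) γ`. -/
def t : R.X ⟶ A.X := D.iR.hom ≫ insR _ D.univ ≫ lactG G g ≫ D.iA.inv

/-- By naturality of the right unitor, f can be applied after ρ has consumed its leg. Thus x · ρ is
x acted on by the endomorphism s(ρ). -/
theorem tm_ractG {c : C} (f : g ⟶ c) (ρ : g ⟶ 𝟙_ C) :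
    tm (D.univ ≫ G.map f) (D.univ ≫ G.map ρ) ≫ ractG G c =
      D.univ ≫ G.map (ComonObj.comul ≫ g ◁ ρ ≫ (ρ_ g).hom ≫ f) := by
  rw [ractG, ← Category.assoc, tm_univ_μ, Category.assoc, ← G.map_comp, ← rightUnitor_naturality,
    Category.assoc, tensorHom_def', Category.assoc]

theorem tm_lactG {c : C} (ρ : g ⟶ 𝟙_ C) (f : g ⟶ c) :
    tm (D.univ ≫ G.map ρ) (D.univ ≫ G.map f) ≫ lactG G c =
      D.univ ≫ G.map (ComonObj.comul ≫ ρ ▷ g ≫ (λ_ g).hom ≫ f) := by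
  rw [lactG, ← Category.assoc, tm_univ_μ, Category.assoc, ← G.map_comp, ← leftUnitor_naturality,
    Category.assoc, MonoidalCategory.tensorHom_def, Category.assoc]

/-- `s` is defined in V as ρ ↦ u · ρ, which makes it a morphism of V without further work. The case
f = 𝟙 of `tm_ractG` recovers the formula in C. -/
theorem el_s {r : 𝟙_ V ⟶ R.X} {ρ : g ⟶ 𝟙_ C} (h : r ≫ D.iR.hom = D.univ ≫ G.map ρ) :
    (r ≫ D.s) ≫ D.iA.hom = D.univ ≫ G.map (ComonObj.comul ≫ g ◁ ρ ≫ (ρ_ g).hom) := by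
  have h1 := D.tm_ractG (𝟙 g) ρ
  rw [G.map_id, Category.comp_id, Category.comp_id] at h1
  simp only [s, ← Category.assoc, h, el_insL]
  rw [Category.assoc _ D.iA.inv, Iso.inv_hom_id, Category.comp_id, h1]
  simp only [Category.assoc]

theorem el_t {r : 𝟙_ V ⟶ R.X} {ρ : g ⟶ 𝟙_ C} (h : r ≫ D.iR.hom = D.univ ≫ G.map ρ) :
    (r ≫ D.t) ≫ D.iA.hom = D.univ ≫ G.map (ComonObj.comul ≫ ρ ▷ g ≫ (λ_ g).hom) := by
  have h1 := D.tm_lactG ρ (𝟙 g)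
  rw [G.map_id, Category.comp_id, Category.comp_id] at h1
  simp only [t, ← Category.assoc, h, el_insR]
  rw [Category.assoc _ D.iA.inv, Iso.inv_hom_id, Category.comp_id, h1]
  simp only [Category.assoc]

/-- This and `act_t` ensure that restricting the A-action along s and t yields the canonical
bimodule structure of G c, so that essential strength can be applied to A-modules. -/
theorem act_s (c : C) : G.obj c ◁ D.s ≫ D.act c = G.obj c ◁ D.iR.hom ≫ ractG G c := by
  refine tm_ext fun x r => ?_
  obtain ⟨f, rfl⟩ := D.exists_el x
  obtain ⟨ρ, h⟩ := D.exists_el_R r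
  rw [← Category.assoc, ← Category.assoc, tm_whiskerLeft, tm_whiskerLeft, h, D.univ_act, tm_ractG,
    ← Category.assoc, D.el_s h, Category.assoc, ← G.map_comp]
  simp only [Category.assoc]

theorem act_t (c : C) : G.obj c ◁ D.t ≫ D.act c =
    (β_ _ _).hom ≫ D.iR.hom ▷ G.obj c ≫ lactG G c := by
  refine tm_ext fun x r => ?_
  obtain ⟨f, rfl⟩ := D.exists_el x
  obtain ⟨ρ, h⟩ := D.exists_el_R r
  rw [← Category.assoc, ← Category.assoc, tm_whiskerLeft, tm_braiding, ← Category.assoc,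
    tm_whiskerRight, h, D.univ_act, tm_lactG,
    ← Category.assoc, D.el_t h, Category.assoc, ← G.map_comp]
  simp only [Category.assoc]

end Actions
end EndoRep
end BGD

namespace BGD
open Functor.LaxMonoidal

/-! ### Convolution identities for a comonoid in C. -/

section Convolution
variable {C : Type w} [Category.{v} C] [MonoidalCategory C] (g : C) [ComonObj g]

/-- The endomorphism `r_g (g ⊗ ρ) γ`. -/
def convS {g : C} [ComonObj g] (ρ : g ⟶ 𝟙_ C) : g ⟶ g := ComonObj.comul ≫ g ◁ ρ ≫ (ρ_ g).hom

/-- The endomorphism `l_g (ρ ⊗ g) γ`. -/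
def convT {g : C} [ComonObj g] (ρ : g ⟶ 𝟙_ C) : g ⟶ g := ComonObj.comul ≫ ρ ▷ g ≫ (λ_ g).hom

variable {g}

theorem convS_counit : convS (ComonObj.counit (X := g)) = 𝟙 g := by simp [convS]

theorem convT_counit : convT (ComonObj.counit (X := g)) = 𝟙 g := by simp [convT]

/-- By coassociativity both sides apply ρ to the last leg of the threefold comultiplication. -/
theorem convS_comul (ρ : g ⟶ 𝟙_ C) :
    convS ρ ≫ ComonObj.comul = ComonObj.comul ≫ g ◁ convS ρ := by
  simp only [convS, Category.assoc, MonoidalCategory.whiskerLeft_comp, ComonObj.comul_assoc_assoc]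
  rw [← rightUnitor_naturality, whisker_exchange_assoc]
  simp

/-- The mirror image: both sides apply ρ to the first leg. -/
theorem convT_comul (ρ : g ⟶ 𝟙_ C) :
    convT ρ ≫ ComonObj.comul = ComonObj.comul ≫ convT ρ ▷ g := by
  simp only [convT, Category.assoc, comp_whiskerRight]
  rw [← leftUnitor_naturality, ← whisker_exchange_assoc, ComonObj.comul_assoc_assoc]
  simp

/-- Both sides apply ρ to the middle leg of the threefold comultiplication. This is the source of
the Takeuchi condition. -/
theorem comul_convS (ρ : g ⟶ 𝟙_ C) :
    ComonObj.comul ≫ convS ρ ▷ g = ComonObj.comul ≫ g ◁ convT ρ := by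
  simp only [convS, convT, comp_whiskerRight, MonoidalCategory.whiskerLeft_comp,
    ComonObj.comul_assoc_assoc]
  simp

/-- Both sides are the convolution product ρ * σ, because the two unitors agree on the unit object.
-/
theorem convS_comp (ρ σ : g ⟶ 𝟙_ C) : convS σ ≫ ρ = convT ρ ≫ σ := by
  simp only [convS, convT, Category.assoc]
  rw [← rightUnitor_naturality, ← leftUnitor_naturality, whisker_exchange_assoc, unitors_equal]

/-- The argument on the left is ρ * σ and the right side is s(ρ) ∘ s(σ), so s is multiplicative. The
product is rewritten as `convS σ ≫ ρ` in order to use `convS_comul`. -/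
theorem convS_mul (ρ σ : g ⟶ 𝟙_ C) : convS (convT ρ ≫ σ) = convS σ ≫ convS ρ := by
  have h : ∀ τ : g ⟶ 𝟙_ C, convS τ = ComonObj.comul ≫ g ◁ τ ≫ (ρ_ g).hom := fun _ => rfl
  rw [← convS_comp, h (convS σ ≫ ρ), h ρ, ← Category.assoc (convS σ), convS_comul]
  simp

/-- Read with ∘, the right side is t(σ) ∘ t(ρ), so t reverses products. -/
theorem convT_mul (ρ σ : g ⟶ 𝟙_ C) : convT (convT ρ ≫ σ) = convT ρ ≫ convT σ := by
  have h : ∀ τ : g ⟶ 𝟙_ C, convT τ = ComonObj.comul ≫ τ ▷ g ≫ (λ_ g).hom := fun _ => rfl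
  rw [h (convT ρ ≫ σ), h σ, ← Category.assoc (convT ρ), convT_comul]
  simp

/-- One operator consumes the first leg and the other the last, so their order is immaterial. -/
theorem convT_convS (ρ σ : g ⟶ 𝟙_ C) : convT σ ≫ convS ρ = convS ρ ≫ convT σ := by
  rw [convS, ← Category.assoc (convT σ), convT_comul, Category.assoc, Category.assoc,
    Category.assoc, ← rightUnitor_naturality, whisker_exchange_assoc]

theorem convS_comp_counit (ρ : g ⟶ 𝟙_ C) : convS ρ ≫ ComonObj.counit = ρ := by
  rw [convS_comp, convT_counit, Category.id_comp]

theorem convT_comp_counit (ρ : g ⟶ 𝟙_ C) : convT ρ ≫ ComonObj.counit = ρ := by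
  rw [← convS_comp, convS_counit, Category.id_comp]

end Convolution

namespace EndoRep
-- The source and target structure, and the strong monoidal functor to bimodules.
section Ring

variable {V : Type u} [Category.{v} V] [MonoidalCategory V] [SymmetricCategory V]
  [MonoidalClosed V] [HasCoequalizers V] [UnitSeparates V]
  {C : Type w} [Category.{v} C] [MonoidalCategory C] {G : C ⥤ V} [G.LaxMonoidal]
  {g : C} [ComonObj g] {R A : Mon V} (D : EndoRep G g R A)

/-- The product a b is the composite α ∘ β, whence the reversal in diagrammatic order. -/
theorem el_mul_A {a b : 𝟙_ V ⟶ A.X} {α β : g ⟶ g} (ha : a ≫ D.iA.hom = D.univ ≫ G.map α)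
    (hb : b ≫ D.iA.hom = D.univ ≫ G.map β) :
    (tm a b ≫ MonObj.mul) ≫ D.iA.hom = D.univ ≫ G.map (β ≫ α) := by
  rw [Category.assoc, D.iA_mul, ← Category.assoc, tm_whiskerRight, ha, D.univ_act,
    ← Category.assoc, hb, G.map_comp, Category.assoc]

/-- The convolution product appears as `convT ρ ≫ σ`, the form in which `convS_mul` and `convT_mul`
accept it. -/
theorem el_mul_R {r q : 𝟙_ V ⟶ R.X} {ρ σ : g ⟶ 𝟙_ C} (hr : r ≫ D.iR.hom = D.univ ≫ G.map ρ)
    (hq : q ≫ D.iR.hom = D.univ ≫ G.map σ) :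
    (tm r q ≫ MonObj.mul) ≫ D.iR.hom = D.univ ≫ G.map (convT ρ ≫ σ) := by
  rw [Category.assoc, D.iR_mul, ← Category.assoc, tm_tensorHom, hr, hq, tm_lactG]
  simp only [convT, Category.assoc]

theorem el_one_A : (MonObj.one : 𝟙_ V ⟶ A.X) ≫ D.iA.hom = D.univ ≫ G.map (𝟙 g) := by
  rw [D.iA_one, G.map_id, Category.comp_id]

theorem el_one_R : (MonObj.one : 𝟙_ V ⟶ R.X) ≫ D.iR.hom = D.univ ≫ G.map ComonObj.counit := by
  rw [D.iR_one, D.univ_counit]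

/-- The source and target morphisms. -/
abbrev reRing : ReRing R A where
  s := D.s
  t := D.t
  s_one := by
    -- After the isomorphism `iA`, this axiom and those below become identities between
    -- endomorphisms of g, applied to the universal element.
    rw [← cancel_mono D.iA.hom, D.el_s D.el_one_R, D.el_one_A]
    exact congrArg (fun z => D.univ ≫ G.map z) convS_counit
  t_one := by
    rw [← cancel_mono D.iA.hom, D.el_t D.el_one_R, D.el_one_A]
    exact congrArg (fun z => D.univ ≫ G.map z) convT_counit
  s_mul := by
    refine tm_ext fun r q => ?_
    obtain ⟨ρ, hr⟩ := D.exists_el_R r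
    obtain ⟨σ, hq⟩ := D.exists_el_R q
    rw [← cancel_mono D.iA.hom, ← Category.assoc, ← Category.assoc, tm_tensorHom,
      D.el_s (D.el_mul_R hr hq), D.el_mul_A (D.el_s hr) (D.el_s hq)]
    exact congrArg (fun z => D.univ ≫ G.map z) (convS_mul ρ σ)
  t_mul := by
    refine tm_ext fun r q => ?_
    obtain ⟨ρ, hr⟩ := D.exists_el_R r
    obtain ⟨σ, hq⟩ := D.exists_el_R q
    rw [← cancel_mono D.iA.hom, ← Category.assoc, ← Category.assoc, ← Category.assoc, tm_braiding,
      tm_tensorHom, D.el_t (D.el_mul_R hr hq), D.el_mul_A (D.el_t hq) (D.el_t hr)]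
    exact congrArg (fun z => D.univ ≫ G.map z) (convT_mul ρ σ)
  s_t_comm := by
    refine tm_ext fun r q => ?_
    obtain ⟨ρ, hr⟩ := D.exists_el_R r
    obtain ⟨σ, hq⟩ := D.exists_el_R q
    rw [← cancel_mono D.iA.hom, ← Category.assoc, ← Category.assoc, ← Category.assoc, tm_braiding,
      tm_tensorHom, tm_tensorHom, D.el_mul_A (D.el_s hr) (D.el_t hq),
      D.el_mul_A (D.el_t hq) (D.el_s hr)]
    exact congrArg (fun z => D.univ ≫ G.map z) (convT_convS ρ σ)

/-- The `R`-`R`-bimodule with underlying object `G c`. -/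
abbrev bi (c : C) : Bimod R R := D.reRing.bimod (D.mod c)

theorem bi_actRight (c : C) : (D.bi c).actRight = G.obj c ◁ D.iR.hom ≫ ractG G c := D.act_s c

/-- The braiding in the definition of the left action of a module and the one in `act_t` cancel by
symmetry. -/
theorem bi_actLeft (c : C) : (D.bi c).actLeft = D.iR.hom ▷ G.obj c ≫ lactG G c := by
  refine (congrArg ((β_ _ _).hom ≫ ·) (D.act_t c)).trans ?_
  exact SymmetricCategory.symmetry_assoc _ _ _

/-- The action of `C` on the bimodules `G c`. -/
abbrev biMap {c d : C} (h : c ⟶ d) : D.bi c ⟶ D.bi d := D.reRing.bimodMap (D.modMap h)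

/-- The actions of R and of G e differ by the isomorphism `iR`, so being balanced over one is being
balanced over the other. Tensor products over R and over G e therefore have the same universal
property. -/
theorem balanced_iff (a b : C) {W : V} (f : G.obj a ⊗ G.obj b ⟶ W) :
    ((D.bi a).actRight ▷ (D.bi b).X ≫ f = (α_ _ _ _).hom ≫ ((D.bi a).X ◁ (D.bi b).actLeft) ≫ f) ↔
      (ractG G a ▷ G.obj b ≫ f = (α_ _ _ _).hom ≫ (G.obj a ◁ lactG G b) ≫ f) := by
  rw [bi_actRight, bi_actLeft, comp_whiskerRight, MonoidalCategory.whiskerLeft_comp]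
  have h : (α_ (G.obj a) R.X (G.obj b)).hom ≫ G.obj a ◁ D.iR.hom ▷ G.obj b =
    (G.obj a ◁ D.iR.hom) ▷ G.obj b ≫ (α_ _ _ _).hom := by simp
  rw [Category.assoc, Category.assoc, reassoc_of% h]
  exact cancel_epi _

/-- The morphism `G a ⊗_R G b ⟶ G (a ⊗ b)`. -/
noncomputable def θV (a b : C) : (D.bi a ⊗ D.bi b : Bimod R R).X ⟶ G.obj (a ⊗ b) :=
  tdesc (P := D.bi a) (Q := D.bi b) (μ G a b) ((D.balanced_iff a b _).2 (μ_balanced G a b))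

theorem tπ_θV (a b : C) : tπ (D.bi a) (D.bi b) ≫ D.θV a b = μ G a b := tπ_tdesc _ _

/-- Essential strength is about the coequalizer over G e, whereas `θV` lives on the one over R. The
two coequalizers are canonically isomorphic, and `θV` is the constraint of U composed with that
isomorphism. -/
theorem isIso_θV (hG : EssentiallyStrong G) (a b : C) : IsIso (D.θV a b) := by
  have h1 : IsIso (canonμ G a b) := hG.2 a b
  have h2 : IsIso (canonμ G a b).hom :=
    ⟨(inv (canonμ G a b)).hom, congrArg Bimod.Hom.hom (IsIso.hom_inv_id (canonμ G a b)),
      congrArg Bimod.Hom.hom (IsIso.inv_hom_id (canonμ G a b))⟩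
  let p := tdesc (P := canonObj G a) (Q := canonObj G b) (tπ (D.bi a) (D.bi b))
    ((D.balanced_iff a b _).1 (tπ_cond (D.bi a) (D.bi b)))
  have hp : tπ (canonObj G a) (canonObj G b) ≫ p = tπ (D.bi a) (D.bi b) := tπ_tdesc _ _
  let q := tdesc (P := D.bi a) (Q := D.bi b) (tπ (canonObj G a) (canonObj G b))
    ((D.balanced_iff a b _).2 (tπ_cond (canonObj G a) (canonObj G b)))
  have hq : tπ (D.bi a) (D.bi b) ≫ q = tπ (canonObj G a) (canonObj G b) := tπ_tdesc _ _
  have hpq : p ≫ q = 𝟙 _ := by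
    refine tπ_hom_ext ?_
    rw [← Category.assoc, hp, hq]; exact (Category.comp_id _).symm
  have hqp : q ≫ p = 𝟙 _ := by
    refine tπ_hom_ext ?_
    rw [← Category.assoc, hq, hp]; exact (Category.comp_id _).symm
  have h3 : IsIso q := ⟨p, hqp, hpq⟩
  have h4 : D.θV a b = q ≫ (canonμ G a b).hom := by
    refine tπ_hom_ext ?_
    rw [tπ_θV, ← Category.assoc, hq]
    exact (tπ_canonμ G a b).symm
  rw [h4]
  exact IsIso.comp_isIso

theorem tb_θV {a b : C} (x : 𝟙_ V ⟶ G.obj a) (y : 𝟙_ V ⟶ G.obj b) :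
    tb (P := D.bi a) (Q := D.bi b) x y ≫ D.θV a b = tm x y ≫ μ G a b := by
  rw [← D.tπ_θV a b, ← Category.assoc]; rfl

/-- On elements this is the G e-linearity `lactG_μ` of μ, transported along `iR`. -/
theorem θV_actLeft (a b : C) : (D.bi a ⊗ D.bi b : Bimod R R).actLeft ≫ D.θV a b =
    R.X ◁ D.θV a b ≫ (D.bi (a ⊗ b)).actLeft := by
  refine tm_tb_ext' fun r x y => ?_
  rw [← Category.assoc, ← Category.assoc, tb_actLeft, tm_whiskerLeft, tb_θV, tb_θV, bi_actLeft,
    bi_actLeft]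
  simp only [← Category.assoc, tm_whiskerRight]
  have h := tm (tm (r ≫ D.iR.hom) x) y ≫= lactG_μ G a b
  simpa only [← Category.assoc, tm_whiskerRight, tm_associator_hom, tm_whiskerLeft] using h

theorem θV_actRight (a b : C) : (D.bi a ⊗ D.bi b : Bimod R R).actRight ≫ D.θV a b =
    D.θV a b ▷ R.X ≫ (D.bi (a ⊗ b)).actRight := by
  refine tm_tb_ext fun x y r => ?_
  rw [← Category.assoc, ← Category.assoc, tb_actRight, tm_whiskerRight, tb_θV, tb_θV, bi_actRight,
    bi_actRight]
  simp only [← Category.assoc, tm_whiskerLeft]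
  have h := tm x (tm y (r ≫ D.iR.hom)) ≫= μ_ractG G a b
  simpa only [← Category.assoc, tm_whiskerRight, tm_associator_inv, tm_whiskerLeft] using h

/-- The isomorphism `G a ⊗_R G b ≅ G (a ⊗ b)` of bimodules. -/
noncomputable def θ (hG : EssentiallyStrong G) (a b : C) : D.bi a ⊗ D.bi b ≅ D.bi (a ⊗ b) :=
  haveI := D.isIso_θV hG a b
  Bimod.isoOfIso (P := (D.bi a ⊗ D.bi b : Bimod R R)) (asIso (D.θV a b)) (D.θV_actLeft a b)
    (D.θV_actRight a b)

theorem tb_θ (hG : EssentiallyStrong G) {a b : C} (x : 𝟙_ V ⟶ G.obj a) (y : 𝟙_ V ⟶ G.obj b) :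
    tb (P := D.bi a) (Q := D.bi b) x y ≫ (D.θ hG a b).hom.hom = tm x y ≫ μ G a b :=
  D.tb_θV x y

/-- The isomorphism `R ≅ G e` of bimodules. -/
noncomputable def θ₀ : 𝟙_ (Bimod R R) ≅ D.bi (𝟙_ C) :=
  Bimod.isoOfIso (P := Bimod.regular R) D.iR
    (by
      rw [bi_actLeft]
      refine D.iR_mul.trans ?_
      rw [tensorHom_def', Category.assoc]; rfl)
    (by
      -- `iR_mul` is phrased with the left action of G e on itself; since the unitors of e coincide,
      -- it serves for the right action too.
      rw [bi_actRight, ractG, ← unitors_equal]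
      refine D.iR_mul.trans ?_
      rw [MonoidalCategory.tensorHom_def, Category.assoc]; rfl)

/-- The functor from `C` to `R`-`R`-bimodules. -/
abbrev biFunctor : C ⥤ Bimod R R where
  obj c := D.bi c
  map h := D.biMap h
  map_id c := by ext; exact G.map_id c
  map_comp f h := by ext; exact G.map_comp f h

/-- The strong monoidal structure of the functor from `C` to `R`-`R`-bimodules. -/
noncomputable def coreMonoidal (hG : EssentiallyStrong G) : D.biFunctor.CoreMonoidal where
  εIso := D.θ₀
  μIso a b := D.θ hG a b
  μIso_hom_natural_left {a b} f c := by
    ext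
    refine tb_ext fun x y => ?_
    rw [Bimod.comp_hom', Bimod.comp_hom', ← Category.assoc, ← Category.assoc, tb_whiskerRight]
    refine (D.tb_θ hG _ _).trans (Eq.trans ?_ (congrArg (· ≫ _) (D.tb_θ hG x y)).symm)
    have h := tm x y ≫= μ_natural_left G f c
    rw [← Category.assoc, tm_whiskerRight] at h
    exact h.trans (Category.assoc _ _ _).symm
  μIso_hom_natural_right {a b} c f := by
    ext
    refine tb_ext fun x y => ?_
    rw [Bimod.comp_hom', Bimod.comp_hom', ← Category.assoc, ← Category.assoc, tb_whiskerLeft]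
    refine (D.tb_θ hG _ _).trans (Eq.trans ?_ (congrArg (· ≫ _) (D.tb_θ hG x y)).symm)
    have h := tm x y ≫= μ_natural_right G c f
    rw [← Category.assoc, tm_whiskerLeft] at h
    exact h.trans (Category.assoc _ _ _).symm
  associativity a b c := by
    ext
    -- The source is an iterated coequalizer, so testing on x ⊗ y ⊗ z suffices; there the claim is
    -- associativity of μ.
    refine tπ_hom_ext (whiskerRight_tπ_ext (tm_ext₃ fun x y z => ?_))
    simp only [← Category.assoc, Bimod.comp_hom', tm_whiskerRight, tm_tπ]
    rw [tb_whiskerRight, tb_associator, tb_whiskerLeft]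
    refine (congrArg (· ≫ _) (D.tb_θ hG _ _)).trans (Eq.trans ?_ (D.tb_θ hG _ _).symm)
    refine (congrArg (fun w => (tm w z ≫ _) ≫ _) (D.tb_θ hG x y)).trans
      (Eq.trans ?_ (congrArg (fun w => tm x w ≫ _) (D.tb_θ hG y z)).symm)
    have h := tm (tm x y) z ≫= associativity G a b c
    simp only [← Category.assoc, tm_whiskerRight, tm_associator_hom, tm_whiskerLeft] at h
    exact h
  left_unitality c := by
    ext
    refine tb_ext fun r x => ?_
    rw [Bimod.comp_hom', Bimod.comp_hom', ← Category.assoc, ← Category.assoc, tb_whiskerRight]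
    refine (tb_leftUnitor (P := D.bi c) r x).trans ?_
    rw [bi_actLeft]
    refine Eq.trans ?_ (congrArg (· ≫ _) (D.tb_θ hG _ _)).symm
    rw [← Category.assoc]
    refine (congrArg (· ≫ lactG G c) (tm_whiskerRight (X := R.X) r x D.iR.hom)).trans ?_
    exact (Category.assoc _ _ _).symm
  right_unitality c := by
    ext
    refine tb_ext fun x r => ?_
    rw [Bimod.comp_hom', Bimod.comp_hom', ← Category.assoc, ← Category.assoc, tb_whiskerLeft]
    refine (tb_rightUnitor (P := D.bi c) x r).trans ?_
    rw [bi_actRight]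
    refine Eq.trans ?_ (congrArg (· ≫ _) (D.tb_θ hG _ _)).symm
    rw [← Category.assoc]
    refine (congrArg (· ≫ ractG G c) (tm_whiskerLeft (Y := R.X) x r D.iR.hom)).trans ?_
    exact (Category.assoc _ _ _).symm

end Ring
end EndoRep
end BGD

/-! ### Transport of comonoids and lifting of strong monoidal structures. -/

namespace BGD
open Functor.LaxMonoidal

/-- The comonoid structure transported along an isomorphism. -/
@[reducible]
def comonOfIso {E : Type u} [Category.{v} E] [MonoidalCategory E] {X Y : E} [ComonObj Y]
    (e : X ≅ Y) : ComonObj X where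
  comul := e.hom ≫ ComonObj.comul ≫ (e.inv ⊗ₘ e.inv)
  counit := e.hom ≫ ComonObj.counit
  counit_comul := by
    rw [← tensorHom_id]
    simp only [Category.assoc, tensorHom_comp_tensorHom, Iso.inv_hom_id_assoc, Category.comp_id,
      ComonObj.counit_comul_hom, Iso.hom_inv_id_assoc]
  comul_counit := by
    rw [← id_tensorHom]
    simp only [Category.assoc, tensorHom_comp_tensorHom, Iso.inv_hom_id_assoc, Category.comp_id,
      ComonObj.comul_counit_hom, Iso.hom_inv_id_assoc]
  comul_assoc := by
    have h1 : (e.inv ⊗ₘ e.inv) ≫ X ◁ (e.hom ≫ ComonObj.comul ≫ (e.inv ⊗ₘ e.inv)) =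
        Y ◁ ComonObj.comul ≫ (e.inv ⊗ₘ (e.inv ⊗ₘ e.inv)) := by
      rw [← id_tensorHom, ← id_tensorHom, tensorHom_comp_tensorHom, tensorHom_comp_tensorHom,
        Iso.inv_hom_id_assoc, Category.comp_id, Category.id_comp]
    have h2 : (e.inv ⊗ₘ e.inv) ≫ (e.hom ≫ ComonObj.comul ≫ (e.inv ⊗ₘ e.inv)) ▷ X =
        ComonObj.comul ▷ Y ≫ ((e.inv ⊗ₘ e.inv) ⊗ₘ e.inv) := by
      rw [← tensorHom_id, ← tensorHom_id, tensorHom_comp_tensorHom, tensorHom_comp_tensorHom,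
        Iso.inv_hom_id_assoc, Category.comp_id, Category.id_comp]
    simp only [Category.assoc]
    rw [h1, reassoc_of% h2, associator_naturality, ComonObj.comul_assoc_assoc]

/-- A functor becomes strong monoidal if its composite with a faithful strong monoidal functor
is so, by structure morphisms that lift. -/
@[reducible]
def coreMonoidalOfFaithful {C D E : Type*} [Category* C] [Category* D] [Category* E]
    [MonoidalCategory C] [MonoidalCategory D] [MonoidalCategory E] (K : C ⥤ D) (F : D ⥤ E)
    [F.Faithful] [F.Monoidal] (h : (K ⋙ F).CoreMonoidal) (εK : 𝟙_ D ≅ K.obj (𝟙_ C))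
    (μK : ∀ a b : C, K.obj a ⊗ K.obj b ≅ K.obj (a ⊗ b))
    (hε : ε F ≫ F.map εK.hom = h.εIso.hom)
    (hμ : ∀ a b, μ F (K.obj a) (K.obj b) ≫ F.map (μK a b).hom = (h.μIso a b).hom) :
    K.CoreMonoidal where
  εIso := εK
  μIso := μK
  μIso_hom_natural_left {a b} f c := by
    apply F.map_injective
    have h1 := h.μIso_hom_natural_left f c
    simp only [← hμ, Functor.comp_map, Functor.comp_obj] at h1
    rw [μ_natural_left_assoc] at h1
    -- The constraint of F is invertible, so precomposing with it loses nothing and turns the claim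
    -- into naturality for the composite.
    rw [F.map_comp, F.map_comp, ← cancel_epi (μ F (K.obj a) (K.obj c)), h1, Category.assoc]
  μIso_hom_natural_right {a b} c f := by
    apply F.map_injective
    have h1 := h.μIso_hom_natural_right c f
    simp only [← hμ, Functor.comp_map, Functor.comp_obj] at h1
    rw [μ_natural_right_assoc] at h1
    rw [F.map_comp, F.map_comp, ← cancel_epi (μ F (K.obj c) (K.obj a)), h1, Category.assoc]
  associativity a b c := by
    apply F.map_injective
    have h1 := h.associativity a b c
    simp only [← hμ, Functor.comp_map, Functor.comp_obj, comp_whiskerRight, Category.assoc,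
      MonoidalCategory.whiskerLeft_comp] at h1
    rw [μ_natural_left_assoc, μ_natural_right_assoc, ← associativity_assoc F,
      cancel_epi, cancel_epi] at h1
    simpa only [F.map_comp] using h1
  left_unitality c := by
    apply F.map_injective
    have h1 := h.left_unitality c
    simp only [← hμ, ← hε, Functor.comp_map, Functor.comp_obj, comp_whiskerRight,
      Category.assoc] at h1
    rw [μ_natural_left_assoc, left_unitality F, cancel_epi, cancel_epi] at h1
    simpa only [F.map_comp] using h1
  right_unitality c := by
    apply F.map_injective
    have h1 := h.right_unitality c
    simp only [← hμ, ← hε, Functor.comp_map, Functor.comp_obj, MonoidalCategory.whiskerLeft_comp,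
      Category.assoc] at h1
    rw [μ_natural_right_assoc, right_unitality F, cancel_epi, cancel_epi] at h1
    simpa only [F.map_comp] using h1

namespace EndoRep
-- The endomorphism bialgebroid and the factorization.
section Bialgebroid

variable {V : Type u} [Category.{v} V] [MonoidalCategory V] [SymmetricCategory V]
  [MonoidalClosed V] [HasCoequalizers V] [UnitSeparates V]
  {C : Type w} [Category.{v} C] [MonoidalCategory C] {G : C ⥤ V} [G.LaxMonoidal]
  {g : C} [ComonObj g] {R A : Mon V} (D : EndoRep G g R A)

/-- `A` is isomorphic to `G g` as a bimodule. -/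
def κ : D.reRing.reg ≅ D.bi g where
  hom := D.reRing.bimodMap D.regIso.hom
  inv := D.reRing.bimodMap D.regIso.inv
  hom_inv_id := by rw [← ReRing.bimodMap_comp, Iso.hom_inv_id, ReRing.bimodMap_id]
  inv_hom_id := by rw [← ReRing.bimodMap_comp, Iso.inv_hom_id, ReRing.bimodMap_id]

theorem κ_hom : D.κ.hom.hom = D.iA.hom := rfl

variable (hG : EssentiallyStrong G)

/-- The comonoid structure on the bimodule `A`. -/
@[reducible]
noncomputable def regComon : ComonObj D.reRing.reg :=
  -- A strong monoidal functor preserves comonoids. The comultiplication uses the inverse of θ,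
  -- which essential strength provides.
  letI : ComonObj (D.bi g) :=
    letI := (D.coreMonoidal hG).toMonoidal
    Functor.obj.instComonObj g D.biFunctor
  comonOfIso D.κ

theorem regComon_comul : (D.regComon hG).comul =
    D.κ.hom ≫ (D.biMap ComonObj.comul ≫ (D.θ hG g g).inv) ≫ (D.κ.inv ⊗ₘ D.κ.inv) := rfl

theorem regComon_counit : (D.regComon hG).counit =
    D.κ.hom ≫ D.biMap ComonObj.counit ≫ D.θ₀.inv := rfl

theorem ε_eq : D.reRing.ε (D.regComon hG) =
    D.iA.hom ≫ G.map ComonObj.counit ≫ D.iR.inv := by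
  rw [ReRing.ε, regComon_counit]; rfl

/-- On endomorphisms the counit is α ↦ π ∘ α, which reduces the counit axioms to the convolution
identities. -/
theorem el_ε {a : 𝟙_ V ⟶ A.X} {α : g ⟶ g} (h : a ≫ D.iA.hom = D.univ ≫ G.map α) :
    (a ≫ D.reRing.ε (D.regComon hG)) ≫ D.iR.hom = D.univ ≫ G.map (α ≫ ComonObj.counit) := by
  rw [ε_eq, ← Category.assoc, h]
  simp

/-- The orbit of G(f)(u) sends α to G(f ∘ α)(u), which is G f once A is identified with G g. -/
theorem orb_univ {c : C} (f : g ⟶ c) :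
    D.reRing.orb (M := D.mod c) (D.univ ≫ G.map f) = D.κ.hom ≫ D.biMap f := by
  ext
  refine el_ext fun a => ?_
  exact (D.reRing.el_orb (M := D.mod c) _ a).trans (D.univ_act f a)

theorem biMap_comp {a b c : C} (f : a ⟶ b) (h : b ⟶ c) :
    D.biMap (f ≫ h) = D.biMap f ≫ D.biMap h := D.biFunctor.map_comp f h

theorem biMap_tensorHom_θ {a b a' b' : C} (f : a ⟶ a') (h : b ⟶ b') :
    (D.biMap f ⊗ₘ D.biMap h) ≫ (D.θ hG a' b').hom = (D.θ hG a b).hom ≫ D.biMap (f ⊗ₘ h) := by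
  let := (D.coreMonoidal hG).toMonoidal
  exact μ_natural D.biFunctor f h

/-- With orbits rewritten as G f and G h, naturality of θ moves them past the inverse θ contained in
δ, and the two cancel. The result computes the diagonal action on G a ⊗_R G b inside C. -/
theorem comul_orb {a b : C} (f : g ⟶ a) (h : g ⟶ b) :
    (D.regComon hG).comul ≫ (D.reRing.orb (M := D.mod a) (D.univ ≫ G.map f) ⊗ₘ
        D.reRing.orb (M := D.mod b) (D.univ ≫ G.map h)) ≫ (D.θ hG a b).hom =
      D.κ.hom ≫ D.biMap (ComonObj.comul ≫ (f ⊗ₘ h)) := by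
  rw [orb_univ, orb_univ, regComon_comul, biMap_comp]
  simp only [Category.assoc, tensorHom_comp_tensorHom_assoc, Iso.inv_hom_id_assoc]
  rw [biMap_tensorHom_θ, Iso.inv_hom_id_assoc]

/-- The isomorphism `A ⊗_R A ≅ G (g ⊗ g)`. -/
noncomputable def κκ : D.reRing.reg ⊗ D.reRing.reg ≅ D.bi (g ⊗ g) :=
  (D.κ ⊗ᵢ D.κ) ≪≫ D.θ hG g g

theorem κκ_hom : (D.κκ hG).hom = (D.κ.hom ⊗ₘ D.κ.hom) ≫ (D.θ hG g g).hom := rfl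

theorem κκ_cancel {Z : V} {p q : Z ⟶ (D.reRing.reg ⊗ D.reRing.reg : Bimod R R).X}
    (h : p ≫ (D.κκ hG).hom.hom = q ≫ (D.κκ hG).hom.hom) : p = q := by
  have e : (D.κκ hG).hom.hom ≫ (D.κκ hG).inv.hom = 𝟙 _ :=
    congrArg Bimod.Hom.hom (D.κκ hG).hom_inv_id
  have h1 := h =≫ (D.κκ hG).inv.hom
  rw [Category.assoc, Category.assoc, e] at h1
  exact ((Category.comp_id _).symm.trans h1).trans (Category.comp_id _)

/-- Under A ≅ G g and A ⊗_R A ≅ G(g ⊗ g), the comultiplication is simply G γ. -/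
theorem comul_κκ : (D.regComon hG).comul ≫ (D.κκ hG).hom = D.κ.hom ≫ D.biMap ComonObj.comul := by
  rw [regComon_comul, κκ_hom]
  simp

theorem leftMul_κ {a : 𝟙_ V ⟶ A.X} {α : g ⟶ g} (h : a ≫ D.iA.hom = D.univ ≫ G.map α) :
    D.reRing.leftMul a ≫ D.κ.hom = D.κ.hom ≫ D.biMap α := by
  rw [← D.orb_univ α, ← h]
  exact D.reRing.orb_map D.regIso.hom a

/-- Left multiplications by s(ρ) and t(ρ) become G of the corresponding endomorphisms, and the claim
becomes `comul_convS`. -/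
theorem regComon_takeuchi : D.reRing.InTakeuchi (D.regComon hG).comul.hom := by
  intro r
  obtain ⟨ρ, hr⟩ := D.exists_el_R r
  have key : (D.regComon hG).comul ≫ D.reRing.leftMul (r ≫ D.s) ▷ D.reRing.reg =
      (D.regComon hG).comul ≫ D.reRing.reg ◁ D.reRing.leftMul (r ≫ D.t) := by
    rw [← cancel_mono (D.κκ hG).hom, κκ_hom, ← tensorHom_id, ← id_tensorHom, Category.assoc,
      Category.assoc, tensorHom_comp_tensorHom_assoc, tensorHom_comp_tensorHom_assoc,
      D.leftMul_κ (D.el_s hr), D.leftMul_κ (D.el_t hr), Category.id_comp]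
    -- The untouched factor is written as the orbit map of u, so that both sides are instances of
    -- `comul_orb`.
    have h1 : D.κ.hom = D.κ.hom ≫ D.biMap (𝟙 g) := by
      rw [show D.biMap (𝟙 g) = 𝟙 _ from D.biFunctor.map_id g, Category.comp_id]
    have h2 := D.comul_orb hG (convS ρ) (𝟙 g)
    have h3 := D.comul_orb hG (𝟙 g) (convT ρ)
    rw [orb_univ, orb_univ, ← h1] at h2 h3
    refine h2.trans (Eq.trans ?_ h3.symm)
    rw [tensorHom_id, id_tensorHom, comul_convS]
  exact congrArg Bimod.Hom.hom key

/-- For x = G(f)(u) and y = G(h)(u), θ(x ⊗ y) is G((f ⊗ h) γ)(u), on which A acts by precomposition;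
`comul_orb` gives the same value for the diagonal action. This A-linearity of θ serves both for
multiplicativity of δ and for the lift to A-modules. -/
theorem takAct_θ (a b : C) :
    D.reRing.takAct (D.mod a) (D.mod b) (D.regComon hG).comul.hom (D.regComon_takeuchi hG) ≫
        (D.θ hG a b).hom.hom =
      (D.θ hG a b).hom.hom ▷ A.X ≫ D.act (a ⊗ b) := by
  refine tm_tb_ext fun x y z => ?_
  obtain ⟨f, rfl⟩ := D.exists_el x
  obtain ⟨h, rfl⟩ := D.exists_el y
  rw [← Category.assoc, ← Category.assoc, tm_whiskerRight]
  refine Eq.trans ?_ (congrArg (fun w => tm w z ≫ _)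
    ((D.tb_θ hG _ _).trans (D.tm_univ_μ f h))).symm
  rw [D.univ_act]
  refine (congrArg (· ≫ (D.θ hG a b).hom.hom) (D.reRing.el_takAct (D.mod a) (D.mod b)
    (D.regComon hG).comul.hom (D.regComon_takeuchi hG) _ _ z)).trans ?_
  have e := z ≫= congrArg Bimod.Hom.hom (D.comul_orb hG f h)
  simp only [Bimod.comp_hom'] at e
  exact (Category.assoc _ _ _).trans ((Category.assoc _ _ _).trans e)

/-- Through `κκ` the product on A ×_R A becomes the action of A on G(g ⊗ g), and multiplicativity
becomes the A-linearity of G γ. -/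
theorem regComon_comul_mul : MonObj.mul ≫ (D.regComon hG).comul.hom =
    (D.regComon hG).comul.hom ▷ A.X ≫
      D.reRing.takAct (RightMod.regular A) (RightMod.regular A) (D.regComon hG).comul.hom
        (D.regComon_takeuchi hG) := by
  refine D.κκ_cancel hG ?_
  have h1 : (D.regComon hG).comul.hom ≫ (D.κκ hG).hom.hom = D.iA.hom ≫ G.map ComonObj.comul :=
    congrArg Bimod.Hom.hom (D.comul_κκ hG)
  have h2 := D.reRing.takAct_nat D.regIso.hom D.regIso.hom (D.regComon hG).comul.hom
    (D.regComon_takeuchi hG)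
  have h3 : (D.κκ hG).hom.hom = (D.κ.hom ⊗ₘ D.κ.hom).hom ≫ (D.θ hG g g).hom.hom := rfl
  have h4 : D.reRing.takAct (RightMod.regular A) (RightMod.regular A) (D.regComon hG).comul.hom
        (D.regComon_takeuchi hG) ≫ (D.κκ hG).hom.hom =
      (D.κκ hG).hom.hom ▷ A.X ≫ D.act (g ⊗ g) := by
    rw [h3, comp_whiskerRight, Category.assoc, ← takAct_θ]
    exact (reassoc_of% h2) _
  rw [Category.assoc, h1, Category.assoc, h4, ← comp_whiskerRight_assoc, h1, reassoc_of% D.iA_mul,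
    D.act_map, comp_whiskerRight, Category.assoc]

/-- The unit of A corresponds to u, so this is the defining equation of γ. -/
theorem regComon_comul_one : MonObj.one ≫ (D.regComon hG).comul.hom =
    tb (P := D.reRing.reg) (Q := D.reRing.reg) MonObj.one MonObj.one := by
  refine D.κκ_cancel hG ?_
  have h1 : (D.regComon hG).comul.hom ≫ (D.κκ hG).hom.hom = D.iA.hom ≫ G.map ComonObj.comul :=
    congrArg Bimod.Hom.hom (D.comul_κκ hG)
  have h3 : (D.κκ hG).hom.hom = (D.κ.hom ⊗ₘ D.κ.hom).hom ≫ (D.θ hG g g).hom.hom := rfl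
  rw [Category.assoc, h1, h3, ← Category.assoc, ← Category.assoc, tb_tensorHom, D.iA_one,
    D.univ_comul]
  refine Eq.trans ?_ (D.tb_θ hG _ _).symm
  rw [κ_hom, D.iA_one]

/-- The right bialgebroid of endomorphisms of the representing object. -/
@[reducible]
noncomputable def bialgebroid : RightBialgebroid R A where
  toReRing := D.reRing
  comon := D.regComon hG
  takeuchi := D.regComon_takeuchi hG
  comul_one := D.regComon_comul_one hG
  comul_mul := D.regComon_comul_mul hG
  counit_one := by
    rw [← cancel_mono D.iR.hom, D.el_ε hG D.el_one_A, Category.id_comp, D.univ_counit, D.iR_one]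
  counit_s := by
    refine tm_ext fun a b => ?_
    obtain ⟨α, ha⟩ := D.exists_el_A a
    obtain ⟨β, hb⟩ := D.exists_el_A b
    rw [← cancel_mono D.iR.hom]
    simp only [← Category.assoc, tm_whiskerRight]
    rw [D.el_ε hG (D.el_mul_A (D.el_s (D.el_ε hG ha)) hb), D.el_ε hG (D.el_mul_A ha hb)]
    refine congrArg (fun z => D.univ ≫ G.map z) ?_
    -- The identity is π ∘ s(π ∘ α) ∘ β = π ∘ α ∘ β, since π ∘ s(ρ) = ρ.
    exact ((Category.assoc _ _ _).trans (congrArg (β ≫ ·) (convS_comp_counit _))).trans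
      (Category.assoc _ _ _).symm
  counit_t := by
    refine tm_ext fun a b => ?_
    obtain ⟨α, ha⟩ := D.exists_el_A a
    obtain ⟨β, hb⟩ := D.exists_el_A b
    rw [← cancel_mono D.iR.hom]
    simp only [← Category.assoc, tm_whiskerRight]
    rw [D.el_ε hG (D.el_mul_A (D.el_t (D.el_ε hG ha)) hb), D.el_ε hG (D.el_mul_A ha hb)]
    refine congrArg (fun z => D.univ ≫ G.map z) ?_
    exact ((Category.assoc _ _ _).trans (congrArg (β ≫ ·) (convT_comp_counit _))).trans
      (Category.assoc _ _ _).symm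

/-- The functor from `C` to the category of right `A`-modules. -/
noncomputable def repFunctor : C ⥤ (D.bialgebroid hG).Rep where
  obj c := D.mod c
  map h := D.modMap h
  map_id c := RightMod.hom_ext (G.map_id c)
  map_comp f h := RightMod.hom_ext (G.map_comp f h)

/-- The action on the unit module is ε(s(ρ) α) = π ∘ s(ρ) ∘ α = ρ ∘ α, that is, precomposition, as
on G e. -/
theorem unitAct_θ₀ : (D.bialgebroid hG).unitMod.act ≫ D.iR.hom =
    D.iR.hom ▷ A.X ≫ D.act (𝟙_ C) := by
  refine tm_ext (X := R.X) fun r a => ?_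
  obtain ⟨ρ, hr⟩ := D.exists_el_R r
  obtain ⟨α, ha⟩ := D.exists_el_A a
  have h1 := (D.bialgebroid hG).el_unitAct r a
  have h2 := D.el_ε hG (D.el_mul_A (D.el_s hr) ha)
  have h3 : tm r a ≫ (D.bialgebroid hG).unitMod.act ≫ D.iR.hom =
      D.univ ≫ G.map ((α ≫ convS ρ) ≫ ComonObj.counit) :=
    (Category.assoc _ _ _).symm.trans ((congrArg (· ≫ D.iR.hom) h1).trans h2)
  rw [h3, ← Category.assoc, tm_whiskerRight, hr, D.univ_act, ← Category.assoc, ha, Category.assoc α,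
    convS_comp_counit, Category.assoc, G.map_comp]

/-- The strong monoidal structure of the functor from `C` to right `A`-modules. -/
noncomputable def repCoreMonoidal : (D.repFunctor hG).CoreMonoidal :=
  coreMonoidalOfFaithful (D.repFunctor hG) (D.bialgebroid hG).Φ (D.coreMonoidal hG)
    ((D.bialgebroid hG).liftIso (M := (D.bialgebroid hG).unitMod) (N := D.mod (𝟙_ C))
      ((D.bialgebroid hG).unitIso.symm ≪≫ D.θ₀) (by
        have e : ((D.bialgebroid hG).unitIso.symm ≪≫ D.θ₀).hom.hom = D.iR.hom :=
          Category.id_comp _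
        rw [e]
        exact D.unitAct_θ₀ hG))
    (fun a b => (D.bialgebroid hG).liftIso (M := (D.bialgebroid hG).tens (D.mod a) (D.mod b))
      (N := D.mod (a ⊗ b))
      (((D.bialgebroid hG).tensIso (D.mod a) (D.mod b)).symm ≪≫ D.θ hG a b) (by
        have e : (((D.bialgebroid hG).tensIso (D.mod a) (D.mod b)).symm ≪≫ D.θ hG a b).hom.hom =
          (D.θ hG a b).hom.hom := Category.id_comp _
        rw [e]
        exact D.takAct_θ hG a b))
    -- The lifted constraints begin with the inverses of those of Φ, so composing with Φ's own
    -- constraints returns those of the bimodule functor.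
    ((D.bialgebroid hG).unitIso.hom_inv_id_assoc D.θ₀.hom)
    (fun a b => ((D.bialgebroid hG).tensIso (D.mod a) (D.mod b)).hom_inv_id_assoc
      (D.θ hG a b).hom)

/-- The factorization `G ≅ Γ Φ K`. -/
noncomputable def factorIso : G ≅ D.repFunctor hG ⋙ (D.bialgebroid hG).Φ ⋙ Γ R :=
  NatIso.ofComponents (fun c => Iso.refl (G.obj c))
    (fun f => (Category.comp_id _).trans (Category.id_comp _).symm)

/-- The constraints of Φ are identities of V. What remains is the unit of R followed by `iR`, and
the projection onto the tensor product followed by `θV`; these are G₀ and μ. -/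
theorem factorIso_isMonoidal :
    letI := (D.repCoreMonoidal hG).toMonoidal
    NatTrans.IsMonoidal (D.factorIso hG).hom := by
  let := (D.repCoreMonoidal hG).toMonoidal
  constructor
  · change ε G ≫ 𝟙 _ = (MonObj.one ≫ 𝟙 R.X) ≫ 𝟙 R.X ≫ D.iR.hom
    rw [Category.comp_id, Category.comp_id, Category.id_comp, D.iR_one]
  · intro a b
    change μ G a b ≫ 𝟙 _ = (𝟙 _ ⊗ₘ 𝟙 _) ≫ (tπ (D.bi a) (D.bi b) ≫ 𝟙 _) ≫ 𝟙 _ ≫ D.θV a b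
    rw [Category.comp_id, id_tensorHom_id, Category.id_comp, Category.comp_id, Category.id_comp,
      tπ_θV]

end Bialgebroid
end EndoRep
end BGD

namespace BGD
open Functor.LaxMonoidal

/-! ### Modules over a commutative ring. -/

section ModuleCase
open TensorProduct
variable {k : Type v} [CommRing k]

/-- The elements of a `k`-module as morphisms `k ⟶ X`. -/
def modEl (X : ModuleCat.{v} k) : X ≃ (𝟙_ (ModuleCat.{v} k) ⟶ X) where
  toFun x := ModuleCat.ofHom (LinearMap.toSpanSingleton k X x)
  invFun f := f.hom (1 : k)
  left_inv x := one_smul k x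
  right_inv f := ModuleCat.hom_ext (LinearMap.ext_ring (one_smul k (f.hom (1 : k))))

theorem modEl_ext {X : ModuleCat.{v} k} {f h : 𝟙_ (ModuleCat.{v} k) ⟶ X}
    (e : f.hom (1 : k) = h.hom (1 : k)) : f = h :=
  (modEl X).symm.injective e

theorem modEl_comp {X Y : ModuleCat.{v} k} (x : X) (f : X ⟶ Y) :
    modEl X x ≫ f = modEl Y (f.hom x) :=
  modEl_ext (by
    change f.hom ((1 : k) • x) = (1 : k) • f.hom x
    rw [one_smul, one_smul])

theorem tm_modEl {X Y : ModuleCat.{v} k} (x : X) (y : Y) :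
    tm (modEl X x) (modEl Y y) = modEl (X ⊗ Y) (x ⊗ₜ[k] y) :=
  modEl_ext (by
    change ((1 : k) • x) ⊗ₜ[k] ((1 : k) • y) = (1 : k) • x ⊗ₜ[k] y
    rw [one_smul, one_smul, one_smul])

variable {C : Type u} [Category.{v} C] [Preadditive C] [Linear k C]
  {G : C ⥤ ModuleCat.{v} k} {g : C} (φ : (linearCoyoneda k C).obj (Opposite.op g) ≅ G)

/-- The representation of elements given by a `k`-linear representation. -/
@[reducible]
def modElRep [MonoidalCategory C] : ElRep G g where
  el c := (((φ.app c).toLinearEquiv.toEquiv : (g ⟶ c) ≃ G.obj c)).trans (modEl _)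
  el_comp {c d} f h := by
    refine Eq.trans ?_ (modEl_comp _ _).symm
    exact congrArg (modEl _)
      (congrArg (fun m => m.hom f) (φ.hom.naturality h))

/-- The isomorphisms `C(g, c) ≅ G c`. -/
def modEquiv (c : C) : (g ⟶ c) ≃ₗ[k] G.obj c := (φ.app c).toLinearEquiv

theorem modEquiv_map {c d : C} (f : g ⟶ c) (h : c ⟶ d) :
    (G.map h).hom (modEquiv φ c f) = modEquiv φ d (f ≫ h) :=
  (congrArg (fun m => m.hom f) (φ.hom.naturality h)).symm

/-- Composition as an action of the endomorphism algebra. -/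
noncomputable def modAct [MonoidalCategory C] (c : C) : G.obj c ⊗ (algMon k (End g)).X ⟶ G.obj c :=
  ModuleCat.ofHom (TensorProduct.lift (LinearMap.mk₂ k
    (fun (x : G.obj c) (a : End g) => modEquiv φ c (End.asHom a ≫ (modEquiv φ c).symm x))
    (fun x y a => by rw [map_add, Preadditive.comp_add, map_add])
    (fun r x a => by rw [map_smul, Linear.comp_smul, map_smul])
    (fun x a b => (congrArg (modEquiv φ c) (Preadditive.add_comp _ _ _ (End.asHom a) _ _)).trans
      (map_add _ _ _))
    (fun r x a => (congrArg (modEquiv φ c) (Linear.smul_comp _ _ _ r (End.asHom a) _)).trans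
      (map_smul _ _ _))))

theorem modAct_tmul [MonoidalCategory C] (c : C) (f : g ⟶ c) (a : g ⟶ g) :
    (modAct φ c).hom (modEquiv φ c f ⊗ₜ[k] (show End g from a)) = modEquiv φ c (a ≫ f) := by
  change modEquiv φ c (a ≫ (modEquiv φ c).symm (modEquiv φ c f)) = _
  rw [LinearEquiv.symm_apply_apply]

variable [MonoidalCategory C] [MonoidalPreadditive C] [MonoidalLinear k C] [G.LaxMonoidal]

/-- The vectors are turned into morphisms from k, where pure tensors are the elements x ⊗ y and
naturality of μ applies. -/
theorem modEquiv_comul [ComonObj g]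
    (h : modEl _ (modEquiv φ g (𝟙 g)) ≫ G.map ComonObj.comul =
      tm (modEl _ (modEquiv φ g (𝟙 g))) (modEl _ (modEquiv φ g (𝟙 g))) ≫ μ G g g)
    {a b : C} (α : g ⟶ a) (β : g ⟶ b) :
    modEquiv φ (a ⊗ b) (ComonObj.comul ≫ (α ⊗ₘ β)) =
      (μ G a b).hom (modEquiv φ a α ⊗ₜ[k] modEquiv φ b β) := by
  apply (modEl _).injective
  have h1 : ∀ {c : C} (f : g ⟶ c), modEl _ (modEquiv φ c f) =
      modEl _ (modEquiv φ g (𝟙 g)) ≫ G.map f := fun f => by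
    rw [modEl_comp, modEquiv_map, Category.id_comp]
  rw [← modEl_comp, ← tm_modEl, h1, h1 α, h1 β, G.map_comp, ← Category.assoc, h, Category.assoc,
    ← μ_natural, ← Category.assoc, tm_tensorHom]

/-- The left side is the product of the convolution algebra with its tensor factors written as
whiskerings, the unit object being a monoid through its unitor. The lemma matches it with the
product of G e. -/
theorem modEquiv_conv [ComonObj g]
    (h : modEl _ (modEquiv φ g (𝟙 g)) ≫ G.map ComonObj.comul =
      tm (modEl _ (modEquiv φ g (𝟙 g))) (modEl _ (modEquiv φ g (𝟙 g))) ≫ μ G g g)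
    (ρ σ : g ⟶ 𝟙_ C) :
    modEquiv φ (𝟙_ C) (ComonObj.comul ≫ ρ ▷ g ≫ 𝟙_ C ◁ σ ≫ (λ_ (𝟙_ C)).hom) =
      (G.map (λ_ (𝟙_ C)).hom).hom
        ((μ G (𝟙_ C) (𝟙_ C)).hom (modEquiv φ (𝟙_ C) ρ ⊗ₜ[k] modEquiv φ (𝟙_ C) σ)) := by
  rw [← modEquiv_comul φ h, modEquiv_map, MonoidalCategory.tensorHom_def]
  simp only [Category.assoc]

/-- Linearity of G, and hence of the composite functor, is inherited from the representable one
through φ. -/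
instance (g : C) : ((linearCoyoneda k C).obj (Opposite.op g)).Linear k where
  map_smul f r := ModuleCat.hom_ext (LinearMap.ext fun x => Linear.comp_smul _ _ _ x r f)

/-- The representation of a `k`-linear monoidal functor. -/
noncomputable def modEndoRep [ComonObj g]
    (h : (modElRep φ).univ ≫ G.map ComonObj.comul =
      tm (modElRep φ).univ (modElRep φ).univ ≫ μ G g g)
    (h' : (modElRep φ).univ ≫ G.map ComonObj.counit = ε G) :
    EndoRep G g (algMon k (Conv g (𝟙_ C))) (algMon k (End g)) where
  toElRep := modElRep φ
  univ_comul := h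
  univ_counit := h'
  iR := φ.app (𝟙_ C)
  iR_one := by
    refine modEl_ext ?_
    refine Eq.trans ?_ (congrArg (fun m => m.hom (1 : k)) h')
    change modEquiv φ (𝟙_ C) (algebraMap k (Conv g (𝟙_ C)) 1) =
      (G.map ComonObj.counit).hom ((1 : k) • modEquiv φ g (𝟙 g))
    rw [one_smul, modEquiv_map, Category.id_comp, map_one]
    -- The convolution unit is the counit followed by the unit of the monoid e, which is an
    -- identity.
    exact congrArg (modEquiv φ (𝟙_ C)) (Category.comp_id _)
  iR_mul := by
    refine ModuleCat.hom_ext (TensorProduct.ext' fun ρ σ => ?_)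
    exact modEquiv_conv φ h ρ σ
  iA := φ.app g
  iA_one := by
    refine modEl_ext ?_
    change modEquiv φ g (algebraMap k (End g) 1) = (1 : k) • modEquiv φ g (𝟙 g)
    rw [one_smul, map_one]; rfl
  act := modAct φ
  univ_act {c} f a := by
    obtain ⟨a, rfl⟩ := (modEl _).surjective a
    rw [← ElRep.el_eq]
    change tm (modEl _ (modEquiv φ c f)) _ ≫ _ = _
    rw [tm_modEl, modEl_comp, modEl_comp]
    refine congrArg (modEl _) ((modAct_tmul φ c f a).trans ?_)
    exact (modEquiv_map φ (show g ⟶ g from a) f).symm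
  iA_mul := by
    refine ModuleCat.hom_ext (TensorProduct.ext' fun a b => ?_)
    exact (modAct_tmul φ g a b).symm

theorem module_factorization (hG : EssentiallyStrong G) :
      ∃ _ : ComonObj g,
        (∀ (a b : C) (α : g ⟶ a) (β : g ⟶ b),
          (φ.hom.app (a ⊗ b)).hom (ComonObj.comul ≫ (α ⊗ₘ β)) =
            (Functor.LaxMonoidal.μ G a b).hom
              ((φ.hom.app a).hom α ⊗ₜ[k] (φ.hom.app b).hom β)) ∧
        (φ.hom.app (𝟙_ C)).hom (ComonObj.counit (X := g)) =
          (Functor.LaxMonoidal.ε G).hom (1 : k) ∧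
        ∃ B : BGD.RightBialgebroid (BGD.algMon k (Conv g (𝟙_ C))) (BGD.algMon k (End g)),
          (∀ ρ : g ⟶ 𝟙_ C, B.s.hom ρ = (ComonObj.comul ≫ g ◁ ρ ≫ (ρ_ g).hom : g ⟶ g)) ∧
          (∀ ρ : g ⟶ 𝟙_ C, B.t.hom ρ = (ComonObj.comul ≫ ρ ▷ g ≫ (λ_ g).hom : g ⟶ g)) ∧
          ∃ (K : C ⥤ B.Rep) (_ : K.Monoidal)
            (e : G ≅ K ⋙ B.Φ ⋙ BGD.Γ (BGD.algMon k (Conv g (𝟙_ C)))),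
            NatTrans.IsMonoidal e.hom ∧
            (K ⋙ B.Φ ⋙ BGD.Γ (BGD.algMon k (Conv g (𝟙_ C)))).Additive ∧
            (K ⋙ B.Φ ⋙ BGD.Γ (BGD.algMon k (Conv g (𝟙_ C)))).Linear k := by
  let := (modElRep φ).comon
  have h : (modElRep φ).univ ≫ G.map ComonObj.comul =
      tm (modElRep φ).univ (modElRep φ).univ ≫ μ G g g := (modElRep φ).univ_comul
  have h' : (modElRep φ).univ ≫ G.map ComonObj.counit = ε G := (modElRep φ).univ_counit
  let D := modEndoRep φ h h'
  -- `hR` and `hA` translate between vectors of R and A and morphisms of C, so that `el_s` and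
  -- `el_t` yield the formulas for s and t.
  have hR : ∀ ρ : g ⟶ 𝟙_ C, modEl (algMon k (Conv g (𝟙_ C))).X ρ ≫ D.iR.hom =
      D.univ ≫ G.map ρ := fun ρ =>
    (modEl_comp (X := (algMon k (Conv g (𝟙_ C))).X) ρ D.iR.hom).trans
      ((modElRep φ).el_eq ρ)
  have hA : ∀ (b : End g) (α : g ⟶ g), modEl (algMon k (End g)).X b ≫ D.iA.hom =
      D.univ ≫ G.map α → b = α := fun b α e => by
    have e2 := (modEl_comp (X := (algMon k (End g)).X) b D.iA.hom).symm.trans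
      (e.trans ((modElRep φ).el_eq α).symm)
    exact (modEquiv φ g).injective ((modEl _).injective e2)
  refine ⟨inferInstance, fun a b α β => modEquiv_comul φ h α β, ?_, D.bialgebroid hG, fun ρ => ?_,
    fun ρ => ?_, D.repFunctor hG, (D.repCoreMonoidal hG).toMonoidal, D.factorIso hG,
    D.factorIso_isMonoidal hG, ?_, ?_⟩
  · refine (modEl _).injective (((modElRep φ).el_eq _).trans (h'.trans ?_))
    exact ((modEl _).apply_symm_apply (ε G)).symm
  · refine hA _ _ (Eq.trans ?_ (D.el_s (hR ρ)))
    exact congrArg (· ≫ D.iA.hom)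
      (modEl_comp (X := (algMon k (Conv g (𝟙_ C))).X) ρ D.s).symm
  · refine hA _ _ (Eq.trans ?_ (D.el_t (hR ρ)))
    exact congrArg (· ≫ D.iA.hom)
      (modEl_comp (X := (algMon k (Conv g (𝟙_ C))).X) ρ D.t).symm
  · have : G.Additive := Functor.additive_of_iso φ
    exact Functor.additive_of_iso (D.factorIso hG)
  · have : G.Linear k := Functor.linear_of_iso k φ
    exact Functor.linear_of_iso k (D.factorIso hG)

end ModuleCase
end BGD

namespace BGD
open Functor.LaxMonoidal

/-! ### Abelian groups. -/

section AbCase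
open TensorProduct

/-- The elements of an abelian group as morphisms `ℤ ⟶ X`. -/
noncomputable def abEl (X : AddCommGrpCat.{v}) : X ≃ (𝟙_ AddCommGrpCat.{v} ⟶ X) where
  toFun x := AddCommGrpCat.ofHom ((zmultiplesHom X x).comp AddEquiv.ulift.toAddMonoidHom)
  invFun f := f.hom (ULift.up 1)
  left_inv x := one_zsmul x
  right_inv f := by
    refine AddCommGrpCat.hom_ext (AddMonoidHom.ext fun z => ?_)
    -- A homomorphism out of the lifted integers is determined by its value at 1.
    refine (map_zsmul f.hom z.down (ULift.up (1 : ℤ))).symm.trans (congrArg f.hom ?_)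
    exact ULift.ext _ _ (mul_one z.down)

theorem abEl_ext {X : AddCommGrpCat.{v}} {f h : 𝟙_ AddCommGrpCat.{v} ⟶ X}
    (e : f.hom (ULift.up 1) = h.hom (ULift.up 1)) : f = h :=
  (abEl X).symm.injective e

theorem abEl_comp {X Y : AddCommGrpCat.{v}} (x : X) (f : X ⟶ Y) :
    abEl X x ≫ f = abEl Y (f.hom x) :=
  abEl_ext (by
    change f.hom ((1 : ℤ) • x) = (1 : ℤ) • f.hom x
    rw [one_zsmul, one_zsmul])

theorem tm_abEl {X Y : AddCommGrpCat.{v}} (x : X) (y : Y) :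
    tm (abEl X x) (abEl Y y) = abEl (X ⊗ Y) (x ⊗ₜ[ℤ] y) :=
  abEl_ext (by
    change ((1 : ℤ) • x) ⊗ₜ[ℤ] ((1 : ℤ) • y) = (1 : ℤ) • x ⊗ₜ[ℤ] y
    rw [one_zsmul, one_zsmul, one_zsmul])

variable {C : Type u} [Category.{v} C] [Preadditive C]
  {G : C ⥤ AddCommGrpCat.{v}} {g : C} (φ : preadditiveCoyoneda.obj (Opposite.op g) ≅ G)

/-- The isomorphisms `C(g, c) ≅ G c`. -/
def abEquiv (c : C) : (g ⟶ c) ≃+ G.obj c := (φ.app c).addCommGroupIsoToAddEquiv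

theorem abEquiv_map {c d : C} (f : g ⟶ c) (h : c ⟶ d) :
    (G.map h).hom (abEquiv φ c f) = abEquiv φ d (f ≫ h) :=
  (congrArg (fun m => m.hom f) (φ.hom.naturality h)).symm

variable [MonoidalCategory C]

/-- The representation of elements given by an additive representation. -/
@[reducible]
noncomputable def abElRep : ElRep G g where
  el c := (abEquiv φ c).toEquiv.trans (abEl _)
  el_comp f h := ((abEl_comp _ _).trans (congrArg (abEl _) (abEquiv_map φ f h))).symm

/-- Composition as an action of the endomorphism ring. -/
noncomputable def abAct (c : C) : G.obj c ⊗ (ringMon (End g)).X ⟶ G.obj c :=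
  AddCommGrpCat.ofHom (TensorProduct.lift (LinearMap.mk₂ ℤ
    (fun (x : G.obj c) (a : End g) => abEquiv φ c (End.asHom a ≫ (abEquiv φ c).symm x))
    (fun x y a => by rw [map_add, Preadditive.comp_add, map_add])
    (fun r x a => by rw [map_zsmul, Preadditive.comp_zsmul, map_zsmul])
    (fun x a b => (congrArg (abEquiv φ c) (Preadditive.add_comp _ _ _ (End.asHom a) _ _)).trans
      (map_add _ _ _))
    (fun r x a => (congrArg (abEquiv φ c) (Preadditive.zsmul_comp (End.asHom a) _ r)).trans
      (map_zsmul _ _ _)))).toAddMonoidHom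

theorem abAct_tmul (c : C) (f : g ⟶ c) (a : g ⟶ g) :
    (abAct φ c).hom (abEquiv φ c f ⊗ₜ[ℤ] (show End g from a)) = abEquiv φ c (a ≫ f) := by
  change abEquiv φ c (a ≫ (abEquiv φ c).symm (abEquiv φ c f)) = _
  rw [AddEquiv.symm_apply_apply]

variable [MonoidalPreadditive C] [G.LaxMonoidal]

/-- Yoneda reduces arbitrary α and β to the universal element, and naturality of μ does the rest. -/
theorem abEquiv_comul [ComonObj g]
    (h : (abElRep φ).univ ≫ G.map ComonObj.comul =
      tm (abElRep φ).univ (abElRep φ).univ ≫ μ G g g)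
    {a b : C} (α : g ⟶ a) (β : g ⟶ b) :
    abEquiv φ (a ⊗ b) (ComonObj.comul ≫ (α ⊗ₘ β)) =
      (μ G a b).hom (abEquiv φ a α ⊗ₜ[ℤ] abEquiv φ b β) := by
  apply (abEl _).injective
  have h1 : ∀ {c : C} (f : g ⟶ c), abEl _ (abEquiv φ c f) =
      (abElRep φ).univ ≫ G.map f := fun f => (abElRep φ).el_eq f
  rw [← abEl_comp, ← tm_abEl, h1, h1 α, h1 β, G.map_comp, ← Category.assoc, h, Category.assoc,
    ← μ_natural, ← Category.assoc, tm_tensorHom]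

theorem abEquiv_conv [ComonObj g]
    (h : (abElRep φ).univ ≫ G.map ComonObj.comul =
      tm (abElRep φ).univ (abElRep φ).univ ≫ μ G g g)
    (ρ σ : g ⟶ 𝟙_ C) :
    abEquiv φ (𝟙_ C) (ComonObj.comul ≫ ρ ▷ g ≫ 𝟙_ C ◁ σ ≫ (λ_ (𝟙_ C)).hom) =
      (G.map (λ_ (𝟙_ C)).hom).hom
        ((μ G (𝟙_ C) (𝟙_ C)).hom (abEquiv φ (𝟙_ C) ρ ⊗ₜ[ℤ] abEquiv φ (𝟙_ C) σ)) := by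
  rw [← abEquiv_comul φ h, abEquiv_map, MonoidalCategory.tensorHom_def]
  simp only [Category.assoc]

/-- The representation of an additive monoidal functor. -/
noncomputable def abEndoRep [ComonObj g]
    (h : (abElRep φ).univ ≫ G.map ComonObj.comul =
      tm (abElRep φ).univ (abElRep φ).univ ≫ μ G g g)
    (h' : (abElRep φ).univ ≫ G.map ComonObj.counit = ε G) :
    EndoRep G g (ringMon (Conv g (𝟙_ C))) (ringMon (End g)) where
  toElRep := abElRep φ
  univ_comul := h
  univ_counit := h'
  iR := φ.app (𝟙_ C)
  iR_one := by
    refine abEl_ext ?_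
    refine Eq.trans ?_ (congrArg (fun m => m.hom (ULift.up 1)) h')
    change abEquiv φ (𝟙_ C) (((1 : ℤ) : Conv g (𝟙_ C))) =
      (G.map ComonObj.counit).hom ((1 : ℤ) • abEquiv φ g (𝟙 g))
    rw [one_zsmul, abEquiv_map, Category.id_comp, Int.cast_one]
    -- Here too the convolution unit carries a trailing identity, the unit of the monoid e.
    exact congrArg (abEquiv φ (𝟙_ C)) (Category.comp_id _)
  iR_mul := abt_ext fun ρ σ => abEquiv_conv φ h ρ σ
  iA := φ.app g
  iA_one := by
    refine abEl_ext ?_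
    change abEquiv φ g (((1 : ℤ) : End g)) = (1 : ℤ) • abEquiv φ g (𝟙 g)
    rw [one_zsmul, Int.cast_one]; rfl
  act := abAct φ
  univ_act {c} f a := by
    obtain ⟨a, rfl⟩ := (abEl _).surjective a
    rw [← ElRep.el_eq]
    change tm (abEl _ (abEquiv φ c f)) _ ≫ _ = _
    rw [tm_abEl, abEl_comp, abEl_comp]
    refine congrArg (abEl _) ((abAct_tmul φ c f a).trans ?_)
    exact (abEquiv_map φ (show g ⟶ g from a) f).symm
  iA_mul := abt_ext fun a b => (abAct_tmul φ g a b).symm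

theorem abelianGroup_factorization (hG : EssentiallyStrong G) :
      ∃ _ : ComonObj g,
        (∀ (a b : C) (α : g ⟶ a) (β : g ⟶ b),
          (φ.hom.app (a ⊗ b)).hom (ComonObj.comul ≫ (α ⊗ₘ β)) =
            (Functor.LaxMonoidal.μ G a b).hom
              ((φ.hom.app a).hom α ⊗ₜ[ℤ] (φ.hom.app b).hom β)) ∧
        (φ.hom.app (𝟙_ C)).hom (ComonObj.counit (X := g)) =
          (Functor.LaxMonoidal.ε G).hom (ULift.up 1) ∧
        ∃ B : BGD.RightBialgebroid (BGD.ringMon (Conv g (𝟙_ C))) (BGD.ringMon (End g)),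
          (∀ ρ : g ⟶ 𝟙_ C, B.s.hom ρ = (ComonObj.comul ≫ g ◁ ρ ≫ (ρ_ g).hom : g ⟶ g)) ∧
          (∀ ρ : g ⟶ 𝟙_ C, B.t.hom ρ = (ComonObj.comul ≫ ρ ▷ g ≫ (λ_ g).hom : g ⟶ g)) ∧
          ∃ (K : C ⥤ B.Rep) (_ : K.Monoidal)
            (e : G ≅ K ⋙ B.Φ ⋙ BGD.Γ (BGD.ringMon (Conv g (𝟙_ C)))),
            NatTrans.IsMonoidal e.hom ∧
            (K ⋙ B.Φ ⋙ BGD.Γ (BGD.ringMon (Conv g (𝟙_ C)))).Additive := by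
  let := (abElRep φ).comon
  have h : (abElRep φ).univ ≫ G.map ComonObj.comul =
      tm (abElRep φ).univ (abElRep φ).univ ≫ μ G g g := (abElRep φ).univ_comul
  have h' : (abElRep φ).univ ≫ G.map ComonObj.counit = ε G := (abElRep φ).univ_counit
  let D := abEndoRep φ h h'
  have hR : ∀ ρ : g ⟶ 𝟙_ C, abEl (ringMon (Conv g (𝟙_ C))).X ρ ≫ D.iR.hom =
      D.univ ≫ G.map ρ := fun ρ =>
    (abEl_comp (X := (ringMon (Conv g (𝟙_ C))).X) ρ D.iR.hom).trans
      ((abElRep φ).el_eq ρ)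
  have hA : ∀ (b : End g) (α : g ⟶ g), abEl (ringMon (End g)).X b ≫ D.iA.hom =
      D.univ ≫ G.map α → b = α := fun b α e => by
    have e2 := (abEl_comp (X := (ringMon (End g)).X) b D.iA.hom).symm.trans
      (e.trans ((abElRep φ).el_eq α).symm)
    exact (abEquiv φ g).injective ((abEl _).injective e2)
  refine ⟨inferInstance, fun a b α β => abEquiv_comul φ h α β, ?_, D.bialgebroid hG, fun ρ => ?_,
    fun ρ => ?_, D.repFunctor hG, (D.repCoreMonoidal hG).toMonoidal, D.factorIso hG,
    D.factorIso_isMonoidal hG, ?_⟩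
  · refine (abEl _).injective (((abElRep φ).el_eq _).trans (h'.trans ?_))
    exact ((abEl _).apply_symm_apply (ε G)).symm
  · refine hA _ _ (Eq.trans ?_ (D.el_s (hR ρ)))
    exact congrArg (· ≫ D.iA.hom)
      (abEl_comp (X := (ringMon (Conv g (𝟙_ C))).X) ρ D.s).symm
  · refine hA _ _ (Eq.trans ?_ (D.el_t (hR ρ)))
    exact congrArg (· ≫ D.iA.hom)
      (abEl_comp (X := (ringMon (Conv g (𝟙_ C))).X) ρ D.t).symm
  -- G is additive because it is isomorphic to a representable additive functor; the composite is
  -- isomorphic to G.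
  · have : G.Additive := Functor.additive_of_iso φ
    exact Functor.additive_of_iso (D.factorIso hG)

end AbCase

/-! ### Sets. -/

section SetCase

/-- The elements of a set as morphisms from the point. -/
def setEl (X : Type v) : X ≃ (𝟙_ (Type v) ⟶ X) where
  toFun x := TypeCat.ofHom fun _ => x
  invFun f := f PUnit.unit
  left_inv x := rfl
  right_inv f := rfl

theorem setEl_comp {X Y : Type v} (x : X) (f : X ⟶ Y) : setEl X x ≫ f = setEl Y (f x) := rfl

theorem tm_setEl {X Y : Type v} (x : X) (y : Y) :
    tm (setEl X x) (setEl Y y) = setEl (X ⊗ Y) (x, y) := rfl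

variable {C : Type u} [Category.{v} C]
  {G : C ⥤ Type v} {g : C} (φ : coyoneda.obj (Opposite.op g) ≅ G)

/-- The bijections `C(g, c) ≅ G c`. -/
def setEquiv (c : C) : (g ⟶ c) ≃ G.obj c := (φ.app c).toEquiv

theorem setEquiv_map {c d : C} (f : g ⟶ c) (h : c ⟶ d) :
    G.map h (setEquiv φ c f) = setEquiv φ d (f ≫ h) :=
  (ConcreteCategory.congr_hom (φ.hom.naturality h) f).symm

variable [MonoidalCategory C]

/-- The representation of elements given by a representation. -/
@[reducible]
def setElRep : ElRep G g where
  el c := (setEquiv φ c).trans (setEl _)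
  el_comp f h := ((setEl_comp _ _).trans (congrArg (setEl _) (setEquiv_map φ f h))).symm

/-- Composition as an action of the endomorphism monoid. -/
noncomputable def setAct (c : C) : G.obj c ⊗ (setMon (End g)).X ⟶ G.obj c :=
  TypeCat.ofHom fun p => setEquiv φ c (End.asHom (show End g from p.2) ≫ (setEquiv φ c).symm p.1)

theorem setAct_apply (c : C) (f : g ⟶ c) (a : g ⟶ g) :
    setAct φ c (setEquiv φ c f, a) = setEquiv φ c (a ≫ f) := by
  change setEquiv φ c (a ≫ (setEquiv φ c).symm (setEquiv φ c f)) = _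
  rw [Equiv.symm_apply_apply]

variable [G.LaxMonoidal]

/-- Elements of a cartesian product are pairs, so the value of μ on a pair is read off from the
universal element by naturality. -/
theorem setEquiv_comul [ComonObj g]
    (h : (setElRep φ).univ ≫ G.map ComonObj.comul =
      tm (setElRep φ).univ (setElRep φ).univ ≫ μ G g g)
    {a b : C} (α : g ⟶ a) (β : g ⟶ b) :
    setEquiv φ (a ⊗ b) (ComonObj.comul ≫ (α ⊗ₘ β)) =
      μ G a b (setEquiv φ a α, setEquiv φ b β) := by
  apply (setEl _).injective
  have h1 : ∀ {c : C} (f : g ⟶ c), setEl _ (setEquiv φ c f) =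
      (setElRep φ).univ ≫ G.map f := fun f => (setElRep φ).el_eq f
  rw [← setEl_comp, ← tm_setEl, h1, h1 α, h1 β, G.map_comp, ← Category.assoc, h, Category.assoc,
    ← μ_natural, ← Category.assoc, tm_tensorHom]

theorem setEquiv_conv [ComonObj g]
    (h : (setElRep φ).univ ≫ G.map ComonObj.comul =
      tm (setElRep φ).univ (setElRep φ).univ ≫ μ G g g)
    (ρ σ : g ⟶ 𝟙_ C) :
    setEquiv φ (𝟙_ C) (ComonObj.comul ≫ ρ ▷ g ≫ 𝟙_ C ◁ σ ≫ (λ_ (𝟙_ C)).hom) =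
      G.map (λ_ (𝟙_ C)).hom
        (μ G (𝟙_ C) (𝟙_ C) (setEquiv φ (𝟙_ C) ρ, setEquiv φ (𝟙_ C) σ)) := by
  rw [← setEquiv_comul φ h, setEquiv_map, MonoidalCategory.tensorHom_def]
  simp only [Category.assoc]

/-- The representation of a set-valued monoidal functor. -/
noncomputable def setEndoRep [ComonObj g]
    (h : (setElRep φ).univ ≫ G.map ComonObj.comul =
      tm (setElRep φ).univ (setElRep φ).univ ≫ μ G g g)
    (h' : (setElRep φ).univ ≫ G.map ComonObj.counit = ε G) :
    EndoRep G g (setMon (Conv g (𝟙_ C))) (setMon (End g)) where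
  toElRep := setElRep φ
  univ_comul := h
  univ_counit := h'
  iR := φ.app (𝟙_ C)
  iR_one := by
    refine (setEl _).symm.injective ?_
    refine Eq.trans ?_ (congrArg (setEl _).symm h')
    change setEquiv φ (𝟙_ C) (ComonObj.counit ≫ 𝟙 (𝟙_ C)) =
      G.map ComonObj.counit (setEquiv φ g (𝟙 g))
    rw [setEquiv_map, Category.id_comp, Category.comp_id]
  iR_mul := by
    refine ConcreteCategory.hom_ext _ _ fun p => ?_
    exact setEquiv_conv φ h p.1 p.2
  iA := φ.app g
  iA_one := rfl
  act := setAct φ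
  univ_act {c} f a := by
    obtain ⟨a, rfl⟩ := (setEl _).surjective a
    rw [← ElRep.el_eq]
    change setEl _ (setAct φ c (setEquiv φ c f, a)) = _
    rw [setAct_apply]
    exact congrArg (setEl _) (setEquiv_map φ (show g ⟶ g from a) f).symm
  iA_mul := by
    refine ConcreteCategory.hom_ext _ _ fun p => ?_
    exact (setAct_apply φ g p.1 p.2).symm

theorem set_factorization (hG : EssentiallyStrong G) :
      ∃ _ : ComonObj g,
        (∀ (a b : C) (α : g ⟶ a) (β : g ⟶ b),
          φ.hom.app (a ⊗ b) (ComonObj.comul ≫ (α ⊗ₘ β)) =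
            Functor.LaxMonoidal.μ G a b (φ.hom.app a α, φ.hom.app b β)) ∧
        φ.hom.app (𝟙_ C) (ComonObj.counit (X := g)) =
          Functor.LaxMonoidal.ε G PUnit.unit ∧
        ∃ B : BGD.RightBialgebroid (BGD.setMon (Conv g (𝟙_ C))) (BGD.setMon (End g)),
          (∀ ρ : g ⟶ 𝟙_ C, B.s ρ = (ComonObj.comul ≫ g ◁ ρ ≫ (ρ_ g).hom : g ⟶ g)) ∧
          (∀ ρ : g ⟶ 𝟙_ C, B.t ρ = (ComonObj.comul ≫ ρ ▷ g ≫ (λ_ g).hom : g ⟶ g)) ∧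
          ∃ (K : C ⥤ B.Rep) (_ : K.Monoidal)
            (e : G ≅ K ⋙ B.Φ ⋙ BGD.Γ (BGD.setMon (Conv g (𝟙_ C)))),
            NatTrans.IsMonoidal e.hom := by
  let := (setElRep φ).comon
  have h : (setElRep φ).univ ≫ G.map ComonObj.comul =
      tm (setElRep φ).univ (setElRep φ).univ ≫ μ G g g := (setElRep φ).univ_comul
  have h' : (setElRep φ).univ ≫ G.map ComonObj.counit = ε G := (setElRep φ).univ_counit
  let D := setEndoRep φ h h'
  have hR : ∀ ρ : g ⟶ 𝟙_ C, setEl (setMon (Conv g (𝟙_ C))).X ρ ≫ D.iR.hom =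
      D.univ ≫ G.map ρ := fun ρ =>
    (setEl_comp (X := (setMon (Conv g (𝟙_ C))).X) ρ D.iR.hom).trans
      ((setElRep φ).el_eq ρ)
  -- Injectivity of the representation recovers an endomorphism from its value at u.
  have hA : ∀ (b : End g) (α : g ⟶ g), setEl (setMon (End g)).X b ≫ D.iA.hom =
      D.univ ≫ G.map α → b = α := fun b α e => by
    have e2 := (setEl_comp (X := (setMon (End g)).X) b D.iA.hom).symm.trans
      (e.trans ((setElRep φ).el_eq α).symm)
    exact (setEquiv φ g).injective ((setEl _).injective e2)
  refine ⟨inferInstance, fun a b α β => setEquiv_comul φ h α β, ?_, D.bialgebroid hG, fun ρ => ?_,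
    fun ρ => ?_, D.repFunctor hG, (D.repCoreMonoidal hG).toMonoidal, D.factorIso hG,
    D.factorIso_isMonoidal hG⟩
  · refine (setEl _).injective (((setElRep φ).el_eq _).trans (h'.trans ?_))
    exact ((setEl _).apply_symm_apply (ε G)).symm
  · refine hA _ _ (Eq.trans ?_ (D.el_s (hR ρ)))
    exact congrArg (· ≫ D.iA.hom)
      (setEl_comp (X := (setMon (Conv g (𝟙_ C))).X) ρ D.s).symm
  · refine hA _ _ (Eq.trans ?_ (D.el_t (hR ρ)))
    exact congrArg (· ≫ D.iA.hom)
      (setEl_comp (X := (setMon (Conv g (𝟙_ C))).X) ρ D.t).symm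

end SetCase
end BGD

/-! ### The three cases together. -/

theorem mainTheorem3 :
    -- `V` the category of `k`-modules
    (∀ (k : Type v) [CommRing k] (C : Type u) [Category.{v} C] [Preadditive C] [Linear k C]
      [MonoidalCategory C] [MonoidalPreadditive C] [MonoidalLinear k C]
      (G : C ⥤ ModuleCat.{v} k) [G.LaxMonoidal], BGD.EssentiallyStrong G →
      ∀ (g : C) (φ : (linearCoyoneda k C).obj (Opposite.op g) ≅ G),
      ∃ _ : ComonObj g,
        (∀ (a b : C) (α : g ⟶ a) (β : g ⟶ b),
          (φ.hom.app (a ⊗ b)).hom (ComonObj.comul ≫ (α ⊗ₘ β)) =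
            (Functor.LaxMonoidal.μ G a b).hom
              ((φ.hom.app a).hom α ⊗ₜ[k] (φ.hom.app b).hom β)) ∧
        (φ.hom.app (𝟙_ C)).hom (ComonObj.counit (X := g)) =
          (Functor.LaxMonoidal.ε G).hom (1 : k) ∧
        ∃ B : BGD.RightBialgebroid (BGD.algMon k (Conv g (𝟙_ C))) (BGD.algMon k (End g)),
          (∀ ρ : g ⟶ 𝟙_ C, B.s.hom ρ = (ComonObj.comul ≫ g ◁ ρ ≫ (ρ_ g).hom : g ⟶ g)) ∧
          (∀ ρ : g ⟶ 𝟙_ C, B.t.hom ρ = (ComonObj.comul ≫ ρ ▷ g ≫ (λ_ g).hom : g ⟶ g)) ∧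
          ∃ (K : C ⥤ B.Rep) (_ : K.Monoidal)
            (e : G ≅ K ⋙ B.Φ ⋙ BGD.Γ (BGD.algMon k (Conv g (𝟙_ C)))),
            NatTrans.IsMonoidal e.hom ∧
            (K ⋙ B.Φ ⋙ BGD.Γ (BGD.algMon k (Conv g (𝟙_ C)))).Additive ∧
            (K ⋙ B.Φ ⋙ BGD.Γ (BGD.algMon k (Conv g (𝟙_ C)))).Linear k) ∧
    -- `V` the category of abelian groups
    (∀ (C : Type u) [Category.{v} C] [Preadditive C] [MonoidalCategory C] [MonoidalPreadditive C]
      (G : C ⥤ AddCommGrpCat.{v}) [G.LaxMonoidal], BGD.EssentiallyStrong G →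
      ∀ (g : C) (φ : preadditiveCoyoneda.obj (Opposite.op g) ≅ G),
      ∃ _ : ComonObj g,
        (∀ (a b : C) (α : g ⟶ a) (β : g ⟶ b),
          (φ.hom.app (a ⊗ b)).hom (ComonObj.comul ≫ (α ⊗ₘ β)) =
            (Functor.LaxMonoidal.μ G a b).hom
              ((φ.hom.app a).hom α ⊗ₜ[ℤ] (φ.hom.app b).hom β)) ∧
        (φ.hom.app (𝟙_ C)).hom (ComonObj.counit (X := g)) =
          (Functor.LaxMonoidal.ε G).hom (ULift.up 1) ∧
        ∃ B : BGD.RightBialgebroid (BGD.ringMon (Conv g (𝟙_ C))) (BGD.ringMon (End g)),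
          (∀ ρ : g ⟶ 𝟙_ C, B.s.hom ρ = (ComonObj.comul ≫ g ◁ ρ ≫ (ρ_ g).hom : g ⟶ g)) ∧
          (∀ ρ : g ⟶ 𝟙_ C, B.t.hom ρ = (ComonObj.comul ≫ ρ ▷ g ≫ (λ_ g).hom : g ⟶ g)) ∧
          ∃ (K : C ⥤ B.Rep) (_ : K.Monoidal)
            (e : G ≅ K ⋙ B.Φ ⋙ BGD.Γ (BGD.ringMon (Conv g (𝟙_ C)))),
            NatTrans.IsMonoidal e.hom ∧
            (K ⋙ B.Φ ⋙ BGD.Γ (BGD.ringMon (Conv g (𝟙_ C)))).Additive) ∧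
    -- `V` the category of sets
    (∀ (C : Type u) [Category.{v} C] [MonoidalCategory C]
      (G : C ⥤ Type v) [G.LaxMonoidal], BGD.EssentiallyStrong G →
      ∀ (g : C) (φ : coyoneda.obj (Opposite.op g) ≅ G),
      ∃ _ : ComonObj g,
        (∀ (a b : C) (α : g ⟶ a) (β : g ⟶ b),
          φ.hom.app (a ⊗ b) (ComonObj.comul ≫ (α ⊗ₘ β)) =
            Functor.LaxMonoidal.μ G a b (φ.hom.app a α, φ.hom.app b β)) ∧
        φ.hom.app (𝟙_ C) (ComonObj.counit (X := g)) =
          Functor.LaxMonoidal.ε G PUnit.unit ∧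
        ∃ B : BGD.RightBialgebroid (BGD.setMon (Conv g (𝟙_ C))) (BGD.setMon (End g)),
          (∀ ρ : g ⟶ 𝟙_ C, B.s ρ = (ComonObj.comul ≫ g ◁ ρ ≫ (ρ_ g).hom : g ⟶ g)) ∧
          (∀ ρ : g ⟶ 𝟙_ C, B.t ρ = (ComonObj.comul ≫ ρ ▷ g ≫ (λ_ g).hom : g ⟶ g)) ∧
          ∃ (K : C ⥤ B.Rep) (_ : K.Monoidal)
            (e : G ≅ K ⋙ B.Φ ⋙ BGD.Γ (BGD.setMon (Conv g (𝟙_ C)))),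
            NatTrans.IsMonoidal e.hom) :=
  ⟨fun _ _ _ _ _ _ _ _ _ _ _ hG _ φ => BGD.module_factorization φ hG,
    fun _ _ _ _ _ _ _ hG _ φ => BGD.abelianGroup_factorization φ hG,
    fun _ _ _ _ _ hG _ φ => BGD.set_factorization φ hG⟩
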